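/- For real $t$ let $\vartheta(t)$ be the Riemann–Siegel theta function, i.e. the continuous real function with $\vartheta(0)=0$ and $e^{i\vartheta(t)}=\pi^{-it/2}\,\Gamma(\tfrac14+\tfrac{it}2)/|\Gamma(\tfrac14+\tfrac{it}2)|$, and let $Z(t)=e^{i\vartheta(t)}\zeta(\tfrac12+it)$. For $t>2\pi$ and $\tfrac12<\sigma<2$ define $$G(t):=\frac1{2\pi i}\int_{-\infty-i\sigma}^{+\infty-i\sigma}\Bigl(\frac t{2\pi}\Bigr)^{ix/2}\zeta\bigl(\tfrac12+i(t+x)\bigr)\,\frac{\pi}{2\sinh(\pi x/2)}\,dx .$$ Then, for every $t>2\pi$, this integral converges absolutely for every $\sigma\in(\tfrac12,2)$ and its value does not depend on the choice of $\sigma$; and for every $\varepsilon>0$, $$Z(t)=2\,\Re\bigl\{e^{i\vartheta(t)}G(t)\bigr\}+O\bigl(t^{-5/6+\varepsilon}\bigr)\qquad(t\to+\infty),$$ where the implied constant and the threshold on $t$ depend only on $\varepsilon$. -/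

import Mathlib

open Complex Filter Asymptotics MeasureTheory

namespace RiemannSiegelApprox

noncomputable section

/-- The Riemann-Siegel theta function on the real line: the primitive, vanishing at `0`, of
`Re (Γ'/Γ (1/4 + i t / 2)) / 2 - (log π) / 2`. Equivalently, it is the continuous function with
`ϑ 0 = 0` and `e ^ (i ϑ t) = π ^ (- i t / 2) * Γ (1/4 + i t / 2) / |Γ (1/4 + i t / 2)|`;
see `theta_zero`, `continuous_theta` and `exp_theta`. -/
def theta (t : ℝ) : ℝ :=
  ∫ u in (0 : ℝ)..t, ((digamma (1 / 4 + I * (u / 2))).re - Real.log Real.pi) / 2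

/-- Hardy's function `Z(t) = e ^ (i ϑ(t)) ζ(1/2 + i t)`. -/
def hardyZ (t : ℝ) : ℂ :=
  exp (I * theta t) * riemannZeta (1 / 2 + I * t)

/-- The integrand `(t / 2π) ^ (i x / 2) * ζ(1/2 + i (t + x)) * π / (2 sinh (π x / 2))`. -/
def integrandG (t : ℝ) (x : ℂ) : ℂ :=
  ((t / (2 * Real.pi) : ℝ) : ℂ) ^ (I * x / 2) * riemannZeta (1 / 2 + I * (t + x)) *
    (Real.pi / (2 * sinh (Real.pi * x / 2)))

/-- `G(t)`, the integral along the horizontal line `Im x = -σ`, oriented from left to right and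
parametrized by `x = y - i σ` with `y` real. -/
def G (σ t : ℝ) : ℂ :=
  1 / (2 * Real.pi * I) * ∫ y : ℝ, integrandG t (y - I * σ)

theorem theta_zero : theta 0 = 0 := by simp [theta]

theorem gamma_line_ne (m : ℕ) (u : ℝ) : (1 / 4 + I * (u / 2) : ℂ) ≠ -m := by
  intro h
  have h1 := congrArg re h
  have h2 : (0 : ℝ) ≤ m := m.cast_nonneg
  simp at h1
  linarith

theorem hasDerivAt_gamma_line (u : ℝ) :
    HasDerivAt (fun u : ℝ => Gamma (1 / 4 + I * (u / 2)))
      (I / 2 * digamma (1 / 4 + I * (u / 2)) * Gamma (1 / 4 + I * (u / 2))) u := by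
  have h1 := (differentiableAt_Gamma _ (fun m => gamma_line_ne m u)).hasDerivAt
  have h2 : HasDerivAt (fun u : ℝ => (1 / 4 + I * (u / 2) : ℂ)) (I * (1 / 2)) u :=
    (((hasDerivAt_id u).ofReal_comp.div_const 2).const_mul I).const_add _
  refine (h1.comp u h2).congr_deriv ?_
  have h3 := Gamma_ne_zero (fun m => gamma_line_ne m u)
  rw [digamma_def, logDeriv_apply, mul_assoc, div_mul_cancel₀ _ h3]
  ring

theorem continuous_digamma_line : Continuous (fun u : ℝ => digamma (1 / 4 + I * (u / 2))) := by
  rw [continuous_iff_continuousAt]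
  intro u
  have ho : IsOpen {s : ℂ | 0 < s.re} := isOpen_lt continuous_const continuous_re
  have hd : DifferentiableOn ℂ Gamma {s : ℂ | 0 < s.re} := fun s hs =>
    (differentiableAt_Gamma s (fun m h => by
      have h2 : (0 : ℝ) ≤ m := m.cast_nonneg
      have h3 : 0 < s.re := hs
      rw [h] at h3
      simp at h3
      linarith)).differentiableWithinAt
  have hmem : (1 / 4 + I * (u / 2) : ℂ) ∈ {s : ℂ | 0 < s.re} := by simp
  have h1 : ContinuousAt (deriv Gamma) (1 / 4 + I * (u / 2) : ℂ) :=
    ((hd.deriv ho).differentiableAt (ho.mem_nhds hmem)).continuousAt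
  have h2 : ContinuousAt Gamma (1 / 4 + I * (u / 2) : ℂ) :=
    (hd.differentiableAt (ho.mem_nhds hmem)).continuousAt
  have h3 : ContinuousAt digamma (1 / 4 + I * (u / 2) : ℂ) := by
    have := h1.div h2 (Gamma_ne_zero (fun m => gamma_line_ne m u))
    exact this
  exact ContinuousAt.comp (f := fun u : ℝ => (1 / 4 + I * (u / 2) : ℂ)) h3 (by fun_prop)

theorem hasDerivAt_theta (t : ℝ) :
    HasDerivAt theta (((digamma (1 / 4 + I * (t / 2))).re - Real.log Real.pi) / 2) t := by
  have hc : Continuous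
      (fun u : ℝ => ((digamma (1 / 4 + I * (u / 2))).re - Real.log Real.pi) / 2) :=
    ((continuous_re.comp continuous_digamma_line).sub continuous_const).div_const 2
  exact hc.integral_hasStrictDerivAt 0 t |>.hasDerivAt

theorem continuous_theta : Continuous theta :=
  continuous_iff_continuousAt.2 fun t => (hasDerivAt_theta t).continuousAt

/-- The defining formula of `e ^ (i ϑ(t))`. -/
theorem exp_theta (t : ℝ) :
    exp (I * theta t) =
      (Real.pi : ℂ) ^ (-(I * t / 2)) * Gamma (1 / 4 + I * (t / 2)) /
        ‖Gamma (1 / 4 + I * (t / 2))‖ := by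
  set m : ℝ → ℝ := fun t => ∫ u in (0 : ℝ)..t, (digamma (1 / 4 + I * (u / 2))).im / 2 with hm
  have hmc : Continuous (fun u : ℝ => (digamma (1 / 4 + I * (u / 2))).im / 2) :=
    (continuous_im.comp continuous_digamma_line).div_const 2
  have hmd (t : ℝ) : HasDerivAt m ((digamma (1 / 4 + I * (t / 2))).im / 2) t :=
    (hmc.integral_hasStrictDerivAt 0 t).hasDerivAt
  set E : ℝ → ℂ := fun t => m t - I * theta t - I * (t / 2) * Real.log Real.pi with hE
  have hEd (t : ℝ) : HasDerivAt E (-(I / 2 * digamma (1 / 4 + I * (t / 2)))) t := by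
    have h := ((hmd t).ofReal_comp.sub ((hasDerivAt_theta t).ofReal_comp.const_mul I)).sub
      ((((hasDerivAt_id t).ofReal_comp.div_const 2).const_mul I).mul_const
        (Real.log Real.pi : ℂ))
    refine h.congr_deriv ?_
    apply Complex.ext <;> simp <;> ring
  set F : ℝ → ℂ := fun t => Gamma (1 / 4 + I * (t / 2)) * exp (E t) with hF
  have hFd (t : ℝ) : HasDerivAt F 0 t := by
    refine ((hasDerivAt_gamma_line t).mul (hEd t).cexp).congr_deriv ?_
    ring
  have hconst : F t = F 0 :=
    is_const_of_deriv_eq_zero (fun t => (hFd t).differentiableAt) (fun t => (hFd t).deriv) t 0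
  have hF0 : F 0 = (Real.Gamma (1 / 4) : ℂ) := by
    rw [← Complex.Gamma_ofReal]
    simp [hF, hE, hm, theta_zero]
  have hpos : 0 < Real.Gamma (1 / 4) := Real.Gamma_pos_of_pos (by norm_num)
  have hG : Gamma (1 / 4 + I * (t / 2)) =
      (Real.Gamma (1 / 4) * Real.exp (-m t) : ℝ) *
        exp (I * theta t + I * (t / 2) * Real.log Real.pi) := by
    have h1 : Gamma (1 / 4 + I * (t / 2)) * exp (E t) = Real.Gamma (1 / 4) := hconst.trans hF0
    have h2 : Gamma (1 / 4 + I * (t / 2)) = Real.Gamma (1 / 4) * exp (-E t) := by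
      rw [← h1, mul_assoc, ← exp_add]; simp
    rw [h2]
    push_cast
    rw [mul_assoc, ← exp_add]
    congr 2
    simp only [hE]
    ring
  have hr : 0 < Real.Gamma (1 / 4) * Real.exp (-m t) := mul_pos hpos (Real.exp_pos _)
  have hn : ‖exp (I * theta t + I * (t / 2) * Real.log Real.pi)‖ = 1 := by
    rw [norm_exp]; simp
  have hpi : (Real.pi : ℂ) ^ (-(I * t / 2)) = exp (-(I * (t / 2) * Real.log Real.pi)) := by
    rw [cpow_def_of_ne_zero (by exact_mod_cast Real.pi_ne_zero), ofReal_log Real.pi_pos.le]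
    congr 1; ring
  rw [hG, norm_mul, hn, mul_one, norm_real, Real.norm_of_nonneg hr.le, hpi, mul_left_comm,
    ← exp_add, mul_div_cancel_left₀ _ (by exact_mod_cast hr.ne')]
  congr 1; ring

end

end RiemannSiegelApprox

/-! Write `p = t/2π`, `s = 1/2 + i(t+x)` and `K(x) = π / (2 sinh (πx/2))`; the kernel `K` has
residue `1` at `0` and no other pole in `|Im x| < 2`. Integrate `p^(ix/2) ζ(s) K(x)` over the lines
`Im x = -1` and `Im x = 1`. The difference is `2πi ζ(1/2 + it)`, by the residue at `0`. The lower
line gives `2πi G(t)`. On the upper line the functional equation `ζ(s) = χ(s) ζ(1-s)` and Stirling's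
`χ(s) ≈ χ(1/2 + it) p^(-ix)` turn the integrand into `χ(1/2 + it)` times the conjugate of the lower
one. Since `e^(iϑ) χ(1/2 + it) = e^(-iϑ)`, the two lines add up to `2 Re (e^(iϑ) G)`. The pole of
`ζ`, at `x = -t - i/2`, lies between the lines, so `ζ(s)` is replaced by `(s-1) ζ(s) / (s₀-1)` with
`s₀ = 1/2 + it`; this costs a factor `1 + x/(t + i/2)`. The resulting exact identity is
`hardyZ_sub_eq`.

Both error terms are integrals of `p^(-ix/2) ζ(1/2 - i(t+x)) Q(x)` over `Im x = 1`, where `Q = (g -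
g(0)) K` has size `O(1/t)` (`norm_chiRatio_sub_one_le`). Absolute values would only give `t^(-1/2)`,
because `p^(-ix/2)` has modulus `p^(1/2)` there. Instead `ζ`, at real part `3/2`, is expanded into
`∑ n^(it) a_n` with `a_n = ∫ p^(-ix/2) n^(-1/2+ix) Q`. As `Q` is holomorphic down to the real line,
`a_n - a_(n+1)` can be estimated on either line, which gives `t^(-1) min(n^(-3/2), p^(1/2)
n^(-5/2))` (`norm_integral_dirichletTerm_sub_le`). Partial summation against `∑_{k ≤ n} k^(it) ≪
t^(1/6) n^(1/2)` for `n ≤ t^(2/3)` (`norm_sum_expTurn_log_le`) and the trivial bound beyond yields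
`t^(-1) t^(1/6+ε)`.

The bound for `∑ k^(it)` comes from Weyl differencing, the second derivative test and the
Kusmin–Landau inequality. The other estimates for `Γ`, digamma, `ζ` and `χ` give Stirling's formula
and the decay needed to move contours. -/

namespace RiemannSiegelApprox

/-! ### Exponential sums: Kusmin–Landau and the second derivative test. -/

/-- The additive character `e(x) = exp(2πix)`. -/
noncomputable def expTurn (x : ℝ) : ℂ := exp ((2 * Real.pi * x : ℝ) * I)

theorem norm_expTurn (x : ℝ) : ‖expTurn x‖ = 1 := norm_exp_ofReal_mul_I _

theorem expTurn_add (x y : ℝ) : expTurn (x + y) = expTurn x * expTurn y := by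
  rw [expTurn, expTurn, expTurn, ← exp_add]
  push_cast
  ring_nf

theorem expTurn_int (k : ℤ) : expTurn k = 1 := by
  rw [expTurn, exp_eq_one_iff]
  exact ⟨k, by push_cast; ring⟩

theorem expTurn_sub (x y : ℝ) :
    expTurn (x - y) = expTurn x * (starRingEnd ℂ) (expTurn y) := by
  rw [expTurn, expTurn, expTurn, ← exp_conj, ← exp_add, map_mul, conj_ofReal, conj_I]
  push_cast
  ring_nf

/-- The point is the constant real part: increments of `1/(1 - e(x))` are purely imaginary, so along
monotone phases the total variation telescopes through the cotangent. -/
theorem inv_one_sub_expTurn {x : ℝ} (hx : Real.sin (Real.pi * x) ≠ 0) :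
    (1 - expTurn x)⁻¹ = 1 / 2 + (Real.cot (Real.pi * x) / 2 : ℝ) * I := by
  have h1 : expTurn x = (Real.cos (Real.pi * x) + Real.sin (Real.pi * x) * I) ^ 2 := by
    rw [expTurn, ofReal_cos, ofReal_sin, ← exp_mul_I, ← exp_nat_mul]
    push_cast
    ring_nf
  have h2 : (Real.sin (Real.pi * x) : ℂ) ^ 2 + (Real.cos (Real.pi * x) : ℂ) ^ 2 = 1 := by
    exact_mod_cast Real.sin_sq_add_cos_sq (Real.pi * x)
  have h3 : (Real.sin (Real.pi * x) : ℂ) ≠ 0 := by exact_mod_cast hx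
  rw [Real.cot_eq_cos_div_sin, h1]
  refine inv_eq_of_mul_eq_one_right ?_
  push_cast
  push_cast at h2 h3
  set S := sin (Real.pi * x : ℂ)
  set K := cos (Real.pi * x : ℂ)
  have : (1 - (K + S * I) ^ 2) = 2 * S * (S - K * I) := by
    linear_combination (-S ^ 2) * I_sq + (-1 : ℂ) * h2
  rw [this]
  field_simp
  linear_combination h2 - K ^ 2 * I_sq

theorem two_mul_le_sin_pi_mul {θ x : ℝ} (h0 : 0 ≤ θ) (h1 : θ ≤ x) (h2 : x ≤ 1 - θ) :
    2 * θ ≤ Real.sin (Real.pi * x) := by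
  have hpi := Real.pi_pos
  rcases le_total x (1 / 2) with hx | hx
  · have := Real.mul_le_sin (x := Real.pi * x) (by nlinarith) (by nlinarith)
    have h3 : 2 / Real.pi * (Real.pi * x) = 2 * x := by field_simp
    linarith
  · have := Real.mul_le_sin (x := Real.pi * (1 - x)) (by nlinarith) (by nlinarith)
    have h3 : 2 / Real.pi * (Real.pi * (1 - x)) = 2 * (1 - x) := by field_simp
    have h4 : Real.sin (Real.pi * (1 - x)) = Real.sin (Real.pi * x) := by
      rw [mul_sub, mul_one, Real.sin_pi_sub]
    linarith

/-- The discrete **Kusmin–Landau inequality**. -/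
theorem norm_sum_expTurn_le_of_mem_Icc (f : ℕ → ℝ) (k : ℤ) {θ : ℝ} (hθ : 0 < θ) {a b : ℕ}
    (hmem : ∀ n, a ≤ n → n < b → k + θ ≤ f (n + 1) - f n ∧ f (n + 1) - f n ≤ k + 1 - θ)
    (hmono : ∀ n, a ≤ n → n + 1 < b → f (n + 1) - f n ≤ f (n + 2) - f (n + 1)) :
    ‖∑ n ∈ Finset.Ico a b, expTurn (f n)‖ ≤ 1 / θ := by
  rcases le_or_gt b a with hab | hab
  · rw [Finset.Ico_eq_empty_of_le hab]
    simp [hθ.le]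
  obtain ⟨g, hg⟩ : ∃ g : ℕ → ℝ, g = fun n => f (n + 1) - f n - k := ⟨_, rfl⟩
  have hgm : ∀ n, a ≤ n → n < b → θ ≤ g n ∧ g n ≤ 1 - θ := fun n h1 h2 => by
    have := hmem n h1 h2
    constructor <;> simp only [hg] <;> linarith
  have hsin : ∀ n, a ≤ n → n < b → 2 * θ ≤ Real.sin (Real.pi * g n) := fun n h1 h2 =>
    two_mul_le_sin_pi_mul hθ.le (hgm n h1 h2).1 (hgm n h1 h2).2
  set c : ℕ → ℂ := fun n => (1 - expTurn (g n))⁻¹ with hc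
  set w : ℕ → ℝ := fun n => Real.cot (Real.pi * g n) with hw
  have hcw : ∀ n, a ≤ n → n < b → c n = 1 / 2 + (w n / 2 : ℝ) * I := fun n h1 h2 =>
    inv_one_sub_expTurn (by have := hsin n h1 h2; intro h; linarith)
  have hcn : ∀ n, a ≤ n → n < b → ‖c n‖ ≤ 1 / (4 * θ) ∧ |w n| ≤ 1 / (2 * θ) := by
    intro n h1 h2
    have hs := hsin n h1 h2
    have hs0 : 0 < Real.sin (Real.pi * g n) := by linarith
    have hsq : ‖c n‖ ^ 2 = (1 / (2 * Real.sin (Real.pi * g n))) ^ 2 := by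
      have hr : w n = Real.cos (Real.pi * g n) / Real.sin (Real.pi * g n) :=
        Real.cot_eq_cos_div_sin _
      have hns : normSq (1 / 2 + (w n / 2 : ℝ) * I) = 1 / 4 + w n ^ 2 / 4 := by
        have h12 : (1 / 2 : ℂ) = ((1 / 2 : ℝ) : ℂ) := by norm_num
        rw [h12, normSq_add_mul_I]
        ring
      rw [hcw n h1 h2, ← normSq_eq_norm_sq, hns, hr]
      field_simp
      linear_combination 4 * Real.sin_sq_add_cos_sq (Real.pi * g n)
    have hn : ‖c n‖ = 1 / (2 * Real.sin (Real.pi * g n)) :=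
      (sq_eq_sq₀ (norm_nonneg _) (by positivity)).1 hsq
    have h4 : 1 / (2 * Real.sin (Real.pi * g n)) ≤ 1 / (4 * θ) :=
      one_div_le_one_div_of_le (by positivity) (by linarith)
    refine ⟨hn ▸ h4, ?_⟩
    have him := abs_im_le_norm (c n)
    rw [hn, hcw n h1 h2] at him
    simp only [add_im, one_im, div_ofNat_im, mul_im, ofReal_re, I_im, mul_one, ofReal_im, I_re,
      mul_zero, add_zero, zero_div, zero_add, abs_div, abs_two] at him
    have h5 : 1 / (2 * θ) = 2 * (1 / (4 * θ)) := by field_simp; norm_num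
    rw [h5]
    linarith
  -- Each term becomes `c n` times a difference of consecutive exponentials, ready for Abel
  -- summation; the integer `k` is invisible to `expTurn`.
  have hE : ∀ n, a ≤ n → n < b →
      expTurn (f n) = c n * expTurn (f n) - c n * expTurn (f (n + 1)) := by
    intro n h1 h2
    have h3 : expTurn (f (n + 1)) = expTurn (g n) * expTurn (f n) := by
      have : f (n + 1) = g n + (k + f n) := by simp only [hg]; ring
      rw [this, expTurn_add, expTurn_add, expTurn_int, one_mul]
    have h4 : 1 - expTurn (g n) ≠ 0 := by
      intro h
      have h5 := hcw n h1 h2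
      simp only [hc, h, inv_zero] at h5
      have := congrArg re h5
      simp at this
    rw [h3]
    simp only [hc]
    field_simp
  -- With the boundary term included, passing from `m` to `m + 1` adds exactly `(c (m+1) - c m) e(f
  -- (m+1))`. Its norm is `(w m - w (m+1)) / 2`, since the cotangent decreases on `(0, π)` and `g`
  -- is monotone.
  have key : ∀ m, a ≤ m → m < b →
      ‖∑ n ∈ Finset.Ico a (m + 1), expTurn (f n) + c m * expTurn (f (m + 1))‖ ≤
        ‖c a‖ + (w a - w m) / 2 := by
    intro m hm
    induction m, hm using Nat.le_induction with
    | base =>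
      intro h
      rw [Finset.sum_Ico_succ_top le_rfl, Finset.Ico_self, Finset.sum_empty, zero_add]
      nth_rewrite 1 [hE a le_rfl h]
      rw [sub_add_cancel, norm_mul, norm_expTurn]
      simp
    | succ m hm ih =>
      intro h
      have hmb : m < b := by omega
      have h1 : ∑ n ∈ Finset.Ico a (m + 1 + 1), expTurn (f n) + c (m + 1) * expTurn (f (m + 1 + 1))
          = (∑ n ∈ Finset.Ico a (m + 1), expTurn (f n) + c m * expTurn (f (m + 1))) +
            (c (m + 1) - c m) * expTurn (f (m + 1)) := by
        rw [Finset.sum_Ico_succ_top (by omega)]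
        linear_combination hE (m + 1) (by omega) h
      have h2 : ‖c (m + 1) - c m‖ = (w m - w (m + 1)) / 2 := by
        have h3 : c (m + 1) - c m = -((w m - w (m + 1)) / 2 : ℝ) * I := by
          rw [hcw _ (by omega) h, hcw m hm hmb]
          push_cast
          ring
        have h4 : 0 ≤ w m - w (m + 1) := by
          have s1 := hsin m hm hmb
          have s2 := hsin (m + 1) (by omega) h
          simp only [hw, Real.cot_eq_cos_div_sin]
          rw [div_sub_div _ _ (by linarith) (by linarith)]
          refine div_nonneg ?_ (mul_nonneg (by linarith) (by linarith))
          have : Real.cos (Real.pi * g m) * Real.sin (Real.pi * g (m + 1)) -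
              Real.sin (Real.pi * g m) * Real.cos (Real.pi * g (m + 1)) =
              Real.sin (Real.pi * (g (m + 1) - g m)) := by
            rw [mul_sub, Real.sin_sub]
            ring
          rw [this]
          have g1 := hgm m hm hmb
          have g2 := hgm (m + 1) (by omega) h
          have g3 := hmono m hm h
          have g4 : g m ≤ g (m + 1) := by simp only [hg]; linarith
          apply Real.sin_nonneg_of_nonneg_of_le_pi
          · exact mul_nonneg Real.pi_pos.le (by linarith)
          · have : g (m + 1) - g m ≤ 1 := by linarith
            nlinarith [Real.pi_pos]
        rw [h3, norm_mul, norm_I, mul_one, norm_neg, norm_real, Real.norm_of_nonneg (by linarith)]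
      rw [h1]
      refine (norm_add_le _ _).trans ?_
      rw [norm_mul, norm_expTurn, mul_one, h2]
      have := ih hmb
      linarith
  obtain ⟨m, rfl⟩ : ∃ m, b = m + 1 := ⟨b - 1, by omega⟩
  have h1 := key m (by omega) (by omega)
  have h2 := (hcn a le_rfl hab).1
  have h3 := hcn m (by omega) (by omega)
  have h4 := abs_le.1 (hcn a le_rfl hab).2
  have h5 := abs_le.1 h3.2
  have h6 : ‖∑ n ∈ Finset.Ico a (m + 1), expTurn (f n)‖ ≤
      ‖∑ n ∈ Finset.Ico a (m + 1), expTurn (f n) + c m * expTurn (f (m + 1))‖ + ‖c m‖ := by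
    have := norm_sub_le (∑ n ∈ Finset.Ico a (m + 1), expTurn (f n) + c m * expTurn (f (m + 1)))
      (c m * expTurn (f (m + 1)))
    rwa [add_sub_cancel_right, norm_mul, norm_expTurn, mul_one] at this
  have h7 : 1 / θ = 1 / (4 * θ) + 1 / (4 * θ) + (1 / (2 * θ) + 1 / (2 * θ)) / 2 := by
    field_simp; norm_num
  rw [h7]
  linarith [h3.1]

/-- The extreme elements of `B` are at most `θ / lam` apart. It counts the indices whose increment
is within `θ` of an integer, where Kusmin–Landau is not available. -/
theorem card_le_of_separated {θ lam : ℝ} (hlam : 0 < lam) (hθ : 0 ≤ θ) (B : Finset ℕ)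
    (hB : ∀ m ∈ B, ∀ n ∈ B, m ≤ n → lam * (n - m) ≤ θ) : (B.card : ℝ) ≤ θ / lam + 1 := by
  rcases B.eq_empty_or_nonempty with rfl | hne
  · simp; positivity
  have h1 : B ⊆ Finset.Icc (B.min' hne) (B.max' hne) := fun x hx =>
    Finset.mem_Icc.2 ⟨B.min'_le x hx, B.le_max' x hx⟩
  have h2 := Finset.card_le_card h1
  have h3 : B.min' hne ≤ B.max' hne := B.min'_le _ (B.max'_mem hne)
  rw [Nat.card_Icc] at h2
  have h4 := hB _ (B.min'_mem hne) _ (B.max'_mem hne) h3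
  have h5 : (B.card : ℝ) ≤ B.max' hne + 1 - B.min' hne := by
    rw [le_sub_iff_add_le]
    exact_mod_cast (by omega : B.card + B.min' hne ≤ B.max' hne + 1)
  have h6 : ((B.max' hne : ℕ) : ℝ) - (B.min' hne : ℕ) ≤ θ / lam := by
    rw [le_div_iff₀ hlam]
    linarith
  linarith

theorem eq_Ico_of_ordConnected (B : Finset ℕ)
    (hB : ∀ m ∈ B, ∀ n ∈ B, ∀ l, m ≤ l → l ≤ n → l ∈ B) : ∃ a b, B = Finset.Ico a b := by
  rcases B.eq_empty_or_nonempty with rfl | hne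
  · exact ⟨0, 0, by simp⟩
  refine ⟨B.min' hne, B.max' hne + 1, ?_⟩
  ext x
  rw [Finset.mem_Ico]
  refine ⟨fun hx => ⟨B.min'_le x hx, Nat.lt_succ_of_le (B.le_max' x hx)⟩, fun hx =>
    hB _ (B.min'_mem hne) _ (B.max'_mem hne) x hx.1 (Nat.le_of_lt_succ hx.2)⟩

/-- The discrete second derivative test of van der Corput. -/
theorem norm_sum_expTurn_le_of_second_diff (f : ℕ → ℝ) (N : ℕ) {lam Lam : ℝ} (hlam : 0 < lam)
    (hlow : ∀ n, n + 1 < N → lam ≤ (f (n + 2) - f (n + 1)) - (f (n + 1) - f n))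
    (hup : ∀ n, n + 1 < N → (f (n + 2) - f (n + 1)) - (f (n + 1) - f n) ≤ Lam)
    (hle : lam ≤ Lam) :
    ‖∑ n ∈ Finset.range N, expTurn (f n)‖ ≤ 5 * (Lam * N + 2) / Real.sqrt lam := by
  have hsq := Real.sqrt_pos.2 hlam
  have htriv : ∀ B : Finset ℕ, ‖∑ n ∈ B, expTurn (f n)‖ ≤ B.card := fun B => by
    refine (norm_sum_le _ _).trans ?_
    simp [norm_expTurn]
  -- For `lam ≥ 1` the trivial bound suffices, because `√lam ≤ lam ≤ Lam`.
  rcases le_or_gt 1 lam with h1 | h1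
  · refine (htriv _).trans ?_
    rw [Finset.card_range, le_div_iff₀ hsq]
    have h2 : Real.sqrt lam ≤ lam := by
      rw [Real.sqrt_le_left hlam.le]
      nlinarith
    have h3 : (0 : ℝ) ≤ N := N.cast_nonneg
    nlinarith [mul_le_mul_of_nonneg_left (h2.trans hle) h3]
  rcases N.eq_zero_or_pos with rfl | hN
  · simp; positivity
  obtain ⟨g, hg⟩ : ∃ g : ℕ → ℝ, g = fun n => f (n + 1) - f n := ⟨_, rfl⟩
  have hgrow : ∀ m n, m ≤ n → n < N → lam * (n - m) ≤ g n - g m := by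
    intro m n hmn
    induction n, hmn using Nat.le_induction with
    | base => intro; simp
    | succ n hmn ih =>
      intro h
      have h2 := ih (by omega)
      have h3 := hlow n h
      simp only [hg] at h2 ⊢
      push_cast
      linarith
  have hgmono : ∀ m n, m ≤ n → n < N → g m ≤ g n := fun m n hmn hn => by
    have h2 := hgrow m n hmn hn
    have h3 : (0 : ℝ) ≤ n - m := sub_nonneg.2 (by exact_mod_cast hmn)
    nlinarith
  have hgup : ∀ n, n < N → g n - g 0 ≤ Lam * n := by
    intro n
    induction n with
    | zero => intro; simp
    | succ n ih =>
      intro h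
      have h2 := ih (by omega)
      have h3 := hup n h
      simp only [hg] at h2 ⊢
      push_cast
      linarith
  -- This balances the at most `2 (θ/lam + 1)` indices near an integer against the Kusmin–Landau
  -- bound `1/θ`; the total is `3/√lam + 2 ≤ 5/√lam`.
  set θ : ℝ := Real.sqrt lam / 2 with hθ
  have hθ0 : 0 < θ := by positivity
  have hlamsq : Real.sqrt lam * Real.sqrt lam = lam := Real.mul_self_sqrt hlam.le
  have hs1 : Real.sqrt lam < 1 := by
    rw [Real.sqrt_lt' one_pos]; linarith
  have hfiber : ∀ k : ℤ, ‖∑ n ∈ (Finset.range N).filter (fun n => ⌊g n⌋ = k), expTurn (f n)‖ ≤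
      5 / Real.sqrt lam := by
    intro k
    set A := (Finset.range N).filter (fun n => ⌊g n⌋ = k) with hA
    have hAmem : ∀ n ∈ A, n < N ∧ (k : ℝ) ≤ g n ∧ g n < k + 1 := fun n hn => by
      rw [hA, Finset.mem_filter, Finset.mem_range, Int.floor_eq_iff] at hn
      exact hn
    set A₁ := A.filter (fun n => g n < k + θ) with hA₁
    set A₂ := A.filter (fun n => k + 1 - θ < g n) with hA₂
    set A₃ := A.filter (fun n => k + θ ≤ g n ∧ g n ≤ k + 1 - θ) with hA₃
    have c1 : (A₁.card : ℝ) ≤ θ / lam + 1 := by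
      refine card_le_of_separated hlam hθ0.le _ fun m hm n hn hmn => ?_
      rw [hA₁, Finset.mem_filter] at hm hn
      have h2 := hgrow m n hmn (hAmem n hn.1).1
      have h3 := (hAmem m hm.1).2.1
      linarith
    have c2 : (A₂.card : ℝ) ≤ θ / lam + 1 := by
      refine card_le_of_separated hlam hθ0.le _ fun m hm n hn hmn => ?_
      rw [hA₂, Finset.mem_filter] at hm hn
      have h2 := hgrow m n hmn (hAmem n hn.1).1
      have h3 := (hAmem n hn.1).2.2
      linarith
    have c3 : ‖∑ n ∈ A₃, expTurn (f n)‖ ≤ 1 / θ := by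
      have hmem3 : ∀ n, n ∈ A₃ ↔ n < N ∧ k + θ ≤ g n ∧ g n ≤ k + 1 - θ := by
        intro n
        rw [hA₃, Finset.mem_filter]
        refine ⟨fun h => ⟨(hAmem n h.1).1, h.2⟩, fun h => ⟨?_, h.2⟩⟩
        rw [hA, Finset.mem_filter, Finset.mem_range, Int.floor_eq_iff]
        exact ⟨h.1, by linarith, by linarith⟩
      obtain ⟨a, b, hab⟩ := eq_Ico_of_ordConnected A₃ (fun m hm n hn l hml hln => by
        rw [hmem3] at hm hn ⊢
        refine ⟨by omega, hm.2.1.trans (hgmono _ _ hml (by omega)),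
          (hgmono _ _ hln hn.1).trans hn.2.2⟩)
      rw [hab]
      refine norm_sum_expTurn_le_of_mem_Icc f k hθ0 (fun n h2 h3 => ?_) (fun n h2 h3 => ?_)
      · have := (hmem3 n).1 (hab ▸ Finset.mem_Ico.2 ⟨h2, h3⟩)
        simp only [hg] at this
        exact this.2
      · have h4 := (hmem3 (n + 1)).1 (hab ▸ Finset.mem_Ico.2 ⟨by omega, h3⟩)
        have := hlow n h4.1
        linarith
    have hsum : ∑ n ∈ A, expTurn (f n) = ∑ n ∈ A₁, expTurn (f n) + ∑ n ∈ A₂, expTurn (f n) +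
        ∑ n ∈ A₃, expTurn (f n) := by
      clear_value A
      rw [hA₁, hA₂, hA₃, Finset.sum_filter, Finset.sum_filter, Finset.sum_filter,
        ← Finset.sum_add_distrib, ← Finset.sum_add_distrib]
      refine Finset.sum_congr rfl fun n _ => ?_
      rcases lt_or_ge (g n) (k + θ) with h2 | h2
      · rw [if_pos h2, if_neg (by linarith), if_neg (by intro h; linarith [h.1])]
        simp
      · rcases lt_or_ge (k + 1 - θ) (g n) with h3 | h3
        · rw [if_neg (by linarith), if_pos h3, if_neg (by intro h; linarith [h.2])]
          simp
        · rw [if_neg (by linarith), if_neg (by linarith), if_pos ⟨h2, h3⟩]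
          simp
    rw [hsum]
    refine (norm_add_le _ _).trans ?_
    have h2 := norm_add_le (∑ n ∈ A₁, expTurn (f n)) (∑ n ∈ A₂, expTurn (f n))
    have h3 := (htriv A₁).trans c1
    have h4 := (htriv A₂).trans c2
    have h5 : θ / lam = 1 / (2 * Real.sqrt lam) := by
      rw [hθ]
      nth_rewrite 2 [← hlamsq]
      field_simp
    have h6 : 1 / θ = 2 / Real.sqrt lam := by rw [hθ]; field_simp
    have h7 : (1 : ℝ) ≤ 1 / Real.sqrt lam := by rw [le_div_iff₀ hsq]; linarith
    have h8 : 5 / Real.sqrt lam = 5 * (1 / Real.sqrt lam) := by ring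
    have h9 : 1 / (2 * Real.sqrt lam) = (1 / Real.sqrt lam) / 2 := by field_simp
    have h10 : 2 / Real.sqrt lam = 2 * (1 / Real.sqrt lam) := by ring
    rw [h8]
    rw [h5, h9] at h3 h4
    rw [h6, h10] at c3
    linarith
  -- The increments rise by at most `Lam * N` altogether, so they meet at most `Lam * N + 2` unit
  -- intervals.
  set K := Finset.Icc ⌊g 0⌋ ⌊g (N - 1)⌋ with hK
  have hmaps : ∀ n ∈ Finset.range N, ⌊g n⌋ ∈ K := fun n hn => by
    rw [Finset.mem_range] at hn
    rw [hK, Finset.mem_Icc]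
    exact ⟨Int.floor_mono (hgmono 0 n (by omega) hn),
      Int.floor_mono (hgmono n (N - 1) (by omega) (by omega))⟩
  rw [← Finset.sum_fiberwise_of_maps_to hmaps]
  refine (norm_sum_le _ _).trans ((Finset.sum_le_sum fun k _ => hfiber k).trans ?_)
  rw [Finset.sum_const, nsmul_eq_mul, hK, Int.card_Icc]
  have hcard : (((⌊g (N - 1)⌋ + 1 - ⌊g 0⌋).toNat : ℕ) : ℝ) ≤ Lam * N + 2 := by
    have h2 : ⌊g 0⌋ ≤ ⌊g (N - 1)⌋ := Int.floor_mono (hgmono _ _ (by omega) (by omega))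
    have h3 : (((⌊g (N - 1)⌋ + 1 - ⌊g 0⌋).toNat : ℕ) : ℝ) =
        ((⌊g (N - 1)⌋ + 1 - ⌊g 0⌋ : ℤ) : ℝ) := by
      rw [← Int.cast_natCast, Int.toNat_of_nonneg (by omega)]
    rw [h3]
    push_cast
    have h4 := Int.floor_le (g (N - 1))
    have h5 := Int.lt_floor_add_one (g 0)
    have h6 := hgup (N - 1) (by omega)
    have h7 : ((N - 1 : ℕ) : ℝ) ≤ N := by exact_mod_cast (by omega : N - 1 ≤ N)
    have h8 : Lam * ((N - 1 : ℕ) : ℝ) ≤ Lam * N :=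
      mul_le_mul_of_nonneg_left h7 (hlam.le.trans hle)
    linarith
  calc _ ≤ (Lam * N + 2) * (5 / Real.sqrt lam) :=
        mul_le_mul_of_nonneg_right hcard (by positivity)
    _ = _ := by ring

/-! ### Weyl differencing and the bound for sums of `n^(it)`. -/

/-- The **van der Corput inequality** (Weyl differencing). -/
theorem sq_norm_sum_le_of_correlations (z : ℕ → ℂ) (hz : ∀ n, ‖z n‖ ≤ 1) (N H : ℕ)
    (hH : 0 < H) (hHN : H ≤ N) (B : ℕ → ℝ) (hB0 : ∀ h, 0 ≤ B h)
    (hB : ∀ h, 0 < h → h < H →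
      ‖∑ n ∈ Finset.range (N - h), z (n + h) * (starRingEnd ℂ) (z n)‖ ≤ B h) :
    ‖∑ n ∈ Finset.range N, z n‖ ^ 2 ≤
      2 * N / H * (N + 2 * ∑ h ∈ Finset.range H, B h) := by
  -- Extension by zero to `ℤ` makes every shift available without boundary terms; the window `T`
  -- contains all the shifted supports.
  obtain ⟨w, hw⟩ : ∃ w : ℤ → ℂ, w = fun m : ℤ => if 0 ≤ m ∧ m < (N : ℤ) then z m.toNat else 0 := ⟨_, rfl⟩
  have hw1 : ∀ m, ‖w m‖ ≤ 1 := fun m => by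
    simp only [hw]
    split_ifs
    · exact hz _
    · simp
  set T := Finset.Ico (0 : ℤ) (N + H) with hT
  have hshift : ∀ (F : ℤ → ℂ), (∀ m : ℤ, ¬ (0 ≤ m ∧ m < (N : ℤ)) → F m = 0) → ∀ h : ℕ, h < H →
      ∑ m ∈ T, F (m - h) = ∑ n ∈ Finset.range N, F n := by
    intro F hF h hh
    symm
    refine Finset.sum_bij_ne_zero (fun n _ _ => (n : ℤ) + h) ?_ ?_ ?_ ?_
    · intro n hn _
      rw [Finset.mem_range] at hn
      rw [hT, Finset.mem_Ico]
      omega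
    · intro a _ _ b _ _ hab
      simpa using hab
    · intro m hm hne
      have h1 : 0 ≤ m - h ∧ m - h < (N : ℤ) := by
        by_contra hcon
        exact hne (hF _ hcon)
      refine ⟨(m - h).toNat, ?_, ?_, ?_⟩
      · rw [Finset.mem_range]; omega
      · rwa [Int.toNat_of_nonneg h1.1]
      · rw [Int.toNat_of_nonneg h1.1]; ring
    · intro n _ _
      congr 1
      ring
  have hwsum : ∑ n ∈ Finset.range N, w n = ∑ n ∈ Finset.range N, z n := by
    refine Finset.sum_congr rfl fun n hn => ?_
    rw [Finset.mem_range] at hn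
    simp only [hw]
    rw [if_pos (by omega), Int.toNat_natCast]
  set S := ∑ n ∈ Finset.range N, z n with hS
  -- Averaging over `H` shifts: Cauchy–Schwarz in `m` then produces correlations that depend only on
  -- `h' - h`.
  have hHS : (H : ℂ) * S = ∑ m ∈ T, ∑ h ∈ Finset.range H, w (m - h) := by
    rw [Finset.sum_comm, ← hwsum]
    rw [Finset.sum_congr rfl (fun h hh => hshift w (fun m hm => by
      simp only [hw]; rw [if_neg hm]) h (Finset.mem_range.1 hh))]
    simp
  have hcs : ‖(H : ℂ) * S‖ ^ 2 ≤
      (N + H) * ∑ m ∈ T, ‖∑ h ∈ Finset.range H, w (m - h)‖ ^ 2 := by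
    rw [hHS]
    have h1 := norm_sum_le T (fun m => ∑ h ∈ Finset.range H, w (m - h))
    have h2 := sq_sum_le_card_mul_sum_sq (s := T)
      (f := fun m => ‖∑ h ∈ Finset.range H, w (m - h)‖)
    have h3 : (T.card : ℝ) = N + H := by
      rw [hT, Int.card_Ico, sub_zero]
      exact_mod_cast congrArg Nat.cast (Int.toNat_natCast (N + H))
    rw [h3] at h2
    exact (pow_le_pow_left₀ (norm_nonneg _) h1 2).trans h2
  obtain ⟨D, hD⟩ : ∃ D : ℕ → ℝ, D = fun d => if d = 0 then (N : ℝ) else B d := ⟨_, rfl⟩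
  have hD0 : ∀ d, 0 ≤ D d := fun d => by
    simp only [hD]
    split_ifs
    · exact N.cast_nonneg
    · exact hB0 d
  have hcor : ∀ h h' : ℕ, h ≤ h' → h' < H →
      ‖∑ m ∈ T, w (m - h) * (starRingEnd ℂ) (w (m - h'))‖ ≤ D (h' - h) := by
    intro h h' hh hh'
    have h1 := hshift (fun m => w (m + (h' - h : ℕ)) * (starRingEnd ℂ) (w m)) (fun m hm => by
      simp only [hw]; rw [if_neg hm]; simp) h' hh'
    have h2 : ∑ m ∈ T, w (m - h) * (starRingEnd ℂ) (w (m - h')) =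
        ∑ n ∈ Finset.range N, w (n + (h' - h : ℕ)) * (starRingEnd ℂ) (w n) := by
      rw [← h1]
      refine Finset.sum_congr rfl fun m _ => ?_
      congr 2
      push_cast [hh]
      ring
    rw [h2]
    set d := h' - h with hd
    rcases Nat.eq_zero_or_pos d with h0 | hpos
    · simp only [hD, h0, if_true]
      refine (norm_sum_le _ _).trans ?_
      refine (Finset.sum_le_sum (g := fun _ => (1 : ℝ)) fun n _ => ?_).trans (by simp)
      rw [norm_mul, norm_conj]
      exact mul_le_one₀ (hw1 _) (norm_nonneg _) (hw1 _)
    · have h3 : ∑ n ∈ Finset.range N, w (n + d) * (starRingEnd ℂ) (w n) =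
          ∑ n ∈ Finset.range (N - d), z (n + d) * (starRingEnd ℂ) (z n) := by
        symm
        refine (Finset.sum_congr rfl fun n hn => ?_).trans
          (Finset.sum_subset (Finset.range_mono (Nat.sub_le N d)) fun n hn hn' => ?_)
        · rw [Finset.mem_range] at hn
          simp only [hw]
          rw [if_pos (by omega), if_pos (by omega), Int.toNat_natCast,
            ← Nat.cast_add, Int.toNat_natCast]
        · rw [Finset.mem_range] at hn hn'
          simp only [hw]
          rw [if_neg (by omega), zero_mul]
      rw [h3]
      simp only [hD, hpos.ne', if_false]
      exact hB d hpos (by omega)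
  have hcor' : ∀ h h' : ℕ, h < H → h' < H →
      ‖∑ m ∈ T, w (m - h) * (starRingEnd ℂ) (w (m - h'))‖ ≤ D ((h' - h) + (h - h')) := by
    intro h h' hh hh'
    rcases le_total h h' with h1 | h1
    · rw [Nat.sub_eq_zero_of_le h1]
      exact hcor h h' h1 hh'
    · have h2 := hcor h' h h1 hh
      have h3 : ∑ m ∈ T, w (m - h) * (starRingEnd ℂ) (w (m - h')) =
          (starRingEnd ℂ) (∑ m ∈ T, w (m - h') * (starRingEnd ℂ) (w (m - h))) := by
        rw [map_sum]
        refine Finset.sum_congr rfl fun m _ => ?_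
        rw [map_mul, conj_conj, mul_comm]
      rwa [h3, norm_conj, Nat.sub_eq_zero_of_le h1, zero_add]
  -- For fixed `h`, the distance `0` occurs once and every other distance at most twice.
  have hDsum : ∀ h : ℕ, h < H → ∑ h' ∈ Finset.range H, D ((h' - h) + (h - h')) ≤
      N + 2 * ∑ d ∈ Finset.range H, B d := by
    intro h hh
    obtain ⟨r, rfl⟩ : ∃ r, H = h + r := ⟨H - h, by omega⟩
    rw [Finset.sum_range_add]
    have h1 : ∑ x ∈ Finset.range h, D ((x - h) + (h - x)) ≤ ∑ d ∈ Finset.range (h + r), B d := by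
      rw [← Finset.sum_range_reflect]
      have h2 : ∑ j ∈ Finset.range h, D ((h - 1 - j - h) + (h - (h - 1 - j))) =
          ∑ j ∈ Finset.range h, B (j + 1) := by
        refine Finset.sum_congr rfl fun j hj => ?_
        rw [Finset.mem_range] at hj
        have h3 : (h - 1 - j - h) + (h - (h - 1 - j)) = j + 1 := by omega
        rw [h3]
        simp [hD]
      rw [h2]
      have h3 := Finset.sum_range_succ' B h
      have h4 : ∑ d ∈ Finset.range (h + 1), B d ≤ ∑ d ∈ Finset.range (h + r), B d :=
        Finset.sum_le_sum_of_subset_of_nonneg (Finset.range_mono (by omega)) fun i _ _ => hB0 i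
      have h5 := hB0 0
      linarith
    have h2 : ∑ x ∈ Finset.range r, D ((h + x - h) + (h - (h + x))) ≤
        N + ∑ d ∈ Finset.range (h + r), B d := by
      have h3 : ∀ x ∈ Finset.range r, D ((h + x - h) + (h - (h + x))) ≤
          (if x = 0 then (N : ℝ) else 0) + B x := fun x _ => by
        have h4 : (h + x - h) + (h - (h + x)) = x := by omega
        rw [h4]
        simp only [hD]
        have := hB0 x
        split_ifs
        · linarith
        · linarith
      refine (Finset.sum_le_sum h3).trans ?_
      rw [Finset.sum_add_distrib]
      have h5 : ∑ d ∈ Finset.range r, B d ≤ ∑ d ∈ Finset.range (h + r), B d :=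
        Finset.sum_le_sum_of_subset_of_nonneg (Finset.range_mono (by omega)) fun i _ _ => hB0 i
      have h6 : ∑ x ∈ Finset.range r, (if x = 0 then (N : ℝ) else 0) ≤ N := by
        rw [Finset.sum_ite_eq' (Finset.range r) 0 fun _ => (N : ℝ)]
        split_ifs
        · exact le_rfl
        · exact N.cast_nonneg
      linarith
    linarith
  have hexpand : ∑ m ∈ T, ‖∑ h ∈ Finset.range H, w (m - h)‖ ^ 2 ≤
      H * (N + 2 * ∑ d ∈ Finset.range H, B d) := by
    have h1 : ((∑ m ∈ T, ‖∑ h ∈ Finset.range H, w (m - h)‖ ^ 2 : ℝ) : ℂ) =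
        ∑ h ∈ Finset.range H, ∑ h' ∈ Finset.range H,
          ∑ m ∈ T, w (m - h) * (starRingEnd ℂ) (w (m - h')) := by
      have h2 : ∀ m ∈ T, ((‖∑ h ∈ Finset.range H, w (m - h)‖ ^ 2 : ℝ) : ℂ) =
          ∑ h ∈ Finset.range H, ∑ h' ∈ Finset.range H,
            w (m - h) * (starRingEnd ℂ) (w (m - h')) := fun m _ => by
        rw [← Finset.sum_mul_sum, ← map_sum, mul_conj, normSq_eq_norm_sq]
      rw [ofReal_sum, Finset.sum_congr rfl h2, Finset.sum_comm]
      refine Finset.sum_congr rfl fun h _ => Finset.sum_comm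
    have h2 : 0 ≤ ∑ m ∈ T, ‖∑ h ∈ Finset.range H, w (m - h)‖ ^ 2 :=
      Finset.sum_nonneg fun _ _ => sq_nonneg _
    have h3 := congrArg norm h1
    rw [norm_real, Real.norm_of_nonneg h2] at h3
    rw [h3]
    refine (norm_sum_le_of_le _ fun h hh => norm_sum_le_of_le _ fun h' hh' =>
      hcor' h h' (Finset.mem_range.1 hh) (Finset.mem_range.1 hh')).trans ?_
    refine (Finset.sum_le_sum fun h hh => hDsum h (Finset.mem_range.1 hh)).trans ?_
    rw [Finset.sum_const, nsmul_eq_mul, Finset.card_range]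
  have hHpos : (0 : ℝ) < H := by exact_mod_cast hH
  have hHN' : (H : ℝ) ≤ N := by exact_mod_cast hHN
  have hBs : 0 ≤ ∑ d ∈ Finset.range H, B d := Finset.sum_nonneg fun d _ => hB0 d
  rw [norm_mul, mul_pow, norm_natCast] at hcs
  have h1 : (H : ℝ) ^ 2 * ‖S‖ ^ 2 ≤ 2 * N * (H * (N + 2 * ∑ d ∈ Finset.range H, B d)) :=
    hcs.trans (mul_le_mul (by linarith) hexpand
      (Finset.sum_nonneg fun _ _ => sq_nonneg _) (by linarith))
  rw [div_mul_eq_mul_div, le_div_iff₀ hHpos]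
  refine le_of_mul_le_mul_left ?_ hHpos
  linarith

/-- The term `h = 0` is `1 / √0 = 0` by convention, so the sum effectively starts at `1`. -/
theorem sum_range_inv_sqrt_le (H : ℕ) :
    ∑ h ∈ Finset.range (H + 1), 1 / Real.sqrt h ≤ 2 * Real.sqrt H := by
  induction H with
  | zero => simp
  | succ H ih =>
    rw [Finset.sum_range_succ]
    have h1 : 0 < Real.sqrt ((H + 1 : ℕ) : ℝ) := Real.sqrt_pos.2 (by positivity)
    have h2 := Real.sq_sqrt (Nat.cast_nonneg (α := ℝ) (H + 1))
    have h3 := Real.sq_sqrt (Nat.cast_nonneg (α := ℝ) H)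
    have h4 : 2 * Real.sqrt H + 1 / Real.sqrt ((H + 1 : ℕ) : ℝ) ≤
        2 * Real.sqrt ((H + 1 : ℕ) : ℝ) := by
      rw [← le_sub_iff_add_le', div_le_iff₀ h1]
      push_cast at h2 ⊢
      push_cast at h1
      nlinarith [sq_nonneg (Real.sqrt ((H : ℝ) + 1) - Real.sqrt H)]
    linarith

/-- Bounds for the second difference of `n ↦ log (n + h) - log n`. -/
theorem second_diff_log_add_sub_log {M h x : ℝ} (hM : 0 < M) (hh1 : 1 ≤ h) (hx : M ≤ x)
    (hx2 : x + h + 2 ≤ 2 * M + 1) :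
    h / (8 * M ^ 3) ≤ (Real.log (x + 2 + h) - Real.log (x + 2) -
        (Real.log (x + 1 + h) - Real.log (x + 1))) -
        (Real.log (x + 1 + h) - Real.log (x + 1) - (Real.log (x + h) - Real.log x)) ∧
      (Real.log (x + 2 + h) - Real.log (x + 2) -
        (Real.log (x + 1 + h) - Real.log (x + 1))) -
        (Real.log (x + 1 + h) - Real.log (x + 1) - (Real.log (x + h) - Real.log x)) ≤
        2 * h / M ^ 3 := by
  have hh : 0 ≤ h := zero_le_one.trans hh1
  set u : ℝ → ℝ := fun y =>
    Real.log (y + 1 + h) - Real.log (y + 1) - (Real.log (y + h) - Real.log y) with hu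
  set u' : ℝ → ℝ := fun y => 1 / (y + 1 + h) - 1 / (y + 1) - (1 / (y + h) - 1 / y) with hu'
  have hd : ∀ y, 0 < y → HasDerivAt u (u' y) y := by
    intro y hy
    have e1 : HasDerivAt (fun y : ℝ => y + 1 + h) 1 y :=
      ((hasDerivAt_id y).add_const 1).add_const h
    have e2 : HasDerivAt (fun y : ℝ => y + 1) 1 y := (hasDerivAt_id y).add_const 1
    have e3 : HasDerivAt (fun y : ℝ => y + h) 1 y := (hasDerivAt_id y).add_const h
    exact ((e1.log (by positivity)).sub (e2.log (by positivity))).sub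
      ((e3.log (by positivity)).sub ((hasDerivAt_id y).log hy.ne'))
  have hx0 : 0 < x := hM.trans_le hx
  -- The quantity to bound is `u (x + 1) - u x = u' ξ`, and the four fractions of `u' ξ` combine
  -- into two nonnegative terms of order `h / M ^ 3`.
  obtain ⟨ξ, hξ, hξe⟩ := exists_hasDerivAt_eq_slope u u' (show x < x + 1 by linarith)
    (fun y hy => (hd y (hx0.trans_le hy.1)).continuousAt.continuousWithinAt)
    (fun y hy => hd y (hx0.trans hy.1))
  have hval : (Real.log (x + 2 + h) - Real.log (x + 2) -
        (Real.log (x + 1 + h) - Real.log (x + 1))) -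
        (Real.log (x + 1 + h) - Real.log (x + 1) - (Real.log (x + h) - Real.log x)) = u' ξ := by
    rw [hξe, add_sub_cancel_left, div_one]
    simp only [hu]
    have h1 : x + 1 + 1 = x + 2 := by ring
    rw [h1]
  have hξM : M ≤ ξ := hx.trans hξ.1.le
  have hξ0 : 0 < ξ := hM.trans_le hξM
  have hform : u' ξ = h / ((ξ + h) * (ξ + 1) * (ξ + 1 + h)) + h / (ξ * (ξ + h) * (ξ + 1)) := by
    simp only [hu']
    field_simp
    ring
  rw [hval, hform]
  have hξ2 := hξ.2
  constructor
  · have h1 : h / (8 * M ^ 3) ≤ h / (ξ * (ξ + h) * (ξ + 1)) := by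
      apply div_le_div_of_nonneg_left hh (by positivity)
      have : ξ * (ξ + h) * (ξ + 1) ≤ (2 * M) * (2 * M) * (2 * M) := by
        gcongr <;> linarith
      linarith
    have h2 : 0 ≤ h / ((ξ + h) * (ξ + 1) * (ξ + 1 + h)) := by positivity
    linarith
  · have h1 : h / ((ξ + h) * (ξ + 1) * (ξ + 1 + h)) ≤ h / M ^ 3 := by
      apply div_le_div_of_nonneg_left hh (by positivity)
      have : M * M * M ≤ (ξ + h) * (ξ + 1) * (ξ + 1 + h) := by
        gcongr <;> linarith
      linarith
    have h2 : h / (ξ * (ξ + h) * (ξ + 1)) ≤ h / M ^ 3 := by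
      apply div_le_div_of_nonneg_left hh (by positivity)
      have : M * M * M ≤ ξ * (ξ + h) * (ξ + 1) := by
        gcongr <;> linarith
      linarith
    have h3 : 2 * h / M ^ 3 = h / M ^ 3 + h / M ^ 3 := by ring
    linarith

/-- The differenced phase `τ (log (m + h) - log m)` has second differences of order `τ h / M ^ 3`.
With `q = √(τ h / M)`, the second derivative test is fed `√lam ≥ q / (3 M)` and `Lam * M = 2 q ^ 2 /
M`. -/
theorem norm_correlation_log_le {τ : ℝ} (hτ : 0 < τ) {M L h : ℕ} (hM : 0 < M) (hL : L ≤ M)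
    (hh : 0 < h) :
    ‖∑ n ∈ Finset.range (L - h), expTurn (τ * Real.log (M + 1 + (n + h : ℕ))) *
        (starRingEnd ℂ) (expTurn (τ * Real.log (M + 1 + n)))‖ ≤
      30 * (Real.sqrt (τ * h / M) + M / Real.sqrt (τ * h / M)) := by
  have hM' : (0 : ℝ) < M := by exact_mod_cast hM
  have hh' : (0 : ℝ) < h := by exact_mod_cast hh
  set q := Real.sqrt (τ * h / M) with hq
  have hq0 : 0 < q := Real.sqrt_pos.2 (by positivity)
  have hqq : q ^ 2 = τ * h / M := Real.sq_sqrt (by positivity)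
  set f : ℕ → ℝ := fun n =>
    τ * Real.log (M + 1 + (n + h : ℕ)) - τ * Real.log (M + 1 + n) with hf
  have hsum : ∑ n ∈ Finset.range (L - h), expTurn (τ * Real.log (M + 1 + (n + h : ℕ))) *
        (starRingEnd ℂ) (expTurn (τ * Real.log (M + 1 + n))) =
      ∑ n ∈ Finset.range (L - h), expTurn (f n) :=
    Finset.sum_congr rfl fun n _ => (expTurn_sub _ _).symm
  rw [hsum]
  have hsd : ∀ n, n + 1 < L - h →
      τ * (h / (8 * (M : ℝ) ^ 3)) ≤ (f (n + 2) - f (n + 1)) - (f (n + 1) - f n) ∧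
      (f (n + 2) - f (n + 1)) - (f (n + 1) - f n) ≤ τ * (2 * h / (M : ℝ) ^ 3) := by
    intro n hn
    have h1 : (n : ℝ) + 2 + h ≤ M := by exact_mod_cast (by omega : n + 2 + h ≤ M)
    have h2 := second_diff_log_add_sub_log (M := M) (h := h) (x := M + 1 + n) hM'
      (by exact_mod_cast hh)
      (by have : (0 : ℝ) ≤ n := n.cast_nonneg
          linarith) (by linarith)
    have h3 : (f (n + 2) - f (n + 1)) - (f (n + 1) - f n) =
        τ * ((Real.log (M + 1 + n + 2 + h) - Real.log (M + 1 + n + 2) -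
        (Real.log (M + 1 + n + 1 + h) - Real.log (M + 1 + n + 1))) -
        (Real.log (M + 1 + n + 1 + h) - Real.log (M + 1 + n + 1) -
          (Real.log (M + 1 + n + h) - Real.log (M + 1 + n)))) := by
      simp only [hf]
      push_cast
      simp only [← add_assoc]
      ring
    rw [h3]
    exact ⟨mul_le_mul_of_nonneg_left h2.1 hτ.le, mul_le_mul_of_nonneg_left h2.2 hτ.le⟩
  have hle : τ * (h / (8 * (M : ℝ) ^ 3)) ≤ τ * (2 * h / (M : ℝ) ^ 3) := by
    gcongr
    · linarith
    · nlinarith [pow_pos hM' 3]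
  refine (norm_sum_expTurn_le_of_second_diff f (L - h) (by positivity)
    (fun n hn => (hsd n hn).1) (fun n hn => (hsd n hn).2) hle).trans ?_
  have hsqrt : q / (3 * M) ≤ Real.sqrt (τ * (h / (8 * (M : ℝ) ^ 3))) := by
    apply Real.le_sqrt_of_sq_le
    rw [div_pow, hqq]
    have : τ * (h / (8 * (M : ℝ) ^ 3)) = (τ * h / M) / (8 * M ^ 2) := by field_simp
    rw [this]
    gcongr
    nlinarith
  have hN : ((L - h : ℕ) : ℝ) ≤ M := by exact_mod_cast (by omega : L - h ≤ M)
  have hnum : τ * (2 * h / (M : ℝ) ^ 3) * (L - h : ℕ) ≤ 2 * q ^ 2 / M := by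
    calc _ ≤ τ * (2 * h / (M : ℝ) ^ 3) * M := by gcongr
      _ = 2 * q ^ 2 / M := by rw [hqq]; field_simp
  calc _ ≤ 5 * (2 * q ^ 2 / M + 2) / (q / (3 * M)) := by
        apply div_le_div₀ (by positivity) (by linarith) (by positivity) hsqrt
    _ = 30 * (q + M / q) := by field_simp; ring

set_option maxHeartbeats 1000000 in
theorem norm_sum_block_le {v : ℝ} (hv : 1 ≤ v) {M L : ℕ} (hM : 0 < M) (hL : L ≤ M)
    (hMv : (M : ℝ) ≤ v ^ 4) :
    ‖∑ n ∈ Finset.range L, expTurn (v ^ 6 / (2 * Real.pi) * Real.log (M + 1 + n))‖ ≤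
      31 * v * Real.sqrt M := by
  have hM' : (0 : ℝ) < M := by exact_mod_cast hM
  have hv0 : 0 < v := by linarith
  have hs0 : 0 < Real.sqrt M := Real.sqrt_pos.2 hM'
  have hss : Real.sqrt M * Real.sqrt M = M := Real.mul_self_sqrt hM'.le
  have hsv : Real.sqrt M ≤ v ^ 2 := by
    rw [Real.sqrt_le_left (by positivity)]
    nlinarith
  have htriv : ‖∑ n ∈ Finset.range L, expTurn (v ^ 6 / (2 * Real.pi) * Real.log (M + 1 + n))‖ ≤
      L := by
    refine (norm_sum_le _ _).trans ?_
    simp [norm_expTurn]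
  have hL' : (L : ℝ) ≤ M := by exact_mod_cast hL
  have hvs : 0 < v * Real.sqrt M := by positivity
  -- When `√M ≤ v` the trivial bound `L ≤ M = √M · √M` is already good enough.
  rcases le_or_gt (Real.sqrt M) v with h1 | h1
  · nlinarith
  -- This `H` equalizes the diagonal contribution `M²/H` and the correlation contribution `M
  -- √(τH/M)`, both then of order `M v²`. The remaining contribution `M² √(M/τ) / √H` is of order
  -- `M²/v²`, which is at most `M v²` because `M ≤ v⁴`.
  set H := ⌈(M : ℝ) / v ^ 2⌉₊ with hH
  have hMv2 : 1 < (M : ℝ) / v ^ 2 := by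
    rw [lt_div_iff₀ (by positivity)]
    nlinarith
  have hHlow : (M : ℝ) / v ^ 2 ≤ H := Nat.le_ceil _
  have hHup : (H : ℝ) ≤ 2 * (M / v ^ 2) := by
    have := (Nat.ceil_lt_add_one (a := (M : ℝ) / v ^ 2) (by positivity)).le
    linarith
  have hH1 : (1 : ℝ) < H := hMv2.trans_le hHlow
  have hHpos : 0 < H := by
    have : (0 : ℝ) < H := by linarith
    exact_mod_cast this
  rcases lt_or_ge L H with hLH | hLH
  · have h2 : (L : ℝ) ≤ H := by exact_mod_cast hLH.le
    have h3 : (M : ℝ) / v ^ 2 ≤ Real.sqrt M := by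
      rw [div_le_iff₀ (by positivity)]
      nlinarith
    nlinarith
  set τ := v ^ 6 / (2 * Real.pi) with hτ
  have hpi := Real.pi_gt_three
  have hpi2 := Real.pi_lt_d2
  have hτ0 : 0 < τ := by positivity
  have hτup : τ ≤ v ^ 6 := by
    rw [hτ, div_le_iff₀ (by positivity)]
    nlinarith [pow_pos hv0 6]
  have hτlow : v ^ 6 / 7 ≤ τ := by
    rw [hτ]
    gcongr
    linarith
  -- At `h = 0` division by `√0 = 0` makes `B 0 = 0`, so sums over the whole range need no separate
  -- case.
  obtain ⟨B, hB⟩ : ∃ B : ℕ → ℝ, B = fun h : ℕ =>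
    30 * (Real.sqrt (τ * h / M) + M / Real.sqrt (τ * h / M)) := ⟨_, rfl⟩
  have hvdc := sq_norm_sum_le_of_correlations (fun n => expTurn (τ * Real.log (M + 1 + n)))
    (fun n => (norm_expTurn _).le) L H hHpos hLH B (fun h => by rw [hB]; positivity)
    (fun h h0 _ => by
      rw [hB]
      exact norm_correlation_log_le hτ0 hM hL h0)
  have hBsum : ∑ h ∈ Finset.range H, B h ≤ 30 * (H * Real.sqrt (τ * H / M) +
      M * Real.sqrt (M / τ) * (2 * Real.sqrt H)) := by
    rw [hB, ← Finset.mul_sum, Finset.sum_add_distrib]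
    gcongr
    · calc _ ≤ ∑ h ∈ Finset.range H, Real.sqrt (τ * H / M) := by
            refine Finset.sum_le_sum fun h hh => ?_
            have : (h : ℝ) ≤ H := by exact_mod_cast (Finset.mem_range.1 hh).le
            gcongr
        _ = _ := by simp
    · have h2 : ∀ h ∈ Finset.range H, (M : ℝ) / Real.sqrt (τ * h / M) =
          M * Real.sqrt (M / τ) * (1 / Real.sqrt h) := fun h _ => by
        have h3 : τ * h / M = h / (M / τ) := by field_simp
        rw [h3, Real.sqrt_div (Nat.cast_nonneg h)]
        field_simp
      rw [Finset.sum_congr rfl h2, ← Finset.mul_sum]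
      gcongr
      refine le_trans ?_ (sum_range_inv_sqrt_le H)
      exact Finset.sum_le_sum_of_subset_of_nonneg (Finset.range_mono (Nat.le_succ H))
        fun i _ _ => by positivity
  have hkey : ‖∑ n ∈ Finset.range L, expTurn (τ * Real.log (M + 1 + n))‖ ^ 2 ≤
      2 * M / H * (M + 2 * (30 * (H * Real.sqrt (τ * H / M) +
      M * Real.sqrt (M / τ) * (2 * Real.sqrt H)))) := by
    refine hvdc.trans ?_
    have : 0 ≤ ∑ h ∈ Finset.range H, B h := Finset.sum_nonneg fun h _ => by rw [hB]; positivity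
    gcongr
  have hH0 : (0 : ℝ) < H := by linarith
  have e1 : 2 * M / H * (M : ℝ) ≤ 2 * (M * v ^ 2) := by
    have : (M : ℝ) / H ≤ v ^ 2 := by
      rw [div_le_iff₀ hH0]
      rw [div_le_iff₀ (by positivity)] at hHlow
      linarith
    calc 2 * M / H * (M : ℝ) = 2 * (M * (M / H)) := by ring
      _ ≤ _ := by gcongr
  have e2 : Real.sqrt (τ * H / M) ≤ 3 / 2 * v ^ 2 := by
    rw [Real.sqrt_le_left (by positivity), div_le_iff₀ hM']
    calc τ * H ≤ v ^ 6 * (2 * (M / v ^ 2)) := by gcongr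
      _ = 2 * (v ^ 4 * M) := by field_simp
      _ ≤ (3 / 2 * v ^ 2) ^ 2 * M := by nlinarith [mul_pos (pow_pos hv0 4) hM']
  have e3 : Real.sqrt (M / τ) * Real.sqrt H / H ≤ 3 / v ^ 2 := by
    have h2 : Real.sqrt (M / τ) * Real.sqrt H / H = Real.sqrt (M / τ / H) := by
      rw [Real.sqrt_div (x := M / τ) (by positivity) (H : ℝ), mul_div_assoc, Real.sqrt_div_self',
        mul_one_div]
    rw [h2, Real.sqrt_le_left (by positivity), div_pow, div_div, div_le_div_iff₀ (by positivity)
      (by positivity)]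
    have h3 : v ^ 6 / 7 * (M / v ^ 2) ≤ τ * H := by gcongr
    have h4 : v ^ 6 / 7 * (M / v ^ 2) = M * (v ^ 2) ^ 2 / 7 := by field_simp
    rw [h4] at h3
    have : 0 < (M : ℝ) * (v ^ 2) ^ 2 := by positivity
    linarith
  have hfin : ‖∑ n ∈ Finset.range L, expTurn (τ * Real.log (M + 1 + n))‖ ^ 2 ≤
      (31 * v * Real.sqrt M) ^ 2 := by
    have h2 : 2 * M / H * (M + 2 * (30 * (H * Real.sqrt (τ * H / M) +
        M * Real.sqrt (M / τ) * (2 * Real.sqrt H)))) =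
        2 * M / H * M + 120 * M * Real.sqrt (τ * H / M) +
        240 * (M * M) * (Real.sqrt (M / τ) * Real.sqrt H / H) := by
      field_simp
      ring
    rw [h2] at hkey
    have h3 : 120 * (M : ℝ) * Real.sqrt (τ * H / M) ≤ 120 * M * (3 / 2 * v ^ 2) := by gcongr
    have h4 : 240 * ((M : ℝ) * M) * (Real.sqrt (M / τ) * Real.sqrt H / H) ≤
        240 * (M * v ^ 4) * (3 / v ^ 2) := by gcongr
    have h5 : 240 * (M * v ^ 4) * (3 / v ^ 2) = 720 * (M * v ^ 2) := by field_simp; norm_num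
    have h6 : (31 * v * Real.sqrt M) ^ 2 = 961 * (M * v ^ 2) := by
      rw [mul_pow, mul_pow, Real.sq_sqrt hM'.le]
      ring
    have h7 : 0 < (M : ℝ) * v ^ 2 := by positivity
    rw [h6]
    rw [h5] at h4
    have h8 : 120 * (M : ℝ) * (3 / 2 * v ^ 2) = 180 * (M * v ^ 2) := by ring
    rw [h8] at h3
    linarith
  exact (pow_le_pow_iff_left₀ (norm_nonneg _) (by positivity) two_ne_zero).1 hfin

/-- The Weyl–van der Corput bound for the partial sums of `∑ n ^ (i v ^ 6)`. -/
theorem norm_sum_expTurn_log_le {v : ℝ} (hv : 1 ≤ v) (n : ℕ) (hn : (n : ℝ) ≤ v ^ 4) :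
    ‖∑ k ∈ Finset.range n, expTurn (v ^ 6 / (2 * Real.pi) * Real.log (k + 1))‖ ≤
      120 * v * Real.sqrt n := by
  have hv0 : 0 < v := by linarith
  induction n using Nat.strong_induction_on with
  | _ n ih =>
  rcases Nat.lt_or_ge n 2 with h2 | h2
  · refine (norm_sum_le _ _).trans ?_
    simp only [norm_expTurn, Finset.sum_const, Finset.card_range, nsmul_eq_mul, mul_one]
    interval_cases n
    · simp
    · simp; linarith
  -- Dyadic descent: a first half, a block of equal length, and at most one leftover term. Halving
  -- contracts `√n` by `1/√2 < 71/100`, and the constant survives since `(120 + 31) · 71/100 + 1 ≤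
  -- 120`.
  set M := n / 2 with hM
  have hMn : M < n := by omega
  have hM0 : 0 < M := by omega
  have hMn' : (M : ℝ) ≤ n / 2 := by
    rw [le_div_iff₀ two_pos]
    exact_mod_cast (by omega : M * 2 ≤ n)
  have hM0' : (1 : ℝ) ≤ M := by exact_mod_cast hM0
  have hMv : (M : ℝ) ≤ v ^ 4 := by linarith
  have h3 := ih M hMn hMv
  have h4 := norm_sum_block_le hv hM0 le_rfl hMv
  have h5 : ‖∑ k ∈ Finset.range (n - (M + M)),
      expTurn (v ^ 6 / (2 * Real.pi) * Real.log ((M + M + k : ℕ) + 1))‖ ≤ 1 := by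
    refine (norm_sum_le _ _).trans ?_
    simp only [norm_expTurn, Finset.sum_const, Finset.card_range, nsmul_eq_mul, mul_one]
    exact_mod_cast (by omega : n - (M + M) ≤ 1)
  have h6 : n = M + M + (n - (M + M)) := by omega
  have h7 : ∑ k ∈ Finset.range n, expTurn (v ^ 6 / (2 * Real.pi) * Real.log (k + 1)) =
      ∑ k ∈ Finset.range M, expTurn (v ^ 6 / (2 * Real.pi) * Real.log (k + 1)) +
      ∑ k ∈ Finset.range M, expTurn (v ^ 6 / (2 * Real.pi) * Real.log (M + 1 + k)) +
      ∑ k ∈ Finset.range (n - (M + M)),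
        expTurn (v ^ 6 / (2 * Real.pi) * Real.log ((M + M + k : ℕ) + 1)) := by
    nth_rewrite 1 [h6]
    rw [Finset.sum_range_add, Finset.sum_range_add]
    congr 2
    refine Finset.sum_congr rfl fun k _ => ?_
    push_cast
    congr 3
    ring
  rw [h7]
  refine (norm_add_le _ _).trans ((add_le_add (norm_add_le _ _) le_rfl).trans ?_)
  have hs : Real.sqrt M ≤ 71 / 100 * Real.sqrt n := by
    rw [Real.sqrt_le_left (by positivity), mul_pow, Real.sq_sqrt n.cast_nonneg]
    have : (0 : ℝ) ≤ n := n.cast_nonneg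
    nlinarith
  have hs1 : 1 ≤ Real.sqrt n := by
    rw [Real.one_le_sqrt]
    linarith
  have h8 : v * Real.sqrt M ≤ 71 / 100 * (v * Real.sqrt n) := by nlinarith
  have h9 : 1 ≤ v * Real.sqrt n := one_le_mul_of_one_le_of_one_le hv hs1
  nlinarith

/-! ### The Gamma function on vertical lines. -/

theorem norm_betaIntegral_le (u v : ℂ) :
    ‖betaIntegral u v‖ ≤ ‖betaIntegral u.re v.re‖ := by
  have h1 : betaIntegral u.re v.re =
      ((∫ x in (0 : ℝ)..1, x ^ (u.re - 1) * (1 - x) ^ (v.re - 1) : ℝ) : ℂ) := by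
    rw [betaIntegral, ← intervalIntegral.integral_ofReal]
    refine intervalIntegral.integral_congr fun x hx => ?_
    rw [Set.uIcc_of_le zero_le_one] at hx
    have h2 : (0 : ℝ) ≤ 1 - x := by linarith [hx.2]
    rw [ofReal_mul, ofReal_cpow hx.1, ofReal_cpow h2]
    push_cast
    rfl
  rw [h1, norm_real, betaIntegral]
  refine (intervalIntegral.norm_integral_le_integral_norm zero_le_one).trans
    (le_trans (le_of_eq ?_) (le_abs_self _))
  refine intervalIntegral.integral_congr_ae ?_
  filter_upwards [compl_mem_ae_iff.2 (measure_singleton (1 : ℝ))] with x hx1 hx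
  rw [Set.uIoc_of_le zero_le_one] at hx
  have h3 : x < 1 := lt_of_le_of_ne hx.2 hx1
  rw [norm_mul, norm_cpow_eq_rpow_re_of_pos hx.1]
  have h4 : (1 - x : ℂ) = ((1 - x : ℝ) : ℂ) := by push_cast; rfl
  rw [h4, norm_cpow_eq_rpow_re_of_pos (by linarith)]
  simp

/-- In `Γ(z) Γ(δ) = Γ(z+δ) B(z, δ)` the beta integral is dominated by its value at `Re z`. This
carries decay from one vertical line to the lines on its left. -/
theorem norm_Gamma_div_Gamma_re_le_add {z : ℂ} {δ : ℝ} (hz : 0 < z.re) (hδ : 0 < δ) :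
    ‖Gamma z‖ * Real.Gamma (z.re + δ) ≤ ‖Gamma (z + δ)‖ * Real.Gamma z.re := by
  have h1 := Gamma_mul_Gamma_eq_betaIntegral hz (t := (δ : ℂ)) (by simpa using hδ)
  have h2 := Gamma_mul_Gamma_eq_betaIntegral (s := (z.re : ℂ)) (t := (δ : ℂ))
    (by simpa using hz) (by simpa using hδ)
  have h3 := norm_betaIntegral_le z δ
  rw [ofReal_re] at h3
  have e1 := congrArg norm h1
  have e2 := congrArg norm h2
  rw [← ofReal_add, Gamma_ofReal, Gamma_ofReal, Gamma_ofReal] at e2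
  rw [Gamma_ofReal] at e1
  simp only [norm_mul, norm_real] at e1 e2
  have p1 := Real.Gamma_pos_of_pos hz
  have p2 := Real.Gamma_pos_of_pos hδ
  have p3 := Real.Gamma_pos_of_pos (add_pos hz hδ)
  rw [Real.norm_of_nonneg p2.le] at e1 e2
  rw [Real.norm_of_nonneg p1.le, Real.norm_of_nonneg p3.le] at e2
  refine le_of_mul_le_mul_right ?_ p2
  calc ‖Gamma z‖ * Real.Gamma (z.re + δ) * Real.Gamma δ
      = Real.Gamma (z.re + δ) * (‖Gamma (z + δ)‖ * ‖betaIntegral z δ‖) := by rw [← e1]; ring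
    _ ≤ Real.Gamma (z.re + δ) * (‖Gamma (z + δ)‖ * ‖betaIntegral z.re δ‖) := by gcongr
    _ = ‖Gamma (z + δ)‖ * (Real.Gamma (z.re + δ) * ‖betaIntegral z.re δ‖) := by ring
    _ = _ := by rw [← e2]; ring

theorem sq_norm_Gamma_half (τ : ℝ) :
    ‖Gamma (1 / 2 + τ * I)‖ ^ 2 = Real.pi / Real.cosh (Real.pi * τ) := by
  have h1 := Gamma_mul_Gamma_one_sub (1 / 2 + τ * I)
  have h2 : (1 : ℂ) - (1 / 2 + τ * I) = (starRingEnd ℂ) (1 / 2 + τ * I) := by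
    simp only [map_add, map_mul, conj_ofReal, conj_I, map_div₀, map_one, map_ofNat]
    ring
  have h3 : sin (Real.pi * (1 / 2 + τ * I)) = (Real.cosh (Real.pi * τ) : ℂ) := by
    have : (Real.pi : ℂ) * (1 / 2 + τ * I) = Real.pi * τ * I + Real.pi / 2 := by ring
    rw [this, sin_add_pi_div_two, cos_mul_I]
    push_cast
    rfl
  rw [h2, Gamma_conj, mul_conj, normSq_eq_norm_sq, h3] at h1
  exact_mod_cast h1

/-- Exponential decay of the Gamma function on vertical lines. -/
theorem norm_Gamma_le {z : ℂ} (hz : 0 < z.re) (hz2 : z.re < 3 / 2) :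
    ‖Gamma z‖ ≤ 3 * Real.Gamma z.re * (1 + |z.im|) * Real.exp (-(Real.pi / 2) * |z.im|) := by
  have hpi := Real.pi_pos
  -- The shift leads to real part `3/2`, where `Γ(3/2 + iτ) = (1/2 + iτ) Γ(1/2 + iτ)` and the last
  -- modulus is known exactly; hence the factor `1 + |Im z|`.
  have h1 := norm_Gamma_div_Gamma_re_le_add hz (δ := 3 / 2 - z.re) (by linarith)
  have h2 : z + ((3 / 2 - z.re : ℝ) : ℂ) = (1 / 2 + z.im * I) + 1 := by
    apply Complex.ext
    · simp; norm_num
    · simp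
  have hne : (1 / 2 + z.im * I : ℂ) ≠ 0 := fun h => by
    have := congrArg re h
    simp at this
  have h3 : Real.Gamma (3 / 2) = Real.sqrt Real.pi / 2 := by
    have : (3 / 2 : ℝ) = 1 / 2 + 1 := by norm_num
    rw [this, Real.Gamma_add_one (by norm_num), Real.Gamma_one_half_eq]
    ring
  rw [h2, Gamma_add_one _ hne, add_sub_cancel, h3, norm_mul] at h1
  have h4 : ‖(1 / 2 + z.im * I : ℂ)‖ ≤ 1 + |z.im| := by
    refine (norm_add_le _ _).trans ?_
    rw [norm_mul, norm_I, mul_one, norm_real, Real.norm_eq_abs]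
    norm_num
  have h5 : ‖Gamma (1 / 2 + z.im * I)‖ ≤
      3 / 2 * Real.sqrt Real.pi * Real.exp (-(Real.pi / 2) * |z.im|) := by
    refine (pow_le_pow_iff_left₀ (norm_nonneg _) (by positivity) two_ne_zero).1 ?_
    rw [sq_norm_Gamma_half, mul_pow, mul_pow, Real.sq_sqrt hpi.le, ← Real.exp_nat_mul]
    have h6 : Real.exp (Real.pi * |z.im|) / 2 ≤ Real.cosh (Real.pi * z.im) := by
      rw [← Real.cosh_abs, abs_mul, abs_of_pos hpi, Real.cosh_eq]
      have := Real.exp_pos (-(Real.pi * |z.im|))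
      linarith
    calc Real.pi / Real.cosh (Real.pi * z.im) ≤ Real.pi / (Real.exp (Real.pi * |z.im|) / 2) := by
          gcongr
      _ = 2 * Real.pi * Real.exp (-(Real.pi * |z.im|)) := by rw [Real.exp_neg]; field_simp
      _ ≤ (3 / 2) ^ 2 * Real.pi * Real.exp (-(Real.pi * |z.im|)) := by gcongr; norm_num
      _ = _ := by
        congr 2
        push_cast
        ring
  have hs : 0 < Real.sqrt Real.pi := Real.sqrt_pos.2 hpi
  have hG := Real.Gamma_pos_of_pos hz
  refine le_of_mul_le_mul_right (h1.trans ?_) (show 0 < Real.sqrt Real.pi / 2 by positivity)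
  calc _ ≤ (1 + |z.im|) * (3 / 2 * Real.sqrt Real.pi * Real.exp (-(Real.pi / 2) * |z.im|)) *
        Real.Gamma z.re := by gcongr
    _ = _ := by ring

/-! ### Digamma asymptotics. -/

/-- The summand of the series for `digamma z - log z`. -/
noncomputable def digammaTerm (z : ℂ) : ℂ := log (z + 1) - log z - 1 / z

/-- The function `u ↦ log (z + u) - u / z` has derivative `-u / (z (z + u))`, and `|z + u| ≥ |z|` in
the right half-plane. -/
theorem norm_digammaTerm_le {z : ℂ} (hz : 0 < z.re) : ‖digammaTerm z‖ ≤ 1 / ‖z‖ ^ 2 := by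
  have hz0 : z ≠ 0 := fun h => by simp [h] at hz
  have hd : ∀ u ∈ Set.Icc (0 : ℝ) 1, HasDerivWithinAt (fun u : ℝ => log (z + u) - u / z)
      (1 / (z + u) - 1 / z) (Set.Icc (0 : ℝ) 1) u := by
    intro u hu
    have h1 : HasDerivAt (fun u : ℝ => z + (u : ℂ)) 1 u :=
      ((hasDerivAt_id u).ofReal_comp).const_add z
    have h2 : HasDerivAt (fun u : ℝ => (u : ℂ) / z) (1 / z) u :=
      ((hasDerivAt_id u).ofReal_comp).div_const z
    have h3 : z + u ∈ slitPlane := by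
      left
      simp
      linarith [hu.1]
    exact ((h1.clog_real h3).sub h2).hasDerivWithinAt
  have hb : ∀ u ∈ Set.Ico (0 : ℝ) 1, ‖1 / (z + u) - 1 / z‖ ≤ 1 / ‖z‖ ^ 2 := by
    intro u hu
    have h1 : ‖z‖ ≤ ‖z + u‖ := by
      rw [← sq_le_sq₀ (norm_nonneg _) (norm_nonneg _), ← normSq_eq_norm_sq, ← normSq_eq_norm_sq,
        normSq_apply, normSq_apply]
      simp
      nlinarith [hu.1]
    have h2 : z + u ≠ 0 := fun h => by
      rw [h, norm_zero] at h1
      exact hz0 (norm_le_zero_iff.1 h1)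
    have h3 : 1 / (z + u) - 1 / z = -u / (z * (z + u)) := by
      field_simp
      ring
    have hzp : 0 < ‖z‖ := norm_pos_iff.2 hz0
    rw [h3, norm_div, norm_neg, norm_real, Real.norm_of_nonneg hu.1, norm_mul, sq]
    gcongr
    exact hu.2.le
  have := norm_image_sub_le_of_norm_deriv_le_segment' hd hb 1 (by simp)
  have h4 : digammaTerm z = log (z + (1 : ℝ)) - (1 : ℝ) / z - (log (z + (0 : ℝ)) - (0 : ℝ) / z) := by
    simp [digammaTerm]
    ring
  rw [h4]
  simpa using this

theorem hasSum_telescope_inv {a : ℝ} (ha : 0 < a) :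
    HasSum (fun k : ℕ => 1 / (a + k) - 1 / (a + k + 1)) (1 / a) := by
  rw [hasSum_iff_tendsto_nat_of_nonneg]
  · have h1 : ∀ n : ℕ, ∑ k ∈ Finset.range n, (1 / (a + k) - 1 / (a + k + 1)) =
        1 / a - 1 / (a + n) := fun n => by
      have := Finset.sum_range_sub' (fun k : ℕ => 1 / (a + k)) n
      simpa [add_assoc] using this
    simp_rw [h1]
    have h2 : Tendsto (fun n : ℕ => 1 / (a + (n : ℝ))) atTop (nhds 0) :=
      (tendsto_const_nhds (x := (1 : ℝ))).div_atTop
        (tendsto_atTop_add_const_left _ a tendsto_natCast_atTop_atTop)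
    simpa using (tendsto_const_nhds (x := 1 / a)).sub h2
  · intro k
    rw [sub_nonneg]
    apply one_div_le_one_div_of_le (by positivity)
    linarith

theorem one_div_sq_le_telescope {a c : ℝ} (hc : 0 < c) (ha : c ≤ a) (k : ℕ) :
    1 / (a + k) ^ 2 ≤ (1 + 1 / c) * (1 / (a + k) - 1 / (a + k + 1)) := by
  have ha0 : 0 < a := hc.trans_le ha
  have hk : (0 : ℝ) ≤ k := k.cast_nonneg
  have h4 : 1 / (a + k) - 1 / (a + k + 1) = 1 / ((a + k) * (a + k + 1)) := by
    field_simp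
    ring
  rw [h4, mul_one_div, div_le_div_iff₀ (by positivity) (by positivity), sq]
  have h5 : a + k + 1 ≤ (1 + 1 / c) * (a + k) := by
    have : 1 ≤ 1 / c * (a + k) := by
      rw [one_div_mul_eq_div, one_le_div hc]
      linarith
    linarith
  calc 1 * ((a + k) * (a + k + 1)) ≤ 1 * ((a + k) * ((1 + 1 / c) * (a + k))) := by gcongr
    _ = _ := by ring

/-- In the right half-plane `(‖z‖ + k)² ≤ 2 ‖z + k‖²`, so the series is dominated by a telescoping
one with sum `O(1/‖z‖)`, uniformly for `Re z ≥ c`. -/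
theorem norm_digammaTerm_add_nat_le {z : ℂ} {c : ℝ} (hc : 0 < c) (hz : c ≤ z.re) (k : ℕ) :
    ‖digammaTerm (z + k)‖ ≤ 2 * (1 + 1 / c) * (1 / (‖z‖ + k) - 1 / (‖z‖ + k + 1)) := by
  have hk : (0 : ℝ) ≤ k := k.cast_nonneg
  have h1 := norm_digammaTerm_le (z := z + k) (by simp; linarith)
  have hzn : c ≤ ‖z‖ := hz.trans (re_le_norm z)
  have hzp : 0 < ‖z‖ := hc.trans_le hzn
  have h2 : (‖z‖ + k) ^ 2 ≤ 2 * ‖z + k‖ ^ 2 := by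
    have e1 : ‖z + k‖ ^ 2 = ‖z‖ ^ 2 + k ^ 2 + 2 * k * z.re := by
      rw [← normSq_eq_norm_sq, ← normSq_eq_norm_sq, normSq_apply, normSq_apply]
      simp
      ring
    rw [e1]
    nlinarith [sq_nonneg (‖z‖ - k), mul_nonneg hk (hc.le.trans hz)]
  have h3 : 1 / ‖z + k‖ ^ 2 ≤ 2 * (1 / (‖z‖ + k) ^ 2) := by
    have : 0 < ‖z + k‖ ^ 2 := by
      have : 0 < (‖z‖ + k) ^ 2 := by positivity
      linarith
    rw [mul_one_div, div_le_div_iff₀ this (by positivity)]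
    linarith
  rw [mul_assoc]
  exact h1.trans (h3.trans (mul_le_mul_of_nonneg_left (one_div_sq_le_telescope hc hzn k) two_pos.le))

theorem summable_digammaTerm {z : ℂ} (hz : 0 < z.re) :
    Summable fun k : ℕ => digammaTerm (z + k) :=
  Summable.of_norm_bounded
    ((hasSum_telescope_inv (norm_pos_iff.2 fun h => by simp [h] at hz)).summable.mul_left _)
    (norm_digammaTerm_add_nat_le hz le_rfl)

theorem norm_tsum_digammaTerm_le {z : ℂ} {c : ℝ} (hc : 0 < c) (hz : c ≤ z.re) :
    ‖∑' k : ℕ, digammaTerm (z + k)‖ ≤ 2 * (1 + 1 / c) / ‖z‖ := by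
  have hzp : 0 < ‖z‖ := hc.trans_le (hz.trans (re_le_norm z))
  have := tsum_of_norm_bounded ((hasSum_telescope_inv hzp).mul_left (2 * (1 + 1 / c)))
    (norm_digammaTerm_add_nat_le hc hz)
  rwa [mul_one_div] at this

theorem differentiableAt_digammaTerm {z : ℂ} (hz : 0 < z.re) :
    DifferentiableAt ℂ digammaTerm z := by
  have hz0 : z ≠ 0 := fun h => by simp [h] at hz
  have h1 : z + 1 ∈ slitPlane := by left; simp; linarith
  have h2 : z ∈ slitPlane := Or.inl hz
  exact (((differentiableAt_id.add_const 1).clog h1).sub (differentiableAt_id.clog h2)).sub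
    ((differentiableAt_const 1).div differentiableAt_id hz0)

theorem differentiableOn_tsum_digammaTerm {c : ℝ} (hc : 0 < c) :
    DifferentiableOn ℂ (fun z => ∑' k : ℕ, digammaTerm (z + k)) {z | c < z.re} := by
  refine differentiableOn_tsum_of_summable_norm
    (u := fun k : ℕ => (1 + 1 / c) * (1 / (c + k) - 1 / (c + k + 1)))
    ((hasSum_telescope_inv hc).summable.mul_left _) (fun k z hz => ?_)
    (isOpen_lt continuous_const continuous_re) (fun k z hz => ?_)
  · have hz' : c < z.re := hz
    have h0 : 0 < (z + k).re := by
      have : (0 : ℝ) ≤ k := k.cast_nonneg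
      simp
      linarith
    exact ((differentiableAt_digammaTerm h0).comp z
      (differentiableAt_id.add_const (k : ℂ))).differentiableWithinAt
  · have hz' : c < z.re := hz
    have hk : (0 : ℝ) ≤ k := k.cast_nonneg
    refine (norm_digammaTerm_le (z := z + k) (by simp; linarith)).trans
      (le_trans ?_ (one_div_sq_le_telescope hc le_rfl k))
    have h1 : c + k ≤ ‖z + k‖ := by
      refine le_trans ?_ (re_le_norm _)
      simp
      linarith
    gcongr

theorem digamma_ofReal {x : ℝ} (hx : 0 < x) :
    HasDerivAt (fun y => Real.log (Real.Gamma y)) (digamma x).re x ∧ (digamma x).im = 0 := by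
  have hne : ∀ m : ℕ, x ≠ -m := fun m h => by
    have : (0 : ℝ) ≤ m := m.cast_nonneg
    linarith
  have hnec : ∀ m : ℕ, (x : ℂ) ≠ -m := fun m h => hne m (by exact_mod_cast h)
  have h1 := (differentiableAt_Gamma (x : ℂ) hnec).hasDerivAt.comp_ofReal
  have h2 := (Real.differentiableAt_Gamma hne).hasDerivAt
  have h3 : (fun y : ℝ => Gamma (y : ℂ)) = fun y : ℝ => ((Real.Gamma y : ℝ) : ℂ) :=
    funext fun y => Gamma_ofReal y
  rw [h3] at h1
  have h4 := h1.unique h2.ofReal_comp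
  have h5 : digamma x = ((deriv Real.Gamma x / Real.Gamma x : ℝ) : ℂ) := by
    rw [digamma_def, logDeriv_apply, h4, Gamma_ofReal]
    push_cast
    rfl
  rw [h5, ofReal_re, ofReal_im]
  exact ⟨h2.log (Real.Gamma_pos_of_pos hx).ne', rfl⟩

/-- By convexity of `log Γ`, its derivative at `x` lies between the slopes over `[x-1, x]` and `[x,
x+1]`, which are `log (x-1)` and `log x`. -/
theorem norm_digamma_sub_log_ofReal_le {x : ℝ} (hx : 1 < x) :
    ‖digamma x - log x‖ ≤ Real.log x - Real.log (x - 1) := by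
  have hx0 : 0 < x := by linarith
  obtain ⟨h1, h2⟩ := digamma_ofReal hx0
  have hc := Real.convexOn_log_Gamma
  have hrec : ∀ y : ℝ, 0 < y → Real.log (Real.Gamma (y + 1)) - Real.log (Real.Gamma y) =
      Real.log y := fun y hy => by
    rw [Real.Gamma_add_one hy.ne', Real.log_mul hy.ne' (Real.Gamma_pos_of_pos hy).ne']
    ring
  have h3 := hc.le_slope_of_hasDerivAt (x := x) (y := x + 1) hx0
    (by simp; linarith) (by linarith) h1
  have h4 := hc.slope_le_of_hasDerivAt (x := x - 1) (y := x) (by simp; linarith)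
    hx0 (by linarith) h1
  simp only [slope_def_field, Function.comp] at h3 h4
  have h5 := hrec x hx0
  have h6 := hrec (x - 1) (by linarith)
  rw [sub_add_cancel] at h6
  rw [h5, add_sub_cancel_left, div_one] at h3
  rw [h6, sub_sub_cancel, div_one] at h4
  have h7 : digamma x - log x = (((digamma x).re - Real.log x : ℝ) : ℂ) := by
    rw [← ofReal_log hx0.le]
    apply Complex.ext <;> simp [h2]
  rw [h7, norm_real, Real.norm_eq_abs, abs_le]
  constructor
  · linarith
  · have := Real.log_le_log (show 0 < x - 1 by linarith) (show x - 1 ≤ x by linarith)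
    linarith

theorem tendsto_digamma_sub_log_add_nat {x : ℝ} (hx : 0 < x) :
    Tendsto (fun n : ℕ => digamma ((x + n : ℝ) : ℂ) - log ((x + n : ℝ) : ℂ)) atTop (nhds 0) := by
  have h1 : Tendsto (fun n : ℕ => 1 / (x + (n : ℝ) - 1)) atTop (nhds 0) := by
    refine (tendsto_const_nhds (x := (1 : ℝ))).div_atTop ?_
    exact tendsto_atTop_add_const_right _ (-1)
      (tendsto_atTop_add_const_left _ x tendsto_natCast_atTop_atTop)
  refine squeeze_zero_norm' ?_ h1
  filter_upwards [eventually_ge_atTop 1] with n hn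
  have hn' : (1 : ℝ) ≤ n := by exact_mod_cast hn
  have h2 : 0 < x + n - 1 := by linarith
  refine (norm_digamma_sub_log_ofReal_le (x := x + n) (by linarith)).trans ?_
  rw [← Real.log_div (by positivity) h2.ne']
  refine (Real.log_le_sub_one_of_pos (by positivity)).trans (le_of_eq ?_)
  field_simp
  ring

/-- The difference of the two sides is invariant under `z ↦ z + 1` and tends to `0` along `x + n`,
so it vanishes for real `x > 0`, and then everywhere by the identity theorem. -/
theorem digamma_sub_log_eq_tsum {z : ℂ} (hz : 0 < z.re) :
    digamma z - log z = ∑' k : ℕ, digammaTerm (z + k) := by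
  set P : ℂ → ℂ := fun z => digamma z - log z - ∑' k : ℕ, digammaTerm (z + k) with hP
  have hne : ∀ w : ℂ, 0 < w.re → ∀ m : ℕ, w ≠ -m := fun w hw m h => by
    rw [h] at hw
    have : (0 : ℝ) ≤ m := m.cast_nonneg
    simp at hw
    linarith
  have hper : ∀ w : ℂ, 0 < w.re → P (w + 1) = P w := by
    intro w hw
    have h1 := digamma_apply_add_one w (hne w hw)
    have h2 := (summable_digammaTerm hw).tsum_eq_zero_add
    have h3 : ∑' k : ℕ, digammaTerm (w + (k + 1 : ℕ)) = ∑' k : ℕ, digammaTerm (w + 1 + k) :=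
      tsum_congr fun k => by push_cast; ring_nf
    simp only [hP]
    rw [h2, h3, h1]
    simp [digammaTerm]
    ring
  have hreal : ∀ x : ℝ, 0 < x → P x = 0 := by
    intro x hx
    have h1 : ∀ n : ℕ, P ((x + n : ℝ) : ℂ) = P x := by
      intro n
      induction n with
      | zero => simp
      | succ n ih =>
        have h2 := hper ((x + n : ℝ) : ℂ) (by rw [ofReal_re]; positivity)
        rw [← ih, ← h2]
        congr 1
        push_cast
        ring
    have h2 : Tendsto (fun n : ℕ => ∑' k : ℕ, digammaTerm (((x + n : ℝ) : ℂ) + k)) atTop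
        (nhds 0) := by
      have h3 : Tendsto (fun n : ℕ => 2 * (1 + 1 / x) / (x + (n : ℝ))) atTop (nhds 0) :=
        tendsto_const_nhds.div_atTop
          (tendsto_atTop_add_const_left _ x tendsto_natCast_atTop_atTop)
      refine squeeze_zero_norm (fun n => ?_) h3
      have h4 := norm_tsum_digammaTerm_le (z := ((x + n : ℝ) : ℂ)) hx (by simp)
      rwa [norm_real, Real.norm_of_nonneg (by positivity)] at h4
    have h3 : Tendsto (fun n : ℕ => P ((x + n : ℝ) : ℂ)) atTop (nhds 0) := by
      simpa using (tendsto_digamma_sub_log_add_nat hx).sub h2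
    simp_rw [h1] at h3
    exact tendsto_nhds_unique tendsto_const_nhds h3
  obtain ⟨c, hc, hcz, hc1⟩ : ∃ c : ℝ, 0 < c ∧ c < z.re ∧ c < 1 :=
    ⟨min z.re 1 / 2, by positivity, by linarith [min_le_left z.re 1, lt_min hz one_pos],
      by linarith [min_le_right z.re 1]⟩
  have hU : IsOpen {w : ℂ | c < w.re} := isOpen_lt continuous_const continuous_re
  have hdiff : DifferentiableOn ℂ P {w | c < w.re} := by
    refine DifferentiableOn.sub (DifferentiableOn.sub ?_ ?_) (differentiableOn_tsum_digammaTerm hc)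
    · have hG : DifferentiableOn ℂ Gamma {w | c < w.re} := fun w hw =>
        (differentiableAt_Gamma w (hne w (hc.trans hw))).differentiableWithinAt
      exact (hG.deriv hU).div hG fun w hw => Gamma_ne_zero (hne w (hc.trans hw))
    · exact fun w hw => (differentiableAt_id.clog (Or.inl (hc.trans hw))).differentiableWithinAt
  have hconv : IsPreconnected {w : ℂ | c < w.re} :=
    (convex_halfSpace_re_gt c).isPreconnected
  have hfreq : ∃ᶠ w in nhdsWithin (1 : ℂ) {1}ᶜ, P w = 0 := by
    have h1 : Tendsto (fun n : ℕ => ((1 + 1 / ((n : ℝ) + 1) : ℝ) : ℂ)) atTop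
        (nhdsWithin (1 : ℂ) {1}ᶜ) := by
      refine tendsto_nhdsWithin_iff.2 ⟨?_, Eventually.of_forall fun n => ?_⟩
      · have h2 := (tendsto_one_div_add_atTop_nhds_zero_nat (𝕜 := ℝ)).const_add 1
        have h3 := (continuous_ofReal.tendsto _).comp h2
        simpa [Function.comp_def] using h3
      · have : (0 : ℝ) < 1 / ((n : ℝ) + 1) := by positivity
        intro h
        have h2 : (1 + 1 / ((n : ℝ) + 1) : ℝ) = 1 := ofReal_injective (h.trans ofReal_one.symm)
        linarith
    exact h1.frequently (Frequently.of_forall fun n => hreal _ (by positivity))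
  have := (hdiff.analyticOnNhd hU).eqOn_zero_of_preconnected_of_frequently_eq_zero hconv
    (z₀ := 1) (by simpa using hc1) hfreq hcz
  exact sub_eq_zero.1 this

theorem norm_digamma_sub_log_le {z : ℂ} {c : ℝ} (hc : 0 < c) (hz : c ≤ z.re) :
    ‖digamma z - log z‖ ≤ 2 * (1 + 1 / c) / ‖z‖ := by
  rw [digamma_sub_log_eq_tsum (hc.trans_le hz)]
  exact norm_tsum_digammaTerm_le hc hz

/-! ### Growth of `ζ` and `χ` in vertical strips. -/

/-- Mellin transforms in the domain of convergence are bounded on vertical strips. -/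
theorem norm_mellin_le_of_re_mem_Icc {f : ℝ → ℂ} {a b : ℝ} (ha : MellinConvergent f a)
    (hb : MellinConvergent f b) :
    ∃ C, ∀ s : ℂ, a ≤ s.re → s.re ≤ b → ‖mellin f s‖ ≤ C := by
  refine ⟨∫ x in Set.Ioi (0 : ℝ), (‖(x : ℂ) ^ ((a : ℂ) - 1) • f x‖ +
    ‖(x : ℂ) ^ ((b : ℂ) - 1) • f x‖), fun s h1 h2 => ?_⟩
  refine norm_integral_le_of_norm_le (ha.norm.add hb.norm) ?_
  filter_upwards [ae_restrict_mem measurableSet_Ioi] with x hx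
  have hx0 : (0 : ℝ) < x := hx
  rw [norm_smul, norm_smul, norm_smul, ← add_mul, norm_cpow_eq_rpow_re_of_pos hx0,
    norm_cpow_eq_rpow_re_of_pos hx0, norm_cpow_eq_rpow_re_of_pos hx0]
  gcongr
  simp only [sub_re, ofReal_re, one_re]
  rcases le_total 1 x with h | h
  · refine le_trans (Real.rpow_le_rpow_of_exponent_le h (sub_le_sub_right h2 1)) ?_
    exact le_add_of_nonneg_left (by positivity)
  · refine le_trans (Real.rpow_le_rpow_of_exponent_ge hx0 h (sub_le_sub_right h1 1)) ?_
    exact le_add_of_nonneg_right (by positivity)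

/-- By definition this function is half the Mellin transform, at `s/2`, of a modified theta kernel
whose Mellin integral converges at every exponent. -/
theorem norm_completedRiemannZeta₀_le (a b : ℝ) :
    ∃ C, ∀ s : ℂ, a ≤ s.re → s.re ≤ b → ‖completedRiemannZeta₀ s‖ ≤ C := by
  set P := HurwitzZeta.hurwitzEvenFEPair 0
  have hP := P.isStrongFEPair_toStrongFEPair
  obtain ⟨C, hC⟩ := norm_mellin_le_of_re_mem_Icc (f := P.f_modif) (a := a / 2) (b := b / 2)
    (hP.hasMellin _).1 (hP.hasMellin _).1
  refine ⟨C / 2, fun s h1 h2 => ?_⟩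
  have h3 : completedRiemannZeta₀ s = mellin P.f_modif (s / 2) / 2 := rfl
  rw [h3, norm_div, norm_ofNat]
  gcongr
  exact hC _ (by simpa using by linarith) (by simpa using by linarith)

theorem exists_Gamma_le_of_mem_Icc {a : ℝ} (ha : 0 < a) (b : ℝ) :
    ∃ C, 0 < C ∧ ∀ x, a ≤ x → x ≤ b → Real.Gamma x ≤ C := by
  have hc : ContinuousOn Real.Gamma (Set.Icc a b) := fun x hx =>
    (Real.differentiableAt_Gamma fun m h => by
      have : (0 : ℝ) ≤ m := m.cast_nonneg
      linarith [hx.1]).continuousAt.continuousWithinAt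
  obtain ⟨C, hC⟩ := isCompact_Icc.exists_bound_of_continuousOn hc
  exact ⟨max C 1, by positivity, fun x h1 h2 =>
    (le_abs_self _).trans ((hC x ⟨h1, h2⟩).trans (le_max_left _ _))⟩

theorem norm_sin_le_exp_abs_im (w : ℂ) : ‖sin w‖ ≤ Real.exp |w.im| := by
  have h1 : sin w = (exp (-w * I) - exp (w * I)) * I / 2 := rfl
  rw [h1, norm_div, norm_mul, norm_I, mul_one, norm_ofNat, div_le_iff₀ two_pos]
  refine (norm_sub_le _ _).trans ?_
  rw [norm_exp, norm_exp]
  have h2 : Real.exp (-w * I).re ≤ Real.exp |w.im| := by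
    apply Real.exp_le_exp.2
    simpa using le_abs_self w.im
  have h3 : Real.exp (w * I).re ≤ Real.exp |w.im| := by
    apply Real.exp_le_exp.2
    simpa using neg_le_abs w.im
  linarith

/-- This form of the reflection formula persists at the poles, where the sine vanishes and `Gamma z
= 0` by convention. -/
theorem inv_Gamma_eq {z : ℂ} (hz : z.re < 1) :
    (Gamma z)⁻¹ = Gamma (1 - z) * sin (Real.pi * z) / Real.pi := by
  have h1 := Gamma_mul_Gamma_one_sub z
  have h2 : Gamma (1 - z) ≠ 0 := Gamma_ne_zero_of_re_pos (by simpa using hz)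
  have hpi : (Real.pi : ℂ) ≠ 0 := by exact_mod_cast Real.pi_ne_zero
  rcases eq_or_ne (sin (Real.pi * z)) 0 with h | h
  · rw [h, div_zero] at h1
    rw [h, (mul_eq_zero.1 h1).resolve_right h2]
    simp
  · have h3 : Gamma z ≠ 0 := fun h0 => by
      rw [h0, zero_mul, eq_comm, div_eq_zero_iff] at h1
      exact h1.elim hpi h
    rw [eq_div_iff h] at h1
    generalize sin (Real.pi * z) = w at *
    field_simp
    linear_combination -h1

/-- Reflection gives the rate `π/4` with a polynomial factor, which the extra `π/8` absorbs. Later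
only a rate below `π/2`, the decay rate of the kernel, is needed. -/
theorem norm_inv_Gammaℝ_le : ∃ C, 0 < C ∧ ∀ s : ℂ, -(1 / 2) ≤ s.re → s.re ≤ 3 / 2 →
    ‖(Gammaℝ s)⁻¹‖ ≤ C * Real.exp (3 * Real.pi / 8 * |s.im|) := by
  obtain ⟨B, hB0, hB⟩ := exists_Gamma_le_of_mem_Icc (a := 1 / 4) (by norm_num) (5 / 4)
  have hpi := Real.pi_pos
  have hpi3 := Real.pi_gt_three
  refine ⟨Real.pi * (6 * B) / Real.pi, by positivity, fun s h1 h2 => ?_⟩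
  have hz : (s / 2).re = s.re / 2 := by simp
  have hzi : (s / 2).im = s.im / 2 := by simp
  rw [Gammaℝ_def, mul_inv, inv_Gamma_eq (by rw [hz]; linarith), norm_mul, norm_div, norm_mul,
    ← cpow_neg, norm_cpow_eq_rpow_re_of_pos hpi, norm_real, Real.norm_of_nonneg hpi.le]
  have e1 : Real.pi ^ (-(-s / 2)).re ≤ Real.pi := by
    nth_rewrite 2 [← Real.rpow_one Real.pi]
    apply Real.rpow_le_rpow_of_exponent_le (by linarith)
    simp
    linarith
  have e2 : ‖Gamma (1 - s / 2)‖ ≤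
      3 * B * (1 + |s.im| / 2) * Real.exp (-(Real.pi / 2) * (|s.im| / 2)) := by
    have hr : (1 - s / 2).re = 1 - s.re / 2 := by simp
    have hi : |(1 - s / 2).im| = |s.im| / 2 := by simp [abs_div]
    have := norm_Gamma_le (z := 1 - s / 2) (by rw [hr]; linarith) (by rw [hr]; linarith)
    rw [hi, hr] at this
    refine this.trans ?_
    gcongr
    exact hB _ (by linarith) (by linarith)
  have e3 : ‖sin (Real.pi * (s / 2))‖ ≤ Real.exp (Real.pi * (|s.im| / 2)) := by
    have hi : |((Real.pi : ℂ) * (s / 2)).im| = Real.pi * (|s.im| / 2) := by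
      rw [im_ofReal_mul, abs_mul, abs_of_pos hpi, hzi, abs_div, abs_two]
    have := norm_sin_le_exp_abs_im (Real.pi * (s / 2))
    rwa [hi] at this
  have e4 : 1 + |s.im| / 2 ≤ 2 * Real.exp (Real.pi / 8 * |s.im|) := by
    have := Real.add_one_le_exp (Real.pi / 8 * |s.im|)
    have h4 := abs_nonneg s.im
    nlinarith
  calc _ ≤ Real.pi * ((3 * B * (1 + |s.im| / 2) * Real.exp (-(Real.pi / 2) * (|s.im| / 2))) *
        Real.exp (Real.pi * (|s.im| / 2)) / Real.pi) := by gcongr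
    _ ≤ Real.pi * ((3 * B * (2 * Real.exp (Real.pi / 8 * |s.im|)) *
        Real.exp (-(Real.pi / 2) * (|s.im| / 2))) *
        Real.exp (Real.pi * (|s.im| / 2)) / Real.pi) := by gcongr
    _ = Real.pi * (6 * B) / Real.pi * (Real.exp (Real.pi / 8 * |s.im|) *
        Real.exp (-(Real.pi / 2) * (|s.im| / 2)) * Real.exp (Real.pi * (|s.im| / 2))) := by ring
    _ = _ := by
        rw [← Real.exp_add, ← Real.exp_add]
        congr 2
        ring

/-- The entire function `(s - 1) ζ(s)`. -/
noncomputable def zetaMulSubOne (s : ℂ) : ℂ :=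
  (s - 1) * completedRiemannZeta₀ s * (Gammaℝ s)⁻¹ + (2 * (Real.pi : ℂ))⁻¹ * (Gammaℝ (s + 2))⁻¹

/-- The second summand carries the polar part of the completed zeta function: `(s-1)(-1/s - 1/(1-s))
= 1/s`, and `1/(s Γℝ(s))` is rewritten as `1/(2π Γℝ(s+2))` so that nothing singular remains at `0`.
-/
theorem differentiable_zetaMulSubOne : Differentiable ℂ zetaMulSubOne := by
  have h1 : Differentiable ℂ fun s : ℂ => (Gammaℝ (s + 2))⁻¹ :=
    differentiable_Gammaℝ_inv.comp (differentiable_id.add_const 2)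
  exact (((differentiable_id.sub_const 1).mul differentiable_completedZeta₀).mul
    differentiable_Gammaℝ_inv).add (h1.const_mul _)

theorem zetaMulSubOne_eq {s : ℂ} (h0 : s ≠ 0) (h1 : s ≠ 1) :
    zetaMulSubOne s = (s - 1) * riemannZeta s := by
  have hs1 : s - 1 ≠ 0 := sub_ne_zero.2 h1
  have hs2 : 1 - s ≠ 0 := sub_ne_zero.2 h1.symm
  have hpi : (Real.pi : ℂ) ≠ 0 := by exact_mod_cast Real.pi_ne_zero
  rw [zetaMulSubOne, riemannZeta_def_of_ne_zero h0, completedRiemannZeta_eq, Gammaℝ_add_two h0]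
  rcases eq_or_ne (Gammaℝ s) 0 with hG | hG
  · simp [hG]
  · field_simp
    ring

theorem norm_zetaMulSubOne_le : ∃ C, 0 < C ∧ ∀ s : ℂ, -(1 / 2) ≤ s.re → s.re ≤ 3 / 2 →
    ‖zetaMulSubOne s‖ ≤ C * Real.exp (7 * Real.pi / 16 * |s.im|) := by
  obtain ⟨A, hA0, hA⟩ := norm_inv_Gammaℝ_le
  obtain ⟨B, hB⟩ := norm_completedRiemannZeta₀_le (-(1 / 2)) (3 / 2)
  have hB0 : 0 ≤ B := (norm_nonneg _).trans (hB 0 (by norm_num) (by norm_num))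
  have hcpt : IsCompact (Set.Icc (-(1 / 2) : ℝ) (3 / 2) ×ℂ Set.Icc (-1 : ℝ) 1) :=
    isCompact_Icc.reProdIm isCompact_Icc
  obtain ⟨D, hD⟩ := hcpt.exists_bound_of_continuousOn
    differentiable_zetaMulSubOne.continuous.continuousOn
  refine ⟨max D 0 + 30 * A * (B + 2), by positivity, fun s h1 h2 => ?_⟩
  have hpi := Real.pi_gt_three
  rcases le_or_gt |s.im| 1 with him | him
  · have h3 := hD s ⟨⟨h1, h2⟩, abs_le.1 him⟩
    have h4 : 1 ≤ Real.exp (7 * Real.pi / 16 * |s.im|) := Real.one_le_exp (by positivity)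
    calc ‖zetaMulSubOne s‖ ≤ max D 0 + 30 * A * (B + 2) :=
          h3.trans ((le_max_left _ _).trans (le_add_of_nonneg_right (by positivity)))
      _ ≤ _ := le_mul_of_one_le_right (by positivity) h4
  · have hs1 : 1 < ‖s‖ := him.trans_le (abs_im_le_norm s)
    have h0 : s ≠ 0 := fun h => by
      rw [h, norm_zero] at hs1
      linarith
    have h1' : s ≠ 1 := fun h => by
      rw [h] at him
      simp at him
      linarith
    have hs3 : ‖s - 1‖ ≤ 3 + |s.im| := by
      refine (norm_le_abs_re_add_abs_im _).trans ?_
      have : |(s - 1).re| ≤ 3 := by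
        rw [sub_re, one_re, abs_le]
        constructor <;> linarith
      have e : (s - 1).im = s.im := by simp
      rw [e]
      linarith
    have hform : zetaMulSubOne s =
        ((s - 1) * completedRiemannZeta₀ s + 1 / s) * (Gammaℝ s)⁻¹ := by
      have hs2 : 1 - s ≠ 0 := sub_ne_zero.2 h1'.symm
      rw [zetaMulSubOne_eq h0 h1', riemannZeta_def_of_ne_zero h0, completedRiemannZeta_eq]
      field_simp
      ring
    rw [hform, norm_mul]
    have h4 : ‖(s - 1) * completedRiemannZeta₀ s + 1 / s‖ ≤ (3 + |s.im|) * (B + 2) := by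
      refine (norm_add_le _ _).trans ?_
      rw [norm_mul, norm_div, norm_one]
      have h5 : 1 / ‖s‖ ≤ 1 := by
        rw [div_le_one (by linarith)]
        exact hs1.le
      have h6 : ‖s - 1‖ * ‖completedRiemannZeta₀ s‖ ≤ (3 + |s.im|) * B :=
        mul_le_mul hs3 (hB s h1 h2) (norm_nonneg _) (by positivity)
      nlinarith
    have h7 : 3 + |s.im| ≤ 30 * Real.exp (Real.pi / 16 * |s.im|) := by
      have := Real.add_one_le_exp (Real.pi / 16 * |s.im|)
      have h4 := abs_nonneg s.im
      nlinarith
    calc _ ≤ (30 * Real.exp (Real.pi / 16 * |s.im|) * (B + 2)) *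
          (A * Real.exp (3 * Real.pi / 8 * |s.im|)) := by
          refine mul_le_mul (h4.trans ?_) (hA s h1 h2) (norm_nonneg _) (by positivity)
          gcongr
      _ = 30 * A * (B + 2) *
          (Real.exp (Real.pi / 16 * |s.im|) * Real.exp (3 * Real.pi / 8 * |s.im|)) := by ring
      _ = 30 * A * (B + 2) * Real.exp (7 * Real.pi / 16 * |s.im|) := by
          rw [← Real.exp_add]
          congr 2
          ring
      _ ≤ _ := by
          gcongr
          exact le_add_of_nonneg_left (le_max_right _ _)

/-- The factor `χ` of the functional equation `ζ(s) = χ(s) ζ(1 - s)`. -/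
noncomputable def chi (s : ℂ) : ℂ := Gammaℝ (1 - s) * (Gammaℝ s)⁻¹

theorem riemannZeta_eq_chi_mul {s : ℂ} (h0 : s ≠ 0) (h1 : s.re < 1) :
    riemannZeta s = chi s * riemannZeta (1 - s) := by
  have h2 : (1 - s) ≠ 0 := fun h => by
    have := congrArg re h
    simp at this
    linarith
  have h3 : Gammaℝ (1 - s) ≠ 0 := Gammaℝ_ne_zero_of_re_pos (by simpa using h1)
  rw [riemannZeta_def_of_ne_zero h0, riemannZeta_def_of_ne_zero h2, completedRiemannZeta_one_sub,
    chi]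
  field_simp

theorem differentiableAt_Gammaℝ {s : ℂ} (hs : 0 < s.re) : DifferentiableAt ℂ Gammaℝ s := by
  have hpi : (Real.pi : ℂ) ≠ 0 := by exact_mod_cast Real.pi_ne_zero
  have h1 : DifferentiableAt ℂ Gamma (s / 2) := differentiableAt_Gamma _ fun m h => by
    have h2 := congrArg re h
    have h3 : (0 : ℝ) ≤ m := m.cast_nonneg
    simp at h2
    linarith
  exact DifferentiableAt.mul ((differentiableAt_id.neg.div_const 2).const_cpow (Or.inl hpi))
    (h1.comp s (differentiableAt_id.div_const 2))

theorem differentiableAt_chi {s : ℂ} (hs : s.re < 1) : DifferentiableAt ℂ chi s := by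
  have h1 : DifferentiableAt ℂ Gammaℝ (1 - s) := differentiableAt_Gammaℝ (by simpa using hs)
  exact (h1.comp s (differentiableAt_id.const_sub 1)).mul (differentiable_Gammaℝ_inv s)

theorem norm_chi_le : ∃ C, 0 < C ∧ ∀ s : ℂ, -(1 / 2) ≤ s.re → s.re ≤ 1 / 2 →
    ‖chi s‖ ≤ C * Real.exp (3 * Real.pi / 8 * |s.im|) := by
  obtain ⟨A, hA0, hA⟩ := norm_inv_Gammaℝ_le
  obtain ⟨B, hB0, hB⟩ := exists_Gamma_le_of_mem_Icc (a := 1 / 4) (by norm_num) (5 / 4)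
  have hpi := Real.pi_gt_three
  refine ⟨3 * B * A, by positivity, fun s h1 h2 => ?_⟩
  have hr : ((1 - s) / 2).re = (1 - s.re) / 2 := by simp
  have hG := norm_Gamma_le (z := (1 - s) / 2) (by rw [hr]; linarith) (by rw [hr]; linarith)
  have e1 : (1 + |((1 - s) / 2).im|) * Real.exp (-(Real.pi / 2) * |((1 - s) / 2).im|) ≤ 1 := by
    have h4 := abs_nonneg ((1 - s) / 2).im
    have h3 : 1 + |((1 - s) / 2).im| ≤ Real.exp (Real.pi / 2 * |((1 - s) / 2).im|) := by
      have := Real.add_one_le_exp (Real.pi / 2 * |((1 - s) / 2).im|)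
      nlinarith
    calc _ ≤ Real.exp (Real.pi / 2 * |((1 - s) / 2).im|) *
          Real.exp (-(Real.pi / 2) * |((1 - s) / 2).im|) := by gcongr
      _ = 1 := by rw [← Real.exp_add]; simp
  have hG0 : 0 < Real.Gamma ((1 - s) / 2).re := Real.Gamma_pos_of_pos (by rw [hr]; linarith)
  have e2 : ‖Gamma ((1 - s) / 2)‖ ≤ 3 * B := by
    refine hG.trans ?_
    rw [mul_assoc]
    calc _ ≤ 3 * Real.Gamma ((1 - s) / 2).re * 1 := by gcongr
      _ ≤ 3 * B := by
        rw [mul_one]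
        gcongr
        exact hB _ (by rw [hr]; linarith) (by rw [hr]; linarith)
  have e3 : ‖(Real.pi : ℂ) ^ (-(1 - s) / 2)‖ ≤ 1 := by
    rw [norm_cpow_eq_rpow_re_of_pos (by linarith)]
    apply Real.rpow_le_one_of_one_le_of_nonpos (by linarith)
    simp
    linarith
  rw [chi, norm_mul, Gammaℝ_def, norm_mul]
  calc _ ≤ 1 * (3 * B) * (A * Real.exp (3 * Real.pi / 8 * |s.im|)) := by
        gcongr
        exact hA s h1 (by linarith)
    _ = _ := by ring

/-- The exact modulus of `χ` on the line `Re s = 1/2`. -/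
theorem norm_chi_of_re_eq_half {s : ℂ} (hs : s.re = 1 / 2) : ‖chi s‖ = 1 := by
  have h1 : 1 - s = (starRingEnd ℂ) s := by
    apply Complex.ext
    · simp [hs]; norm_num
    · simp
  have h2 : Gammaℝ s ≠ 0 := Gammaℝ_ne_zero_of_re_pos (by rw [hs]; norm_num)
  have h3 : ‖Gammaℝ ((starRingEnd ℂ) s)‖ = ‖Gammaℝ s‖ := by
    rw [Gammaℝ_def, Gammaℝ_def, norm_mul, norm_mul, norm_cpow_eq_rpow_re_of_pos Real.pi_pos,
      norm_cpow_eq_rpow_re_of_pos Real.pi_pos]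
    have h4 : (starRingEnd ℂ) s / 2 = (starRingEnd ℂ) (s / 2) := by rw [map_div₀, map_ofNat]
    rw [h4, Gamma_conj, norm_conj]
    simp
  rw [chi, h1, norm_mul, h3, norm_inv, mul_inv_cancel₀ (norm_ne_zero_iff.2 h2)]

/-- The exact modulus of `χ` on the line `Re s = -1/2`. -/
theorem norm_chi_of_re_eq_neg_half {s : ℂ} (hs : s.re = -(1 / 2)) :
    ‖chi s‖ = ‖s‖ / (2 * Real.pi) := by
  have hs0 : s ≠ 0 := fun h => by
    rw [h] at hs
    simp at hs
  -- On this line `s ↦ 1 - s` is conjugation of `s + 2`, so the modulus follows from `Γℝ(s+2) =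
  -- Γℝ(s) s / (2π)`.
  have h1 : 1 - s = (starRingEnd ℂ) (s + 2) := by
    apply Complex.ext
    · simp [hs]; norm_num
    · simp
  have h2 : Gammaℝ s ≠ 0 := by
    rw [Ne, Gammaℝ_eq_zero_iff]
    rintro ⟨n, h⟩
    have h3 := congrArg re h
    simp [hs] at h3
    rcases n with _ | n
    · simp at h3
    · push_cast at h3
      have : (0 : ℝ) ≤ n := n.cast_nonneg
      linarith
  have h3 : ‖Gammaℝ ((starRingEnd ℂ) (s + 2))‖ = ‖Gammaℝ (s + 2)‖ := by
    rw [Gammaℝ_def, Gammaℝ_def, norm_mul, norm_mul, norm_cpow_eq_rpow_re_of_pos Real.pi_pos,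
      norm_cpow_eq_rpow_re_of_pos Real.pi_pos]
    have h4 : (starRingEnd ℂ) (s + 2) / 2 = (starRingEnd ℂ) ((s + 2) / 2) := by
      rw [map_div₀, map_ofNat]
    rw [h4, Gamma_conj, norm_conj]
    simp
  have h5 : ‖Gammaℝ s‖ ≠ 0 := norm_ne_zero_iff.2 h2
  rw [chi, h1, norm_mul, h3, norm_inv, Gammaℝ_add_two hs0]
  simp only [norm_div, norm_mul, norm_ofNat, norm_real, Real.norm_of_nonneg Real.pi_pos.le]
  field_simp

/-! ### Integrals along horizontal lines. -/

theorem integrable_exp_neg_mul_abs {δ : ℝ} (hδ : 0 < δ) :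
    Integrable fun y : ℝ => Real.exp (-δ * |y|) := by
  rw [← integrableOn_univ, ← Set.Iic_union_Ioi (a := (0 : ℝ)), integrableOn_union]
  constructor
  · refine (integrableOn_exp_mul_Iic hδ 0).congr_fun (fun y hy => ?_) measurableSet_Iic
    simp only
    rw [abs_of_nonpos hy]
    ring_nf
  · refine (exp_neg_integrableOn_Ioi 0 hδ).congr_fun (fun y hy => ?_) measurableSet_Ioi
    simp only
    rw [abs_of_pos hy]

theorem integrable_of_exp_decay {f : ℝ → ℂ} (hf : Continuous f) {C δ : ℝ} (hδ : 0 < δ)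
    (hdec : ∀ y, 1 ≤ |y| → ‖f y‖ ≤ C * Real.exp (-δ * |y|)) : Integrable f := by
  obtain ⟨B, hB⟩ := isCompact_Icc.exists_bound_of_continuousOn
    (hf.continuousOn (s := Set.Icc (-1 : ℝ) 1))
  refine ((integrable_exp_neg_mul_abs hδ).const_mul (max C 0 + max B 0 * Real.exp δ)).mono'
    hf.aestronglyMeasurable (Eventually.of_forall fun y => ?_)
  rcases le_or_gt 1 |y| with h | h
  · refine (hdec y h).trans ?_
    gcongr
    exact (le_max_left _ _).trans (le_add_of_nonneg_right (by positivity))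
  · have h1 := hB y (abs_le.1 h.le)
    have h2 : 1 ≤ Real.exp δ * Real.exp (-δ * |y|) := by
      rw [← Real.exp_add]
      apply Real.one_le_exp
      nlinarith
    calc ‖f y‖ ≤ max B 0 * 1 := by rw [mul_one]; exact h1.trans (le_max_left _ _)
      _ ≤ max B 0 * (Real.exp δ * Real.exp (-δ * |y|)) := by gcongr
      _ ≤ _ := by
        rw [add_mul, mul_assoc]
        exact le_add_of_nonneg_left (by positivity)

theorem integrable_line {f : ℂ → ℂ} {a b : ℝ}
    (hf : DifferentiableOn ℂ f {z | a ≤ z.im ∧ z.im ≤ b}) {C δ : ℝ} (hδ : 0 < δ)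
    (hdec : ∀ z : ℂ, a ≤ z.im → z.im ≤ b → 1 ≤ |z.re| → ‖f z‖ ≤ C * Real.exp (-δ * |z.re|))
    {c : ℝ} (hac : a ≤ c) (hcb : c ≤ b) : Integrable fun y : ℝ => f (y + c * I) := by
  refine integrable_of_exp_decay (C := C) ?_ hδ fun y hy => ?_
  · rw [← continuousOn_univ]
    refine hf.continuousOn.comp (by fun_prop) fun y _ => ?_
    simpa using ⟨hac, hcb⟩
  · have := hdec (y + c * I) (by simpa using hac) (by simpa using hcb) (by simpa using hy)
    simpa using this

/-- Shifting a horizontal line of integration through a strip of holomorphy. -/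
theorem integral_line_eq {f : ℂ → ℂ} {a b : ℝ} (hab : a ≤ b)
    (hf : DifferentiableOn ℂ f {z | a ≤ z.im ∧ z.im ≤ b}) {C δ : ℝ} (hδ : 0 < δ)
    (hdec : ∀ z : ℂ, a ≤ z.im → z.im ≤ b → 1 ≤ |z.re| → ‖f z‖ ≤ C * Real.exp (-δ * |z.re|)) :
    ∫ y : ℝ, f (y + a * I) = ∫ y : ℝ, f (y + b * I) := by
  have hi1 := integrable_line hf hδ hdec le_rfl hab
  have hi2 := integrable_line hf hδ hdec hab le_rfl
  have hbot : Tendsto (fun n : ℕ => -(n : ℝ)) atTop atBot :=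
    tendsto_neg_atTop_atBot.comp tendsto_natCast_atTop_atTop
  have t1 := intervalIntegral_tendsto_integral hi1 hbot tendsto_natCast_atTop_atTop
  have t2 := intervalIntegral_tendsto_integral hi2 hbot tendsto_natCast_atTop_atTop
  have hrect : ∀ n : ℕ, (∫ x in (-(n : ℝ))..n, f (x + a * I)) -
      (∫ x in (-(n : ℝ))..n, f (x + b * I)) =
      I • (∫ y in a..b, f ((-(n : ℝ) : ℝ) + y * I)) - I • (∫ y in a..b, f ((n : ℝ) + y * I)) := by
    intro n
    have := integral_boundary_rect_eq_zero_of_differentiableOn f (-(n : ℝ) + a * I)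
      ((n : ℝ) + b * I) (hf.mono fun z hz => by
        have h2 := hz.2
        simp only [Set.mem_preimage, add_im, mul_im, ofReal_im, ofReal_re, I_re, I_im,
          neg_im] at h2
        simp only [mul_zero, mul_one, neg_zero, zero_add, add_zero] at h2
        rwa [Set.uIcc_of_le hab] at h2)
    simp only [add_re, neg_re, ofReal_re, mul_re, I_re, mul_zero, ofReal_im, I_im, mul_one, sub_self,
      add_zero, add_im, neg_im, mul_im, neg_zero, zero_add] at this
    linear_combination this
  have hvert : ∀ σ : ℝ, |σ| = 1 →
      Tendsto (fun n : ℕ => ∫ y in a..b, f ((σ * n : ℝ) + y * I)) atTop (nhds 0) := by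
    intro σ hσ
    have h1 : Tendsto (fun n : ℕ => C * Real.exp (-δ * n) * |b - a|) atTop (nhds 0) := by
      have h2 : Tendsto (fun n : ℕ => Real.exp (-δ * (n : ℝ))) atTop (nhds 0) := by
        refine Real.tendsto_exp_atBot.comp ?_
        exact (tendsto_natCast_atTop_atTop).const_mul_atTop_of_neg (by linarith)
      simpa using (h2.const_mul C).mul_const |b - a|
    refine squeeze_zero_norm' ?_ h1
    filter_upwards [eventually_ge_atTop 1] with n hn
    have hn' : (1 : ℝ) ≤ n := by exact_mod_cast hn
    refine intervalIntegral.norm_integral_le_of_norm_le_const fun y hy => ?_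
    rw [Set.uIoc_of_le hab] at hy
    have h3 : |((σ * n : ℝ) + y * I : ℂ).re| = n := by
      simp [abs_mul, hσ]
    have := hdec ((σ * n : ℝ) + y * I) (by simpa using hy.1.le) (by simpa using hy.2)
      (by rw [h3]; exact hn')
    rwa [h3] at this
  have t3 := (((hvert (-1) (by simp)).const_smul I).sub ((hvert 1 (by simp)).const_smul I))
  have t4 := t1.sub t2
  simp only [smul_zero, sub_zero, neg_one_mul, one_mul] at t3
  have t5 := t4.congr hrect
  exact sub_eq_zero.1 (tendsto_nhds_unique t5 t3)

theorem integral_inv_cosh : ∫ y : ℝ, 1 / Real.cosh (Real.pi * y / 2) = 2 ∧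
    Integrable fun y : ℝ => 1 / Real.cosh (Real.pi * y / 2) := by
  have hpi := Real.pi_pos
  have hcont : Continuous fun y : ℝ => 1 / Real.cosh (Real.pi * y / 2) :=
    continuous_const.div (by fun_prop) fun y => (Real.cosh_pos _).ne'
  have hint : Integrable fun y : ℝ => 1 / Real.cosh (Real.pi * y / 2) := by
    refine ((integrable_exp_neg_mul_abs (δ := Real.pi / 2) (by positivity)).const_mul 2).mono'
      hcont.aestronglyMeasurable (Eventually.of_forall fun y => ?_)
    rw [Real.norm_of_nonneg (by positivity), div_le_iff₀ (Real.cosh_pos _), ← Real.cosh_abs,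
      Real.cosh_eq]
    have h1 : |Real.pi * y / 2| = Real.pi / 2 * |y| := by
      rw [abs_div, abs_mul, abs_of_pos hpi, abs_two]
      ring
    rw [h1, neg_mul]
    have h2 : Real.exp (-(Real.pi / 2 * |y|)) * Real.exp (Real.pi / 2 * |y|) = 1 := by
      rw [← Real.exp_add]
      simp
    nlinarith [sq_nonneg (Real.exp (-(Real.pi / 2 * |y|)))]
  refine ⟨?_, hint⟩
  have hd : ∀ y : ℝ, HasDerivAt (fun y : ℝ => 4 / Real.pi * Real.arctan (Real.exp (Real.pi * y / 2)))
      (1 / Real.cosh (Real.pi * y / 2)) y := by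
    intro y
    have h1 : HasDerivAt (fun y : ℝ => Real.pi * y / 2) (Real.pi * 1 / 2) y :=
      ((hasDerivAt_id y).const_mul Real.pi).div_const 2
    refine (h1.exp.arctan.const_mul (4 / Real.pi)).congr_deriv ?_
    rw [Real.cosh_eq, Real.exp_neg]
    have := Real.exp_pos (Real.pi * y / 2)
    field_simp
    ring
  have htop : Tendsto (fun y : ℝ => Real.pi * y / 2) atTop atTop := by
    have := tendsto_id.const_mul_atTop (show 0 < Real.pi / 2 by positivity)
    refine this.congr fun y => ?_
    simp only [id]
    ring
  have hbot : Tendsto (fun y : ℝ => Real.pi * y / 2) atBot atBot := by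
    have := tendsto_id.const_mul_atBot (show 0 < Real.pi / 2 by positivity)
    refine this.congr fun y => ?_
    simp only [id]
    ring
  have h1 : Tendsto (fun y : ℝ => 4 / Real.pi * Real.arctan (Real.exp (Real.pi * y / 2))) atTop
      (nhds (4 / Real.pi * (Real.pi / 2))) :=
    ((Real.tendsto_arctan_atTop.mono_right nhdsWithin_le_nhds).comp
      (Real.tendsto_exp_atTop.comp htop)).const_mul _
  have h2 : Tendsto (fun y : ℝ => 4 / Real.pi * Real.arctan (Real.exp (Real.pi * y / 2))) atBot
      (nhds (4 / Real.pi * Real.arctan 0)) :=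
    ((Real.continuous_arctan.tendsto 0).comp (Real.tendsto_exp_atBot.comp hbot)).const_mul _
  rw [integral_of_hasDerivAt_of_tendsto hd hint h2 h1]
  simp
  field_simp
  norm_num

/-! ### The kernel and its residue. -/

/-- The kernel `π / (2 sinh (π x / 2))`. -/
noncomputable def cschKernel (x : ℂ) : ℂ := Real.pi / (2 * sinh (Real.pi * x / 2))

theorem sq_norm_sinh (z : ℂ) : ‖sinh z‖ ^ 2 = Real.sinh z.re ^ 2 + Real.sin z.im ^ 2 := by
  have h1 : sinh z = (Real.sinh z.re * Real.cos z.im : ℝ) +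
      (Real.cosh z.re * Real.sin z.im : ℝ) * I := by
    nth_rewrite 1 [← re_add_im z]
    rw [sinh_add, sinh_mul_I, cosh_mul_I]
    push_cast
    ring
  rw [h1, ← normSq_eq_norm_sq, normSq_add_mul_I]
  have h2 := Real.sin_sq_add_cos_sq z.im
  have h3 := Real.cosh_sq z.re
  rw [mul_pow, mul_pow, h3]
  linear_combination Real.sinh z.re ^ 2 * h2

theorem re_pi_mul_div_two (x : ℂ) : (Real.pi * x / 2 : ℂ).re = Real.pi * x.re / 2 := by
  rw [div_ofNat_re, re_ofReal_mul]

theorem im_pi_mul_div_two (x : ℂ) : (Real.pi * x / 2 : ℂ).im = Real.pi * x.im / 2 := by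
  rw [div_ofNat_im, im_ofReal_mul]

theorem exp_abs_le_cosh (u : ℝ) : Real.exp |u| / 2 ≤ Real.cosh u := by
  rw [← Real.cosh_abs, Real.cosh_eq]
  have := Real.exp_pos (-|u|)
  linarith

/-- It rests on `|sinh (a + ib)|² = sinh² a + sin² b ≥ cosh² a sin² b`. -/
theorem norm_cschKernel_le_of_sin {x : ℂ} (hx : Real.sin (Real.pi * x.im / 2) ≠ 0) :
    ‖cschKernel x‖ ≤ Real.pi / |Real.sin (Real.pi * x.im / 2)| *
      Real.exp (-(Real.pi / 2) * |x.re|) := by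
  have hpi := Real.pi_pos
  have h1 : Real.cosh (Real.pi * x.re / 2) * |Real.sin (Real.pi * x.im / 2)| ≤
      ‖sinh (Real.pi * x / 2)‖ := by
    refine (pow_le_pow_iff_left₀ (by positivity) (norm_nonneg _) two_ne_zero).1 ?_
    rw [sq_norm_sinh, re_pi_mul_div_two, im_pi_mul_div_two, mul_pow, sq_abs, Real.cosh_sq]
    nlinarith [Real.sin_sq_le_one (Real.pi * x.im / 2), sq_nonneg (Real.sinh (Real.pi * x.re / 2))]
  have h2 := exp_abs_le_cosh (Real.pi * x.re / 2)
  have h3 : |Real.pi * x.re / 2| = Real.pi / 2 * |x.re| := by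
    rw [abs_div, abs_mul, abs_of_pos hpi, abs_two]
    ring
  rw [h3] at h2
  have hs := abs_pos.2 hx
  have h4 : Real.exp (Real.pi / 2 * |x.re|) / 2 * |Real.sin (Real.pi * x.im / 2)| ≤
      ‖sinh (Real.pi * x / 2)‖ := (mul_le_mul_of_nonneg_right h2 hs.le).trans h1
  rw [cschKernel, norm_div, norm_mul, norm_real, Real.norm_of_nonneg hpi.le, norm_ofNat]
  calc _ ≤ Real.pi / (2 * (Real.exp (Real.pi / 2 * |x.re|) / 2 *
        |Real.sin (Real.pi * x.im / 2)|)) := by gcongr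
    _ = _ := by
      rw [neg_mul, Real.exp_neg]
      field_simp

theorem norm_cschKernel_le_of_abs_im_eq_one {x : ℂ} (hx : |x.im| = 1) :
    ‖cschKernel x‖ ≤ Real.pi * Real.exp (-(Real.pi / 2) * |x.re|) := by
  have h1 : |Real.sin (Real.pi * x.im / 2)| = 1 := by
    rcases (abs_eq zero_le_one).1 hx with h | h
    · rw [h, mul_one, Real.sin_pi_div_two, abs_one]
    · rw [h, mul_neg, mul_one, neg_div, Real.sin_neg, Real.sin_pi_div_two, abs_neg, abs_one]
  have := norm_cschKernel_le_of_sin (x := x) (fun h => by rw [h, abs_zero] at h1; linarith)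
  rwa [h1, div_one] at this

theorem norm_cschKernel_le_of_one_le_abs_re {x : ℂ} (hx : 1 ≤ |x.re|) :
    ‖cschKernel x‖ ≤ 2 * Real.pi * Real.exp (-(Real.pi / 2) * |x.re|) := by
  have hpi := Real.pi_gt_three
  have h1 : Real.exp (Real.pi / 2 * |x.re|) / 4 ≤ ‖sinh (Real.pi * x / 2)‖ := by
    refine (pow_le_pow_iff_left₀ (by positivity) (norm_nonneg _) two_ne_zero).1 ?_
    rw [sq_norm_sinh, re_pi_mul_div_two]
    have h2 : Real.exp (Real.pi / 2 * |x.re|) / 4 ≤ Real.sinh (Real.pi / 2 * |x.re|) := by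
      rw [Real.sinh_eq]
      have h3 : Real.exp (-(Real.pi / 2 * |x.re|)) ≤ 1 := by
        apply Real.exp_le_one_iff.2
        have : 0 ≤ Real.pi / 2 * |x.re| := by positivity
        linarith
      have h4 := Real.add_one_le_exp (Real.pi / 2 * |x.re|)
      nlinarith
    have h5 : Real.sinh (Real.pi * x.re / 2) ^ 2 = Real.sinh (Real.pi / 2 * |x.re|) ^ 2 := by
      have h6 : |Real.pi * x.re / 2| = Real.pi / 2 * |x.re| := by
        rw [abs_div, abs_mul, abs_of_pos (by positivity), abs_two]
        ring
      rw [← h6, ← Real.abs_sinh, sq_abs]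
    rw [h5]
    have := pow_le_pow_left₀ (by positivity) h2 2
    nlinarith [sq_nonneg (Real.sin (Real.pi * x / 2 : ℂ).im)]
  rw [cschKernel, norm_div, norm_mul, norm_real, Real.norm_of_nonneg (by positivity), norm_ofNat]
  calc _ ≤ Real.pi / (2 * (Real.exp (Real.pi / 2 * |x.re|) / 4)) := by gcongr
    _ = _ := by
      rw [neg_mul, Real.exp_neg]
      field_simp
      norm_num

/-- The factor `y` cancels the pole. For `|y| < 1` the left side is at most `1` by `|sinh u| ≥ |u|`,
and the right side is at least `1` because `e^(-2) ≥ 1/8`. -/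
theorem norm_mul_cschKernel_ofReal_le (y : ℝ) :
    ‖(y : ℂ) * cschKernel y‖ ≤ 8 * (1 + |y|) * Real.exp (-(Real.pi / 2) * |y|) := by
  have hpi := Real.pi_gt_three
  have hpi2 := Real.pi_lt_d2
  have hy := abs_nonneg y
  rw [norm_mul, norm_real, Real.norm_eq_abs]
  rcases le_or_gt 1 |y| with h | h
  · have h1 := norm_cschKernel_le_of_one_le_abs_re (x := (y : ℂ)) (by simpa using h)
    rw [ofReal_re] at h1
    calc |y| * ‖cschKernel y‖ ≤ (1 + |y|) * (8 * Real.exp (-(Real.pi / 2) * |y|)) := by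
          gcongr
          · linarith
          · refine h1.trans ?_
            gcongr
            linarith
      _ = _ := by ring
  · have h1 : |y| * ‖cschKernel y‖ ≤ 1 := by
      rcases eq_or_ne y 0 with h0 | h0
      · simp [h0]
      have h2 : (sinh (Real.pi * y / 2) : ℂ) = (Real.sinh (Real.pi * y / 2) : ℝ) := by
        push_cast
        rfl
      have h3 : Real.pi * |y| / 2 ≤ |Real.sinh (Real.pi * y / 2)| := by
        have h4 : |Real.pi * y / 2| = Real.pi * |y| / 2 := by
          rw [abs_div, abs_mul, abs_of_pos (by positivity : 0 < Real.pi), abs_two]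
        rw [Real.abs_sinh, h4]
        exact Real.self_le_sinh_iff.2 (by positivity)
      have hy0 := abs_pos.2 h0
      rw [cschKernel, h2, norm_div, norm_mul, norm_real, norm_real, norm_ofNat,
        Real.norm_of_nonneg (by positivity), Real.norm_eq_abs, mul_div_assoc', div_le_one]
      · linarith
      · have : 0 < Real.pi * |y| / 2 := by positivity
        linarith
    refine h1.trans ?_
    have h4 : Real.exp (-2) ≤ Real.exp (-(Real.pi / 2) * |y|) := by
      apply Real.exp_le_exp.2
      nlinarith
    have h5 : 1 / 8 ≤ Real.exp (-2 : ℝ) := by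
      rw [Real.exp_neg, ← one_div]
      apply one_div_le_one_div_of_le (Real.exp_pos _)
      have := Real.exp_one_lt_d9
      have h6 : Real.exp 2 = Real.exp 1 * Real.exp 1 := by rw [← Real.exp_add]; norm_num
      rw [h6]
      nlinarith [Real.exp_pos 1]
    nlinarith

theorem sinh_pi_mul_div_two_ne_zero {x : ℂ} (hx : x ≠ 0) (him : |x.im| < 2) :
    sinh (Real.pi * x / 2) ≠ 0 := by
  intro h
  have hpi := Real.pi_pos
  have h1 := sq_norm_sinh (Real.pi * x / 2)
  rw [h, norm_zero, re_pi_mul_div_two, im_pi_mul_div_two] at h1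
  have h2 : Real.sinh (Real.pi * x.re / 2) = 0 := by
    nlinarith [sq_nonneg (Real.sinh (Real.pi * x.re / 2)), sq_nonneg (Real.sin (Real.pi * x.im / 2))]
  have h3 : Real.sin (Real.pi * x.im / 2) = 0 := by
    nlinarith [sq_nonneg (Real.sinh (Real.pi * x.re / 2)), sq_nonneg (Real.sin (Real.pi * x.im / 2))]
  rw [Real.sinh_eq_zero] at h2
  have him' := abs_lt.1 him
  rw [Real.sin_eq_zero_iff_of_lt_of_lt (by nlinarith) (by nlinarith)] at h3
  apply hx
  apply Complex.ext
  · simpa [hpi.ne'] using h2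
  · simpa [hpi.ne'] using h3

theorem differentiableAt_cschKernel {x : ℂ} (hx : x ≠ 0) (him : |x.im| < 2) :
    DifferentiableAt ℂ cschKernel x := by
  have h1 : DifferentiableAt ℂ (fun x : ℂ => sinh (Real.pi * x / 2)) x := by fun_prop
  exact (differentiableAt_const _).div (h1.const_mul 2)
    (mul_ne_zero two_ne_zero (sinh_pi_mul_div_two_ne_zero hx him))

/-- `(g(x) - g(0)) π / (2 sinh (π x / 2))` with the singularity at `0` removed. -/
noncomputable def cschMul (g : ℂ → ℂ) (x : ℂ) : ℂ :=
  dslope g 0 x * (Real.pi / 2) / dslope (fun x : ℂ => sinh (Real.pi * x / 2)) 0 x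

theorem cschMul_of_ne {g : ℂ → ℂ} {x : ℂ} (hx : x ≠ 0) :
    cschMul g x = (g x - g 0) * cschKernel x := by
  rw [cschMul, dslope_of_ne _ hx, dslope_of_ne _ hx, slope_def_field, slope_def_field, cschKernel]
  simp only [mul_zero, zero_div, sinh_zero, sub_zero]
  field_simp

theorem differentiableOn_cschMul {g : ℂ → ℂ} {U : Set ℂ} (hU : IsOpen U) (h0 : (0 : ℂ) ∈ U)
    (him : ∀ x ∈ U, |x.im| < 2) (hg : DifferentiableOn ℂ g U) :
    DifferentiableOn ℂ (cschMul g) U := by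
  have hs : Differentiable ℂ (fun x : ℂ => sinh (Real.pi * x / 2)) := by fun_prop
  refine DifferentiableOn.div
    (((differentiableOn_dslope (hU.mem_nhds h0)).2 hg).mul_const _)
    ((differentiableOn_dslope (hU.mem_nhds h0)).2 hs.differentiableOn) fun x hx => ?_
  rcases eq_or_ne x 0 with h | h
  · rw [h, dslope_same]
    have h1 : HasDerivAt (fun x : ℂ => sinh (Real.pi * x / 2))
        (cosh (Real.pi * 0 / 2) * (Real.pi * 1 / 2)) 0 :=
      (((hasDerivAt_id (0 : ℂ)).const_mul (Real.pi : ℂ)).div_const 2).csinh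
    rw [h1.deriv]
    simp
  · rw [dslope_of_ne _ h, slope_def_field]
    simp only [mul_zero, zero_div, sinh_zero, sub_zero]
    exact div_ne_zero (sinh_pi_mul_div_two_ne_zero h (him x hx)) h

theorem norm_cschMul_le {g : ℂ → ℂ} {z : ℂ} {C a : ℝ} (ha0 : 0 ≤ a) (hC : 0 ≤ C)
    (hgz : ‖g z‖ ≤ C * Real.exp (a * |z.re|)) (hg0 : ‖g 0‖ ≤ C) (hz1 : 1 ≤ |z.re|) :
    ‖cschMul g z‖ ≤ 2 * C * (2 * Real.pi) * Real.exp (-(Real.pi / 2 - a) * |z.re|) := by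
  have hpi := Real.pi_pos
  have hz : z ≠ 0 := fun h => by
    rw [h] at hz1
    simp at hz1
    linarith
  rw [cschMul_of_ne hz, norm_mul]
  have h5 : ‖g 0‖ ≤ C * Real.exp (a * |z.re|) :=
    hg0.trans (le_mul_of_one_le_right hC (Real.one_le_exp (by positivity)))
  have h7 : ‖g z - g 0‖ ≤ 2 * C * Real.exp (a * |z.re|) := by
    refine (norm_sub_le _ _).trans ?_
    linarith
  calc _ ≤ (2 * C * Real.exp (a * |z.re|)) *
        (2 * Real.pi * Real.exp (-(Real.pi / 2) * |z.re|)) :=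
        mul_le_mul h7 (norm_cschKernel_le_of_one_le_abs_re hz1) (norm_nonneg _) (by positivity)
    _ = 2 * C * (2 * Real.pi) * (Real.exp (a * |z.re|) * Real.exp (-(Real.pi / 2) * |z.re|)) := by
        ring
    _ = _ := by
        rw [← Real.exp_add]
        congr 2
        ring

theorem cschKernel_add_I (y : ℝ) :
    cschKernel (y + (1 : ℝ) * I) = -(Real.pi * I / 2) * (1 / Real.cosh (Real.pi * y / 2) : ℝ) := by
  have h1 : (Real.pi * (y + (1 : ℝ) * I) / 2 : ℂ) = (Real.pi * y / 2 : ℂ) + (Real.pi / 2 : ℂ) * I := by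
    push_cast
    ring
  have hc : (Real.cosh (Real.pi * y / 2) : ℂ) ≠ 0 := by exact_mod_cast (Real.cosh_pos _).ne'
  rw [cschKernel, h1, sinh_add, sinh_mul_I, cosh_mul_I, cos_pi_div_two, sin_pi_div_two]
  push_cast at hc ⊢
  field_simp
  linear_combination cosh (Real.pi * y / 2 : ℂ) * I_sq

theorem cschKernel_neg (x : ℂ) : cschKernel (-x) = -cschKernel x := by
  rw [cschKernel, cschKernel]
  have : (Real.pi * -x / 2 : ℂ) = -(Real.pi * x / 2) := by ring
  rw [this, sinh_neg, mul_neg, div_neg]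

theorem cschKernel_sub_I (y : ℝ) :
    cschKernel (y + (-1 : ℝ) * I) = Real.pi * I / 2 * (1 / Real.cosh (Real.pi * y / 2) : ℝ) := by
  have h1 : (y + (-1 : ℝ) * I : ℂ) = -((-y : ℝ) + (1 : ℝ) * I) := by
    push_cast
    ring
  have h2 : Real.pi * -y / 2 = -(Real.pi * y / 2) := by ring
  rw [h1, cschKernel_neg, cschKernel_add_I, h2, Real.cosh_neg]
  ring

/-- The residue theorem for `g(x) π / (2 sinh (π x / 2))` in the strip `|Im x| ≤ 1`. -/
theorem integral_mul_cschKernel_sub {g : ℂ → ℂ} (hg : Differentiable ℂ g) {C a : ℝ}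
    (ha : a < Real.pi / 2) (ha0 : 0 ≤ a)
    (hb : ∀ x : ℂ, |x.im| ≤ 1 → ‖g x‖ ≤ C * Real.exp (a * |x.re|)) :
    (∫ y : ℝ, g (y + (-1 : ℝ) * I) * cschKernel (y + (-1 : ℝ) * I)) -
      (∫ y : ℝ, g (y + (1 : ℝ) * I) * cschKernel (y + (1 : ℝ) * I)) =
      2 * Real.pi * I * g 0 := by
  have hpi := Real.pi_pos
  have hU : IsOpen {x : ℂ | |x.im| < 2} := isOpen_lt (by fun_prop) continuous_const
  have hd := differentiableOn_cschMul hU (by simp) (fun x hx => hx)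
    (hg.differentiableOn (s := {x : ℂ | |x.im| < 2}))
  have hd' : DifferentiableOn ℂ (cschMul g) {z | -1 ≤ z.im ∧ z.im ≤ 1} :=
    hd.mono fun z hz => by
      have : |z.im| ≤ 1 := abs_le.2 hz
      exact this.trans_lt one_lt_two
  have hC : 0 ≤ C := by
    have := (norm_nonneg _).trans (hb 0 (by simp))
    simpa using this
  have hdec : ∀ z : ℂ, -1 ≤ z.im → z.im ≤ 1 → 1 ≤ |z.re| →
      ‖cschMul g z‖ ≤ 2 * C * (2 * Real.pi) * Real.exp (-(Real.pi / 2 - a) * |z.re|) := by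
    intro z h1 h2 h3
    have h6 := hb 0 (by simp)
    simp only [zero_re, abs_zero, mul_zero, Real.exp_zero, mul_one] at h6
    exact norm_cschMul_le ha0 hC (hb z (abs_le.2 ⟨h1, h2⟩)) h6 h3
  have hδ : 0 < Real.pi / 2 - a := by linarith
  have key := integral_line_eq (by norm_num : (-1 : ℝ) ≤ 1) hd' hδ hdec
  obtain ⟨hcosh, hcoshi⟩ := integral_inv_cosh
  have hcoshC : ∫ y : ℝ, ((1 / Real.cosh (Real.pi * y / 2) : ℝ) : ℂ) = 2 := by
    exact (integral_ofReal (f := fun y : ℝ => 1 / Real.cosh (Real.pi * y / 2))).trans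
      (by rw [hcosh]; norm_num)
  -- Only `g 0 * cschKernel` is singular. On `Im x = ±1` the kernel is `∓(πi/2) / cosh (πy/2)` with
  -- integral `∓πi`, while the holomorphic remainder `cschMul g` has equal integrals on the two
  -- lines; the difference is `2πi g(0)`.
  have hsplit : ∀ c : ℝ, |c| = 1 → ∀ w : ℂ,
      (∀ y : ℝ, cschKernel (y + c * I) = w * (1 / Real.cosh (Real.pi * y / 2) : ℝ)) →
      ∫ y : ℝ, g (y + c * I) * cschKernel (y + c * I) =
        (∫ y : ℝ, cschMul g (y + c * I)) + g 0 * (w * 2) := by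
    intro c hc w hw
    have hcm := abs_le.1 hc.le
    have hint := integrable_line hd' hδ hdec hcm.1 hcm.2
    have hk : Integrable fun y : ℝ => g 0 * (w * ((1 / Real.cosh (Real.pi * y / 2) : ℝ) : ℂ)) :=
      (hcoshi.ofReal.const_mul w).const_mul (g 0)
    rw [← hcoshC, ← integral_const_mul, ← integral_const_mul, ← integral_add hint hk]
    refine integral_congr_ae (Eventually.of_forall fun y => ?_)
    have hne : (y + c * I : ℂ) ≠ 0 := fun h => by
      have := congrArg im h
      simp at this
      rw [this] at hc
      simp at hc
    simp only
    rw [cschMul_of_ne hne, ← hw y]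
    ring
  rw [hsplit (-1) (by simp) _ cschKernel_sub_I, hsplit 1 (by simp) _ cschKernel_add_I, key]
  ring

/-! ### The Weyl bound for weighted integrals of `ζ`. -/

theorem sum_range_mul_by_parts (z a : ℕ → ℂ) (M : ℕ) :
    ∑ n ∈ Finset.range M, z n * a n = (∑ n ∈ Finset.range M, z n) * a M +
      ∑ n ∈ Finset.range M, (∑ k ∈ Finset.range (n + 1), z k) * (a n - a (n + 1)) := by
  induction M with
  | zero => simp
  | succ M ih =>
    rw [Finset.sum_range_succ, ih, Finset.sum_range_succ (fun n => (_ : ℂ) * (a n - a (n + 1))),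
      Finset.sum_range_succ]
    ring

theorem norm_cpow_sub_cpow_add_one_le {m : ℝ} (hm : 0 < m) {w : ℂ} (hw : w.re ≤ 1) :
    ‖(m : ℂ) ^ w - ((m : ℂ) + 1) ^ w‖ ≤ ‖w‖ * m ^ (w.re - 1) := by
  have hd : ∀ u ∈ Set.Icc (0 : ℝ) 1, HasDerivWithinAt (fun u : ℝ => ((m : ℂ) + u) ^ w)
      (w * ((m : ℂ) + u) ^ (w - 1) * 1) (Set.Icc (0 : ℝ) 1) u := by
    intro u hu
    have h1 : HasDerivAt (fun u : ℂ => (m : ℂ) + u) 1 (u : ℂ) :=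
      (hasDerivAt_id (u : ℂ)).const_add (m : ℂ)
    have h3 : (m : ℂ) + u ∈ slitPlane := by
      left
      simp
      linarith [hu.1]
    exact (h1.cpow_const (c := w) h3).comp_ofReal.hasDerivWithinAt
  have hb : ∀ u ∈ Set.Ico (0 : ℝ) 1, ‖w * ((m : ℂ) + u) ^ (w - 1) * 1‖ ≤
      ‖w‖ * m ^ (w.re - 1) := by
    intro u hu
    have h1 : 0 < m + u := by linarith [hu.1]
    rw [mul_one, norm_mul, ← ofReal_add, norm_cpow_eq_rpow_re_of_pos h1, sub_re, one_re]
    gcongr ‖w‖ * ?_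
    exact Real.rpow_le_rpow_of_nonpos hm (by linarith [hu.1]) (by linarith)
  have := norm_image_sub_le_of_norm_deriv_le_segment' hd hb 1 (by simp)
  rw [norm_sub_rev]
  simpa using this

/-- The integrand attached to the `n`-th term of the Dirichlet series, without its oscillation. -/
noncomputable def dirichletTerm (p : ℝ) (Q : ℂ → ℂ) (n : ℕ) (x : ℂ) : ℂ :=
  (p : ℂ) ^ (-(I * x / 2)) * ((n : ℂ) + 1) ^ (-(1 / 2) + I * x) * Q x

theorem norm_cpow_neg_I_mul_div_two {p : ℝ} (hp : 0 < p) (x : ℂ) :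
    ‖(p : ℂ) ^ (-(I * x / 2))‖ = p ^ (x.im / 2) := by
  rw [norm_cpow_eq_rpow_re_of_pos hp]
  congr 1
  simp
  ring

theorem re_neg_half_add_I_mul (x : ℂ) : (-(1 / 2) + I * x : ℂ).re = -(1 / 2) - x.im := by
  simp
  ring

theorem norm_dirichletTerm {p : ℝ} (hp : 0 < p) (Q : ℂ → ℂ) (n : ℕ) (x : ℂ) :
    ‖dirichletTerm p Q n x‖ =
      p ^ (x.im / 2) * ((n : ℝ) + 1) ^ (-(1 / 2) - x.im) * ‖Q x‖ := by
  rw [dirichletTerm, norm_mul, norm_mul, norm_cpow_neg_I_mul_div_two hp]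
  have h1 : (n : ℂ) + 1 = ((n + 1 : ℝ) : ℂ) := by push_cast; rfl
  rw [h1, norm_cpow_eq_rpow_re_of_pos (by positivity), re_neg_half_add_I_mul]

theorem differentiableOn_dirichletTerm {p : ℝ} (hp : 0 < p) {Q : ℂ → ℂ} {U : Set ℂ}
    (hQ : DifferentiableOn ℂ Q U) (n : ℕ) : DifferentiableOn ℂ (dirichletTerm p Q n) U := by
  have h1 : (p : ℂ) ≠ 0 := by exact_mod_cast hp.ne'
  have h2 : (n : ℂ) + 1 ≠ 0 := by exact_mod_cast n.succ_ne_zero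
  have h3 : Differentiable ℂ fun x : ℂ => (p : ℂ) ^ (-(I * x / 2)) := fun x =>
    DifferentiableAt.const_cpow (by fun_prop) (Or.inl h1)
  have h4 : Differentiable ℂ fun x : ℂ => ((n : ℂ) + 1) ^ (-(1 / 2) + I * x) := fun x =>
    DifferentiableAt.const_cpow (by fun_prop) (Or.inl h2)
  exact (h3.differentiableOn.mul h4.differentiableOn).mul hQ

theorem norm_dirichletTerm_sub_le {p : ℝ} (hp : 0 < p) (Q : ℂ → ℂ) (n : ℕ) {x : ℂ}
    (h0 : 0 ≤ x.im) (h1 : x.im ≤ 1) :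
    ‖dirichletTerm p Q n x - dirichletTerm p Q (n + 1) x‖ ≤
      p ^ (x.im / 2) * ((n : ℝ) + 1) ^ (-(3 / 2) - x.im) * (2 * (1 + |x.re|) * ‖Q x‖) := by
  have h2 : dirichletTerm p Q n x - dirichletTerm p Q (n + 1) x =
      (p : ℂ) ^ (-(I * x / 2)) * ((((n : ℝ) + 1 : ℝ) : ℂ) ^ (-(1 / 2) + I * x) -
        ((((n : ℝ) + 1 : ℝ) : ℂ) + 1) ^ (-(1 / 2) + I * x)) * Q x := by
    rw [dirichletTerm, dirichletTerm]
    push_cast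
    ring
  rw [h2, norm_mul, norm_mul, norm_cpow_neg_I_mul_div_two hp]
  have hn : (0 : ℝ) < (n : ℝ) + 1 := by positivity
  have h3 := norm_cpow_sub_cpow_add_one_le hn (w := -(1 / 2) + I * x)
    (by rw [re_neg_half_add_I_mul]; linarith)
  rw [re_neg_half_add_I_mul] at h3
  have h4 : ‖(-(1 / 2) + I * x : ℂ)‖ ≤ 2 * (1 + |x.re|) := by
    refine (norm_add_le _ _).trans ?_
    rw [norm_mul, norm_I, one_mul]
    have := norm_le_abs_re_add_abs_im x
    rw [abs_of_nonneg h0] at this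
    have h5 : ‖(-(1 / 2) : ℂ)‖ = 1 / 2 := by simp
    rw [h5]
    have := abs_nonneg x.re
    linarith
  have h6 : -(1 / 2) - x.im - 1 = -(3 / 2) - x.im := by ring
  rw [h6] at h3
  calc _ ≤ p ^ (x.im / 2) * (2 * (1 + |x.re|) * ((n : ℝ) + 1) ^ (-(3 / 2) - x.im)) * ‖Q x‖ := by
        gcongr
        exact h3.trans (by gcongr)
    _ = _ := by ring

theorem two_mul_one_add_mul_exp_neg_le (y : ℝ) :
    2 * (1 + y) * Real.exp (-y) ≤ 4 * Real.exp (-(1 / 2) * y) := by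
  have h1 := Real.add_one_le_exp (1 / 2 * y)
  have h2 : Real.exp (1 / 2 * y) * Real.exp (-y) = Real.exp (-(1 / 2) * y) := by
    rw [← Real.exp_add]
    congr 1
    ring
  rw [← h2]
  nlinarith [Real.exp_pos (-y)]

/-- Differencing in `n` gains a factor `1/n`, and holomorphy of `Q` allows the estimate on either
edge of the strip: the real line gives `n^(-3/2)`, the line `Im x = 1` gives `p^(1/2) n^(-5/2)`. The
index `n` stands for the integer `n + 1`. The decay constants `C`, `δ` only justify the contour
shift and are absent from the bound; the point `y = 0` is a null set. -/
theorem norm_integral_dirichletTerm_sub_le :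
    ∃ K, 0 < K ∧ ∀ (p : ℝ) (Q : ℂ → ℂ) (A C δ : ℝ), 1 ≤ p → 0 ≤ A → 0 < δ →
      DifferentiableOn ℂ Q {z | 0 ≤ z.im ∧ z.im ≤ 1} →
      (∀ z : ℂ, 0 ≤ z.im → z.im ≤ 1 → 1 ≤ |z.re| → ‖Q z‖ ≤ C * Real.exp (-δ * |z.re|)) →
      (∀ y : ℝ, ‖Q (y + (1 : ℝ) * I)‖ ≤ A * Real.exp (-|y|)) →
      (∀ y : ℝ, y ≠ 0 → ‖Q (y + (0 : ℝ) * I)‖ ≤ A * Real.exp (-|y|)) →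
      ∀ n : ℕ,
      ‖(∫ y : ℝ, dirichletTerm p Q n (y + (1 : ℝ) * I)) -
          ∫ y : ℝ, dirichletTerm p Q (n + 1) (y + (1 : ℝ) * I)‖ ≤
        K * A * min (((n : ℝ) + 1) ^ (-(3 / 2) : ℝ)) (p ^ (1 / 2 : ℝ) * ((n : ℝ) + 1) ^ (-(5 / 2) : ℝ)) := by
  have hexp := integrable_exp_neg_mul_abs (δ := 1 / 2) (by norm_num)
  set K₀ := ∫ y : ℝ, 4 * Real.exp (-(1 / 2) * |y|) with hK₀
  have hK₀0 : 0 ≤ K₀ := integral_nonneg fun y => by positivity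
  refine ⟨K₀ + 1, by positivity, fun p Q A C δ hp hA hδ hQ hdec h1 h0 n => ?_⟩
  have hp0 : 0 < p := by linarith
  have hterm : ∀ n : ℕ, ∀ z : ℂ, 0 ≤ z.im → z.im ≤ 1 → 1 ≤ |z.re| →
      ‖dirichletTerm p Q n z‖ ≤ p ^ (1 / 2 : ℝ) * C * Real.exp (-δ * |z.re|) := by
    intro n z hz0 hz1 hz
    rw [norm_dirichletTerm hp0, mul_assoc (p ^ (1 / 2 : ℝ))]
    have e1 : p ^ (z.im / 2) ≤ p ^ (1 / 2 : ℝ) :=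
      Real.rpow_le_rpow_of_exponent_le hp (by linarith)
    have e2 : ((n : ℝ) + 1) ^ (-(1 / 2) - z.im) ≤ 1 :=
      Real.rpow_le_one_of_one_le_of_nonpos (by have : (0 : ℝ) ≤ n := n.cast_nonneg
                                               linarith) (by linarith)
    calc _ ≤ p ^ (1 / 2 : ℝ) * 1 * ‖Q z‖ := by gcongr
      _ ≤ _ := by
        rw [mul_one]
        gcongr
        exact hdec z hz0 hz1 hz
  have hd := differentiableOn_dirichletTerm hp0 hQ
  have hint1 : ∀ n, Integrable fun y : ℝ => dirichletTerm p Q n (y + (1 : ℝ) * I) := fun n =>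
    integrable_line (hd n) hδ (hterm n) zero_le_one le_rfl
  rw [← integral_sub (hint1 n) (hint1 (n + 1))]
  have hline := integral_line_eq (f := fun z => dirichletTerm p Q n z - dirichletTerm p Q (n + 1) z)
    zero_le_one ((hd n).sub (hd (n + 1))) (C := 2 * (p ^ (1 / 2 : ℝ) * C)) hδ
    fun z hz0 hz1 hz => by
      refine (norm_sub_le _ _).trans ?_
      have := hterm n z hz0 hz1 hz
      have := hterm (n + 1) z hz0 hz1 hz
      linarith
  have hmain : ∀ c : ℝ, 0 ≤ c → c ≤ 1 →
      (∀ y : ℝ, y ≠ 0 → ‖Q (y + c * I)‖ ≤ A * Real.exp (-|y|)) →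
      ‖∫ y : ℝ, (dirichletTerm p Q n (y + c * I) - dirichletTerm p Q (n + 1) (y + c * I))‖ ≤
        p ^ (c / 2) * ((n : ℝ) + 1) ^ (-(3 / 2) - c) * (A * K₀) := by
    intro c hc0 hc1 hQc
    rw [hK₀, ← integral_const_mul, ← integral_const_mul]
    refine norm_integral_le_of_norm_le (((hexp.const_mul 4).const_mul A).const_mul _) ?_
    filter_upwards [compl_mem_ae_iff.2 (measure_singleton (0 : ℝ))] with y hy
    have h2 := norm_dirichletTerm_sub_le hp0 Q n (x := y + c * I) (by simpa using hc0)
      (by simpa using hc1)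
    have h3 : (y + c * I : ℂ).im = c := by simp
    have h4 : (y + c * I : ℂ).re = y := by simp
    rw [h3, h4] at h2
    refine h2.trans (mul_le_mul_of_nonneg_left ?_ (by positivity))
    have h5 := hQc y hy
    have h6 := two_mul_one_add_mul_exp_neg_le |y|
    calc 2 * (1 + |y|) * ‖Q (y + c * I)‖ ≤ 2 * (1 + |y|) * (A * Real.exp (-|y|)) := by gcongr
      _ = A * (2 * (1 + |y|) * Real.exp (-|y|)) := by ring
      _ ≤ _ := by gcongr
  have b1 := hmain 1 zero_le_one le_rfl fun y _ => h1 y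
  have b0 := hmain 0 le_rfl zero_le_one h0
  rw [hline] at b0
  have e1 : (-(3 / 2) - 1 : ℝ) = -(5 / 2) := by norm_num
  rw [e1] at b1
  rw [zero_div, Real.rpow_zero, one_mul, sub_zero] at b0
  rw [mul_min_of_nonneg _ _ (by positivity), le_min_iff]
  constructor
  · refine b0.trans ?_
    have : 0 ≤ ((n : ℝ) + 1) ^ (-(3 / 2) : ℝ) := by positivity
    nlinarith [mul_nonneg this hA]
  · refine b1.trans ?_
    have : 0 ≤ p ^ (1 / 2 : ℝ) * ((n : ℝ) + 1) ^ (-(5 / 2) : ℝ) := by positivity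
    nlinarith [mul_nonneg this hA]

theorem natCast_add_one_cpow_eq_expTurn {v : ℝ} (n : ℕ) :
    ((n : ℂ) + 1) ^ (I * (v ^ 6 : ℝ)) =
      expTurn (v ^ 6 / (2 * Real.pi) * Real.log ((n : ℝ) + 1)) := by
  have h1 : (n : ℂ) + 1 = ((n + 1 : ℝ) : ℂ) := by push_cast; rfl
  have h2 : (0 : ℝ) < n + 1 := by positivity
  have h3 : ((n + 1 : ℝ) : ℂ) ≠ 0 := by exact_mod_cast h2.ne'
  have hpi := Real.pi_ne_zero
  rw [expTurn, h1, cpow_def_of_ne_zero h3, ← ofReal_log h2.le]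
  congr 1
  have h4 : 2 * Real.pi * (v ^ 6 / (2 * Real.pi) * Real.log ((n : ℝ) + 1)) =
      v ^ 6 * Real.log ((n : ℝ) + 1) := by field_simp
  rw [h4]
  push_cast
  ring

/-- Weights in the summation by parts. -/
theorem norm_partial_sum_mul_min_le {v ε p : ℝ} (hv : 1 ≤ v) (hε0 : 0 < ε) (hε : ε ≤ 1 / 4)
    (hp0 : 0 ≤ p) (hp : p ≤ v ^ 6) (n : ℕ) :
    ‖∑ k ∈ Finset.range (n + 1), ((k : ℂ) + 1) ^ (I * (v ^ 6 : ℝ))‖ *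
        min (((n : ℝ) + 1) ^ (-(3 / 2) : ℝ)) (p ^ (1 / 2 : ℝ) * ((n : ℝ) + 1) ^ (-(5 / 2) : ℝ)) ≤
      120 * (v ^ 6) ^ (1 / 6 + ε) * ((n : ℝ) + 1) ^ (-(1 + ε)) := by
  have hv0 : 0 < v := by linarith
  have hm : (0 : ℝ) < (n : ℝ) + 1 := by positivity
  have hm1 : (1 : ℝ) ≤ (n : ℝ) + 1 := by
    have : (0 : ℝ) ≤ n := n.cast_nonneg
    linarith
  have hv6 : (v ^ 6) ^ (1 / 6 + ε) = v * v ^ (6 * ε) := by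
    rw [← Real.rpow_natCast v 6, ← Real.rpow_mul hv0.le]
    nth_rewrite 2 [← Real.rpow_one v]
    rw [← Real.rpow_add hv0]
    congr 1
    push_cast
    ring
  simp_rw [natCast_add_one_cpow_eq_expTurn]
  rw [hv6]
  set m := (n : ℝ) + 1 with hmdef
  set S := ‖∑ k ∈ Finset.range (n + 1), expTurn (v ^ 6 / (2 * Real.pi) * Real.log ((k : ℝ) + 1))‖
    with hS
  -- The cut is at `t^(2/3)`, with `v = t^(1/6)`. Below it the Weyl bound against the first weight
  -- gives `v m^(-1)`. Above it the trivial bound against the second gives `p^(1/2) m^(-3/2) ≤ v³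
  -- m^(-1/2) m^(-1) ≤ v m^(-1)`. The powers with `ε` only make the sum over `m` converge.
  rcases le_or_gt m (v ^ 4) with h | h
  · have h1 := norm_sum_expTurn_log_le hv (n + 1) (by push_cast; exact h)
    push_cast at h1
    rw [← hmdef, ← hS, Real.sqrt_eq_rpow] at h1
    have h2 : m ^ ε ≤ v ^ (6 * ε) := by
      have h3 : m ≤ v ^ 6 := h.trans (pow_le_pow_right₀ hv (by norm_num))
      have h4 : v ^ (6 * ε) = (v ^ 6) ^ ε := by
        rw [← Real.rpow_natCast v 6, ← Real.rpow_mul hv0.le]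
        push_cast
        rfl
      rw [h4]
      exact Real.rpow_le_rpow hm.le h3 hε0.le
    calc S * min (m ^ (-(3 / 2) : ℝ)) (p ^ (1 / 2 : ℝ) * m ^ (-(5 / 2) : ℝ))
        ≤ (120 * v * m ^ (1 / 2 : ℝ)) * m ^ (-(3 / 2) : ℝ) := by
          refine mul_le_mul h1 (min_le_left _ _) (le_min ?_ ?_) ?_ <;> positivity
      _ = 120 * v * (m ^ ε * m ^ (-(1 + ε))) := by
          rw [mul_assoc, ← Real.rpow_add hm, ← Real.rpow_add hm]
          congr 2
          ring
      _ ≤ 120 * v * (v ^ (6 * ε) * m ^ (-(1 + ε))) := by gcongr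
      _ = _ := by ring
  · have h1 : S ≤ m := by
      refine (norm_sum_le _ _).trans ?_
      simp [norm_expTurn, hmdef]
    have h2 : m ^ (-(1 / 2) + ε) ≤ v ^ (4 * (-(1 / 2) + ε)) := by
      have h4 : v ^ (4 * (-(1 / 2) + ε)) = (v ^ 4) ^ (-(1 / 2) + ε) := by
        rw [← Real.rpow_natCast v 4, ← Real.rpow_mul hv0.le]
        push_cast
        rfl
      rw [h4]
      exact Real.rpow_le_rpow_of_nonpos (by positivity) h.le (by linarith)
    have h3 : p ^ (1 / 2 : ℝ) ≤ v ^ (3 : ℝ) := by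
      have h4 : v ^ (3 : ℝ) = (v ^ 6) ^ (1 / 2 : ℝ) := by
        rw [← Real.rpow_natCast v 6, ← Real.rpow_mul hv0.le]
        norm_num
      rw [h4]
      exact Real.rpow_le_rpow hp0 hp (by norm_num)
    calc S * min (m ^ (-(3 / 2) : ℝ)) (p ^ (1 / 2 : ℝ) * m ^ (-(5 / 2) : ℝ))
        ≤ m * (p ^ (1 / 2 : ℝ) * m ^ (-(5 / 2) : ℝ)) := by
          refine mul_le_mul h1 (min_le_right _ _) (le_min ?_ ?_) ?_ <;> positivity
      _ = p ^ (1 / 2 : ℝ) * (m ^ (-(1 / 2) + ε) * m ^ (-(1 + ε))) := by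
          nth_rewrite 1 [← Real.rpow_one m]
          rw [mul_left_comm, ← Real.rpow_add hm, ← Real.rpow_add hm]
          congr 2
          ring
      _ ≤ v ^ (3 : ℝ) * (v ^ (4 * (-(1 / 2) + ε)) * m ^ (-(1 + ε))) := by gcongr
      _ = v ^ (1 + 4 * ε) * m ^ (-(1 + ε)) := by
          rw [← mul_assoc, ← Real.rpow_add hv0]
          congr 2
          ring
      _ ≤ 120 * (v * v ^ (6 * ε)) * m ^ (-(1 + ε)) := by
          gcongr
          have h5 : v * v ^ (6 * ε) = v ^ (1 + 6 * ε) := by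
            rw [Real.rpow_add hv0, Real.rpow_one]
          rw [h5]
          have h6 : v ^ (1 + 4 * ε) ≤ v ^ (1 + 6 * ε) :=
            Real.rpow_le_rpow_of_exponent_le hv (by linarith)
          have h7 : 0 < v ^ (1 + 6 * ε) := by positivity
          linarith

/-- A weighted integral of `ζ` to the right of its critical strip, with a weight that can be moved
to the critical line, obeys the Weyl bound. -/
theorem norm_integral_zeta_mul_le {ε : ℝ} (hε0 : 0 < ε) (hε : ε ≤ 1 / 4) :
    ∃ K, 0 < K ∧ ∀ (t : ℝ) (Q : ℂ → ℂ) (A C δ : ℝ), 2 * Real.pi < t → 0 ≤ A → 0 < δ →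
      DifferentiableOn ℂ Q {z | 0 ≤ z.im ∧ z.im ≤ 1} →
      (∀ z : ℂ, 0 ≤ z.im → z.im ≤ 1 → 1 ≤ |z.re| → ‖Q z‖ ≤ C * Real.exp (-δ * |z.re|)) →
      (∀ y : ℝ, ‖Q (y + (1 : ℝ) * I)‖ ≤ A * Real.exp (-|y|)) →
      (∀ y : ℝ, y ≠ 0 → ‖Q (y + (0 : ℝ) * I)‖ ≤ A * Real.exp (-|y|)) →
      ‖∫ y : ℝ, ((t / (2 * Real.pi) : ℝ) : ℂ) ^ (-(I * (y + (1 : ℝ) * I) / 2)) *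
          riemannZeta (1 / 2 - I * (t + (y + (1 : ℝ) * I))) * Q (y + (1 : ℝ) * I)‖ ≤
        K * A * t ^ (1 / 6 + ε) := by
  obtain ⟨K, hK0, hK⟩ := norm_integral_dirichletTerm_sub_le
  have hsumm : Summable fun n : ℕ => ((n : ℝ) + 1) ^ (-(1 + ε)) := by
    have := (summable_nat_add_iff 1).2 (Real.summable_nat_rpow.2 (show -(1 + ε) < -1 by linarith))
    simpa using this
  set W := ∑' n : ℕ, ((n : ℝ) + 1) ^ (-(1 + ε)) with hW
  have hW0 : 0 ≤ W := tsum_nonneg fun n => by positivity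
  refine ⟨120 * K * (W + 1), by positivity, fun t Q A C δ ht hA hδ hQ hdec h1 h0 => ?_⟩
  have hpi := Real.pi_gt_three
  have ht0 : 0 < t := by linarith
  set p := t / (2 * Real.pi) with hp
  have hp1 : 1 ≤ p := by
    rw [hp, le_div_iff₀ (by positivity)]
    linarith
  have hp0 : 0 < p := by linarith
  obtain ⟨v, hv1, hvt⟩ : ∃ v : ℝ, 1 ≤ v ∧ v ^ 6 = t := by
    refine ⟨t ^ (1 / 6 : ℝ), Real.one_le_rpow (by linarith) (by norm_num), ?_⟩
    rw [← Real.rpow_natCast, ← Real.rpow_mul ht0.le]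
    norm_num
  have hpv : p ≤ v ^ 6 := by
    rw [hvt, hp]
    exact div_le_self ht0.le (by linarith)
  set a : ℕ → ℂ := fun n => ∫ y : ℝ, dirichletTerm p Q n (y + (1 : ℝ) * I) with ha
  set z : ℕ → ℂ := fun n => ((n : ℂ) + 1) ^ (I * (v ^ 6 : ℝ)) with hz
  have hz1 : ∀ n, ‖z n‖ = 1 := fun n => by
    simp only [hz]
    rw [natCast_add_one_cpow_eq_expTurn, norm_expTurn]
  have hexp : Integrable fun y : ℝ => Real.exp (-|y|) := by
    simpa using integrable_exp_neg_mul_abs one_pos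
  have hd := differentiableOn_dirichletTerm hp0 hQ
  have hnorm : ∀ (n : ℕ) (y : ℝ), ‖dirichletTerm p Q n (y + (1 : ℝ) * I)‖ ≤
      p ^ (1 / 2 : ℝ) * ((n : ℝ) + 1) ^ (-(3 / 2) : ℝ) * (A * Real.exp (-|y|)) := fun n y => by
    rw [norm_dirichletTerm hp0]
    have h3 : (y + (1 : ℝ) * I : ℂ).im = 1 := by simp
    have h4 : (-(1 / 2) - 1 : ℝ) = -(3 / 2) := by norm_num
    rw [h3, h4]
    gcongr
    exact h1 y
  have hint : ∀ n, Integrable fun y : ℝ => dirichletTerm p Q n (y + (1 : ℝ) * I) := fun n => by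
    refine ((hexp.const_mul A).const_mul _).mono' ?_ (Eventually.of_forall (hnorm n))
    refine Continuous.aestronglyMeasurable ?_
    rw [← continuousOn_univ]
    refine (hd n).continuousOn.comp (by fun_prop) fun y _ => ?_
    simp
  set E := ∫ y : ℝ, Real.exp (-|y|) with hE
  have hinorm : ∀ n, ∫ y : ℝ, ‖dirichletTerm p Q n (y + (1 : ℝ) * I)‖ ≤
      p ^ (1 / 2 : ℝ) * A * E * ((n : ℝ) + 1) ^ (-(3 / 2) : ℝ) := fun n => by
    refine (integral_mono (hint n).norm ((hexp.const_mul A).const_mul _) (hnorm n)).trans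
      (le_of_eq ?_)
    rw [integral_const_mul, integral_const_mul]
    ring
  have hsumm2 : Summable fun n : ℕ => p ^ (1 / 2 : ℝ) * A * E * ((n : ℝ) + 1) ^ (-(3 / 2) : ℝ) := by
    refine Summable.mul_left _ ?_
    have := (summable_nat_add_iff 1).2
      (Real.summable_nat_rpow.2 (show (-(3 / 2) : ℝ) < -1 by norm_num))
    simpa using this
  -- The argument of `ζ` has real part `3/2` on this line, so the Dirichlet series may be integrated
  -- term by term.
  have hF := hasSum_integral_of_summable_integral_norm
    (F := fun (n : ℕ) (y : ℝ) => z n * dirichletTerm p Q n (y + (1 : ℝ) * I)) (μ := volume)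
    (fun n => (hint n).const_mul (z n)) (by
      refine Summable.of_nonneg_of_le (fun n => integral_nonneg fun y => norm_nonneg _)
        (fun n => ?_) hsumm2
      simp only [norm_mul, hz1, one_mul]
      exact hinorm n)
  have hzeta : ∀ y : ℝ, ∑' n : ℕ, z n * dirichletTerm p Q n (y + (1 : ℝ) * I) =
      (p : ℂ) ^ (-(I * (y + (1 : ℝ) * I) / 2)) *
        riemannZeta (1 / 2 - I * (t + (y + (1 : ℝ) * I))) * Q (y + (1 : ℝ) * I) := by
    intro y
    have hre : (1 / 2 - I * (t + (y + (1 : ℝ) * I)) : ℂ).re = 3 / 2 := by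
      simp
      norm_num
    rw [zeta_eq_tsum_one_div_nat_add_one_cpow (by rw [hre]; norm_num), ← tsum_mul_left,
      ← tsum_mul_right]
    refine tsum_congr fun n => ?_
    have hn : (n : ℂ) + 1 ≠ 0 := by exact_mod_cast n.succ_ne_zero
    have h5 : 1 / ((n : ℂ) + 1) ^ (1 / 2 - I * (t + (y + (1 : ℝ) * I)) : ℂ) =
        z n * ((n : ℂ) + 1) ^ (-(1 / 2) + I * (y + (1 : ℝ) * I) : ℂ) := by
      simp only [hz]
      rw [one_div, ← cpow_neg, ← cpow_add _ _ hn, hvt]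
      congr 1
      ring
    rw [h5, dirichletTerm]
    ring
  simp_rw [hzeta] at hF
  have hlim := hF.tendsto_sum_nat
  simp_rw [integral_const_mul] at hlim
  -- Partial summation. The trivial bound suffices for the boundary term, which decays like `(M +
  -- 1)^(-1/2)` and disappears in the limit.
  have hpart : ∀ M : ℕ, ‖∑ n ∈ Finset.range M, z n * a n‖ ≤
      p ^ (1 / 2 : ℝ) * A * E * ((M : ℝ) + 1) ^ (-(1 / 2) : ℝ) +
        120 * K * (W + 1) * A * t ^ (1 / 6 + ε) := by
    intro M
    have hM : (0 : ℝ) < (M : ℝ) + 1 := by positivity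
    rw [sum_range_mul_by_parts]
    refine (norm_add_le _ _).trans (add_le_add ?_ ?_)
    · rw [norm_mul]
      have e1 : ‖∑ n ∈ Finset.range M, z n‖ ≤ (M : ℝ) + 1 := by
        refine (norm_sum_le _ _).trans ?_
        simp [hz1]
      have e2 : ‖a M‖ ≤ p ^ (1 / 2 : ℝ) * A * E * ((M : ℝ) + 1) ^ (-(3 / 2) : ℝ) :=
        (norm_integral_le_integral_norm _).trans (hinorm M)
      calc _ ≤ ((M : ℝ) + 1) * (p ^ (1 / 2 : ℝ) * A * E * ((M : ℝ) + 1) ^ (-(3 / 2) : ℝ)) := by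
            gcongr
        _ = p ^ (1 / 2 : ℝ) * A * E * (((M : ℝ) + 1) ^ (1 : ℝ) * ((M : ℝ) + 1) ^ (-(3 / 2) : ℝ)) := by
            rw [Real.rpow_one]
            ring
        _ = _ := by
            rw [← Real.rpow_add hM]
            norm_num
    · have hbd : ∀ n ∈ Finset.range M,
          ‖(∑ k ∈ Finset.range (n + 1), z k) * (a n - a (n + 1))‖ ≤
            120 * K * A * t ^ (1 / 6 + ε) * ((n : ℝ) + 1) ^ (-(1 + ε)) := by
        intro n _
        have e1 := hK p Q A C δ hp1 hA hδ hQ hdec h1 h0 n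
        have e2 := norm_partial_sum_mul_min_le hv1 hε0 hε hp0.le hpv n
        rw [norm_mul]
        set μ := min (((n : ℝ) + 1) ^ (-(3 / 2) : ℝ))
          (p ^ (1 / 2 : ℝ) * ((n : ℝ) + 1) ^ (-(5 / 2) : ℝ))
        rw [hvt] at e2
        calc _ ≤ ‖∑ k ∈ Finset.range (n + 1), z k‖ * (K * A * μ) := by gcongr
          _ = K * A * (‖∑ k ∈ Finset.range (n + 1), z k‖ * μ) := by ring
          _ ≤ K * A * (120 * t ^ (1 / 6 + ε) * ((n : ℝ) + 1) ^ (-(1 + ε))) := by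
              refine mul_le_mul_of_nonneg_left ?_ (by positivity)
              simp only [hz, hvt]
              exact e2
          _ = _ := by ring
      refine (norm_sum_le_of_le _ hbd).trans ?_
      rw [← Finset.mul_sum]
      have e3 : ∑ n ∈ Finset.range M, ((n : ℝ) + 1) ^ (-(1 + ε)) ≤ W + 1 :=
        (hsumm.sum_le_tsum _ fun n _ => by positivity).trans (by linarith)
      calc _ ≤ 120 * K * A * t ^ (1 / 6 + ε) * (W + 1) := by gcongr
        _ = _ := by ring
  have hzero : Tendsto (fun M : ℕ => p ^ (1 / 2 : ℝ) * A * E * ((M : ℝ) + 1) ^ (-(1 / 2) : ℝ) +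
        120 * K * (W + 1) * A * t ^ (1 / 6 + ε)) atTop
      (nhds (p ^ (1 / 2 : ℝ) * A * E * 0 + 120 * K * (W + 1) * A * t ^ (1 / 6 + ε))) := by
    refine Tendsto.add_const _ (Tendsto.const_mul _ ?_)
    exact (tendsto_rpow_neg_atTop (by norm_num : (0 : ℝ) < 1 / 2)).comp
      (tendsto_atTop_add_const_right _ 1 tendsto_natCast_atTop_atTop)
  have := le_of_tendsto_of_tendsto' hlim.norm hzero hpart
  simpa using this

/-! ### Stirling's formula for `χ`. -/

theorem log_mul_I_mul_one_add {r : ℝ} (hr : 0 < r) {w : ℂ} (hw : ‖w‖ ≤ 1 / 2) :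
    log (r * (I * (1 + w))) = Real.log r + Real.pi / 2 * I + log (1 + w) ∧
    log (r * (-I * (1 + w))) = Real.log r - Real.pi / 2 * I + log (1 + w) := by
  have hre : 0 < (1 + w).re := by
    have := (abs_le.1 ((abs_re_le_norm w).trans hw)).1
    simp
    linarith
  have hne : 1 + w ≠ 0 := fun h => by
    rw [h] at hre
    simp at hre
  -- As `1 + w` has argument in `(-π/2, π/2)`, adding `±π/2` stays within the principal branch, so
  -- the logarithm is additive.
  have harg := abs_lt.1 (abs_arg_lt_pi_div_two_iff.2 (Or.inl hre))
  have hpi := Real.pi_pos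
  have h1 : log (I * (1 + w)) = log I + log (1 + w) := by
    refine (log_mul_eq_add_log_iff I_ne_zero hne).2 ?_
    rw [arg_I]
    constructor <;> linarith [harg.1, harg.2]
  have h2 : log (-I * (1 + w)) = log (-I) + log (1 + w) := by
    refine (log_mul_eq_add_log_iff (neg_ne_zero.2 I_ne_zero) hne).2 ?_
    rw [arg_neg_I]
    constructor <;> linarith [harg.1, harg.2]
  rw [log_ofReal_mul hr (mul_ne_zero I_ne_zero hne),
    log_ofReal_mul hr (mul_ne_zero (neg_ne_zero.2 I_ne_zero) hne), h1, h2, log_I, log_neg_I]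
  constructor <;> ring

/-- The logarithmic derivative of `χ`. -/
noncomputable def chiLogDeriv (s : ℂ) : ℂ :=
  Real.log Real.pi - digamma ((1 - s) / 2) / 2 - digamma (s / 2 + 1) / 2 + 1 / s

theorem hasDerivAt_inner_Gamma {f : ℂ → ℂ} {f' s : ℂ} (hf : HasDerivAt f f' s)
    (hre : 0 < (f s).re) :
    HasDerivAt (fun s => Gamma (f s)) (digamma (f s) * Gamma (f s) * f') s := by
  have hne : ∀ m : ℕ, f s ≠ -m := fun m h => by
    rw [h] at hre
    have : (0 : ℝ) ≤ m := m.cast_nonneg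
    simp at hre
    linarith
  have h1 := (differentiableAt_Gamma _ hne).hasDerivAt
  refine (h1.comp s hf).congr_deriv ?_
  rw [digamma_def, logDeriv_apply, div_mul_cancel₀ _ (Gamma_ne_zero hne)]

/-- Replacing `Γ(s/2)` by `Γ(s/2 + 1)` keeps both Gamma arguments at real part at least `1/4` for
`-1/2 ≤ Re s ≤ 1/2`, where the digamma estimate is uniform. -/
theorem chi_eq (s : ℂ) (hs : s ≠ 0) :
    chi s = (Real.pi : ℂ) ^ (s - 1 / 2) * Gamma ((1 - s) / 2) * (s / 2) * (Gamma (s / 2 + 1))⁻¹ := by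
  have hpi : (Real.pi : ℂ) ≠ 0 := by exact_mod_cast Real.pi_ne_zero
  have h1 : (Real.pi : ℂ) ^ (s - 1 / 2) =
      (Real.pi : ℂ) ^ (-(1 - s) / 2) * ((Real.pi : ℂ) ^ (-s / 2))⁻¹ := by
    rw [← cpow_neg, ← cpow_add _ _ hpi]
    congr 1
    ring
  have h2 : (s / 2 : ℂ) ≠ 0 := div_ne_zero hs two_ne_zero
  rw [chi, Gammaℝ_def, Gammaℝ_def, h1, Gamma_add_one _ h2, mul_inv, mul_inv]
  field_simp

theorem hasDerivAt_chi {s : ℂ} (hs : s ≠ 0) (h1 : s.re < 1) (h2 : -2 < s.re) :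
    HasDerivAt chi (chi s * chiLogDeriv s) s := by
  have hpi : (Real.pi : ℂ) ≠ 0 := by exact_mod_cast Real.pi_ne_zero
  have d1 : HasDerivAt (fun s : ℂ => (Real.pi : ℂ) ^ (s - 1 / 2))
      ((Real.pi : ℂ) ^ (s - 1 / 2) * log Real.pi * 1) s :=
    ((hasDerivAt_id s).sub_const (1 / 2)).const_cpow (Or.inl hpi)
  have d2 := hasDerivAt_inner_Gamma (f := fun s : ℂ => (1 - s) / 2)
    (((hasDerivAt_id s).const_sub 1).div_const 2) (by simp; linarith)
  have hre2 : 0 < (s / 2 + 1).re := by simp; linarith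
  have d3 := hasDerivAt_inner_Gamma (f := fun s : ℂ => s / 2 + 1)
    (((hasDerivAt_id s).div_const 2).add_const 1) hre2
  have hG : Gamma (s / 2 + 1) ≠ 0 := Gamma_ne_zero_of_re_pos hre2
  have d4 := d3.inv hG
  have d5 : HasDerivAt (fun s : ℂ => s / 2) (1 / 2) s := (hasDerivAt_id s).div_const 2
  have key := ((d1.mul d2).mul d5).mul d4
  have heq : chi =ᶠ[nhds s] fun s => (Real.pi : ℂ) ^ (s - 1 / 2) * Gamma ((1 - s) / 2) * (s / 2) *
      (Gamma (s / 2 + 1))⁻¹ := by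
    filter_upwards [isOpen_ne.mem_nhds hs] with z hz
    exact chi_eq z hz
  refine (key.congr_of_eventuallyEq heq).congr_deriv ?_
  rw [chi_eq s hs, chiLogDeriv, ← ofReal_log Real.pi_pos.le]
  simp only [Pi.mul_apply, Pi.inv_apply]
  field_simp
  ring

/-- Stirling's approximation for the logarithmic derivative of `χ` near height `t`. -/
theorem norm_chiLogDeriv_add_log_le {t : ℝ} (ht : 20 ≤ t) {x : ℂ} (hx : |x.re| ≤ t / 4)
    (h0 : 0 ≤ x.im) (h1 : x.im ≤ 1) :
    ‖chiLogDeriv (1 / 2 + I * (t + x)) + Real.log (t / (2 * Real.pi))‖ ≤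
      100 * (1 + |x.re|) / t := by
  have hpi := Real.pi_pos
  have ht0 : 0 < t := by linarith
  have htc : (t : ℂ) ≠ 0 := by exact_mod_cast ht0.ne'
  set s : ℂ := 1 / 2 + I * (t + x) with hs
  have hsre : s.re = 1 / 2 - x.im := by
    simp [hs]
    ring
  have hsim : s.im = t + x.re := by simp [hs]
  have hxn : ‖x‖ ≤ |x.re| + 1 := by
    refine (norm_le_abs_re_add_abs_im x).trans ?_
    rw [abs_of_nonneg h0]
    linarith
  -- These are chosen so that `(1-s)/2 = -(it/2)(1 + w₁)` and `s/2 + 1 = (it/2)(1 + w₂)`. The terms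
  -- `±πi/2` of the two logarithms cancel, and the main term left is `log π - log (t/2)`.
  obtain ⟨w₁, hw₁⟩ : ∃ w : ℂ, w = (x + I / 2) / t := ⟨_, rfl⟩
  obtain ⟨w₂, hw₂⟩ : ∃ w : ℂ, w = (x - 5 / 2 * I) / t := ⟨_, rfl⟩
  have hI2 := I_sq
  have hz1 : (1 - s) / 2 = (t / 2 : ℝ) * (-I * (1 + w₁)) := by
    rw [hs, hw₁]
    push_cast
    field_simp
    linear_combination hI2
  have hz2 : s / 2 + 1 = (t / 2 : ℝ) * (I * (1 + w₂)) := by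
    rw [hs, hw₂]
    push_cast
    field_simp
    linear_combination 5 * hI2
  have hn1 : ‖w₁‖ ≤ (|x.re| + 4) / t := by
    rw [hw₁, norm_div, norm_real, Real.norm_of_nonneg ht0.le]
    gcongr
    refine (norm_add_le _ _).trans ?_
    have : ‖(I / 2 : ℂ)‖ = 1 / 2 := by simp
    rw [this]
    linarith
  have hn2 : ‖w₂‖ ≤ (|x.re| + 4) / t := by
    rw [hw₂, norm_div, norm_real, Real.norm_of_nonneg ht0.le]
    gcongr
    refine (norm_sub_le _ _).trans ?_
    have : ‖(5 / 2 * I : ℂ)‖ = 5 / 2 := by simp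
    rw [this]
    linarith
  have hhalf : (|x.re| + 4) / t ≤ 1 / 2 := by
    rw [div_le_iff₀ ht0]
    linarith
  have ht2 : 0 < t / 2 := by positivity
  have hl1 := (log_mul_I_mul_one_add ht2 (hn1.trans hhalf)).2
  have hl2 := (log_mul_I_mul_one_add ht2 (hn2.trans hhalf)).1
  rw [← hz1] at hl1
  rw [← hz2] at hl2
  have hre1 : (1 / 4 : ℝ) ≤ ((1 - s) / 2).re := by simp [hsre]; linarith
  have hre2 : (1 / 4 : ℝ) ≤ (s / 2 + 1).re := by simp [hsre]; linarith
  have hD1 := norm_digamma_sub_log_le (by norm_num : (0 : ℝ) < 1 / 4) hre1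
  have hD2 := norm_digamma_sub_log_le (by norm_num : (0 : ℝ) < 1 / 4) hre2
  have hxr := abs_le.1 hx
  have hlow1 : t / 4 ≤ ‖(1 - s) / 2‖ := by
    refine le_trans ?_ (abs_im_le_norm _)
    have : ((1 - s) / 2).im = -(t + x.re) / 2 := by simp [hsim]
    rw [this, abs_of_nonpos (by linarith)]
    linarith
  have hlow2 : t / 4 ≤ ‖s / 2 + 1‖ := by
    refine le_trans ?_ (abs_im_le_norm _)
    have : (s / 2 + 1).im = (t + x.re) / 2 := by simp [hsim]
    rw [this, abs_of_nonneg (by linarith)]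
    linarith
  have hlow3 : t / 2 ≤ ‖s‖ := by
    refine le_trans ?_ (abs_im_le_norm _)
    rw [hsim, abs_of_nonneg (by linarith)]
    linarith
  have hD1' : ‖digamma ((1 - s) / 2) - log ((1 - s) / 2)‖ ≤ 40 / t := by
    refine hD1.trans ?_
    calc 2 * (1 + 1 / (1 / 4)) / ‖(1 - s) / 2‖ ≤ 2 * (1 + 1 / (1 / 4)) / (t / 4) := by gcongr
      _ = 40 / t := by field_simp; norm_num
  have hD2' : ‖digamma (s / 2 + 1) - log (s / 2 + 1)‖ ≤ 40 / t := by
    refine hD2.trans ?_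
    calc 2 * (1 + 1 / (1 / 4)) / ‖s / 2 + 1‖ ≤ 2 * (1 + 1 / (1 / 4)) / (t / 4) := by gcongr
      _ = 40 / t := by field_simp; norm_num
  have hL1 := norm_log_one_add_half_le_self (hn1.trans hhalf)
  have hL2 := norm_log_one_add_half_le_self (hn2.trans hhalf)
  have hinv : ‖1 / s‖ ≤ 2 / t := by
    rw [norm_div, norm_one]
    calc 1 / ‖s‖ ≤ 1 / (t / 2) := by gcongr
      _ = 2 / t := by field_simp
  have hlogs : Real.log Real.pi + Real.log (t / (2 * Real.pi)) = Real.log (t / 2) := by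
    rw [← Real.log_mul hpi.ne' (by positivity)]
    congr 1
    field_simp
  have hlogsc : (Real.log Real.pi : ℂ) + Real.log (t / (2 * Real.pi)) = Real.log (t / 2) := by
    exact_mod_cast hlogs
  have hform : chiLogDeriv s + Real.log (t / (2 * Real.pi)) =
      1 / s + (-(1 / 2) * (digamma ((1 - s) / 2) - log ((1 - s) / 2)) +
      (-(1 / 2) * (digamma (s / 2 + 1) - log (s / 2 + 1)) +
      (-(1 / 2) * log (1 + w₁) + -(1 / 2) * log (1 + w₂)))) := by
    rw [chiLogDeriv, hl1, hl2]
    linear_combination hlogsc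
  have hhn : ‖(-(1 / 2) : ℂ)‖ = 1 / 2 := by simp
  rw [hform]
  have b1 := norm_add_le (1 / s) (-(1 / 2) * (digamma ((1 - s) / 2) - log ((1 - s) / 2)) +
      (-(1 / 2) * (digamma (s / 2 + 1) - log (s / 2 + 1)) +
      (-(1 / 2) * log (1 + w₁) + -(1 / 2) * log (1 + w₂))))
  have b2 := norm_add_le (-(1 / 2) * (digamma ((1 - s) / 2) - log ((1 - s) / 2)))
      (-(1 / 2) * (digamma (s / 2 + 1) - log (s / 2 + 1)) +
      (-(1 / 2) * log (1 + w₁) + -(1 / 2) * log (1 + w₂)))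
  have b3 := norm_add_le (-(1 / 2) * (digamma (s / 2 + 1) - log (s / 2 + 1)))
      (-(1 / 2) * log (1 + w₁) + -(1 / 2) * log (1 + w₂))
  have b4 := norm_add_le (-(1 / 2) * log (1 + w₁)) (-(1 / 2) * log (1 + w₂))
  simp only [norm_mul (-(1 / 2) : ℂ), hhn] at b1 b2 b3 b4
  have hfin : 2 / t + (40 / t + (40 / t + (3 / 2 * ((|x.re| + 4) / t)))) ≤
      100 * (1 + |x.re|) / t := by
    have : 2 / t + (40 / t + (40 / t + (3 / 2 * ((|x.re| + 4) / t)))) =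
        (88 + 3 / 2 * |x.re|) / t := by
      field_simp
      ring
    rw [this]
    gcongr
    have := abs_nonneg x.re
    linarith
  have p1 : 0 ≤ 40 / t := by positivity
  linarith

/-- `χ(1/2 + i(t + x)) / χ(1/2 + it) · (t / 2π) ^ (ix)`, which is close to `1` for small `x`. -/
noncomputable def chiRatio (t : ℝ) (x : ℂ) : ℂ :=
  chi (1 / 2 + I * (t + x)) / chi (1 / 2 + I * t) * ((t / (2 * Real.pi) : ℝ) : ℂ) ^ (I * x)

theorem norm_chi_half (t : ℝ) : ‖chi (1 / 2 + I * t)‖ = 1 := norm_chi_of_re_eq_half (by simp)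

theorem chi_half_ne_zero (t : ℝ) : chi (1 / 2 + I * t) ≠ 0 :=
  norm_ne_zero_iff.1 (by rw [norm_chi_half]; exact one_ne_zero)

theorem chiRatio_zero {t : ℝ} : chiRatio t 0 = 1 := by
  rw [chiRatio, add_zero, div_self (chi_half_ne_zero t)]
  simp

theorem norm_chiRatio {t : ℝ} (ht : 0 < t) (x : ℂ) :
    ‖chiRatio t x‖ = ‖chi (1 / 2 + I * (t + x))‖ * (t / (2 * Real.pi)) ^ (-x.im) := by
  have hpi := Real.pi_pos
  rw [chiRatio, norm_mul, norm_div, norm_chi_half, div_one,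
    norm_cpow_eq_rpow_re_of_pos (by positivity)]
  simp

theorem differentiableAt_chiRatio {t : ℝ} (ht : 0 < t) {x : ℂ} (hx : -(1 / 2) < x.im) :
    DifferentiableAt ℂ (chiRatio t) x := by
  have hpi := Real.pi_pos
  have hp : ((t / (2 * Real.pi) : ℝ) : ℂ) ≠ 0 := by
    exact_mod_cast (by positivity : 0 < t / (2 * Real.pi)).ne'
  have h1 : DifferentiableAt ℂ (fun x : ℂ => chi (1 / 2 + I * (t + x))) x :=
    DifferentiableAt.comp x (differentiableAt_chi (by simp; linarith))
      (by fun_prop : DifferentiableAt ℂ (fun x : ℂ => 1 / 2 + I * (t + x)) x)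
  exact (h1.div_const _).mul (DifferentiableAt.const_cpow (by fun_prop) (Or.inl hp))

theorem hasDerivAt_chiRatio {t : ℝ} (ht : 20 ≤ t) {x : ℂ} (hx : |x.re| ≤ t / 4)
    (h0 : 0 ≤ x.im) (h1 : x.im ≤ 1) :
    HasDerivAt (chiRatio t) (chiRatio t x *
      (I * (chiLogDeriv (1 / 2 + I * (t + x)) + Real.log (t / (2 * Real.pi))))) x := by
  have hpi := Real.pi_pos
  have hp0 : 0 < t / (2 * Real.pi) := by positivity
  have hp : ((t / (2 * Real.pi) : ℝ) : ℂ) ≠ 0 := by exact_mod_cast hp0.ne'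
  have hxr := abs_le.1 hx
  have hs : (1 / 2 + I * (t + x) : ℂ) ≠ 0 := fun h => by
    have := congrArg im h
    simp at this
    linarith
  have d0 : HasDerivAt (fun x : ℂ => 1 / 2 + I * (t + x)) (I * 1) x :=
    (((hasDerivAt_id x).const_add (t : ℂ)).const_mul I).const_add _
  have d1 := (hasDerivAt_chi hs (by simp; linarith) (by simp; linarith)).comp x d0
  have d2 : HasDerivAt (fun x : ℂ => I * x) (I * 1) x := (hasDerivAt_id x).const_mul I
  have d3 := d2.const_cpow (c := ((t / (2 * Real.pi) : ℝ) : ℂ)) (Or.inl hp)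
  have d4 := (d1.div_const (chi (1 / 2 + I * t))).mul d3
  refine d4.congr_deriv ?_
  rw [chiRatio, ← ofReal_log hp0.le]
  simp only [Function.comp]
  ring

/-- For `|y| ≤ t/4` the logarithmic derivative is `O((1 + |y|)/t)`; it is integrated from `0` to
`y`, where `chiRatio` has modulus `1`, and then vertically to `y + i`. For `|y| > t/4` the exact
moduli of `χ` suffice, because `1 ≤ 4|y|/t`. -/
theorem norm_chiRatio_sub_one_le : ∃ B, 1 ≤ B ∧ ∀ t : ℝ, 20 ≤ t → ∀ y : ℝ,
    ‖chiRatio t (y + (0 : ℝ) * I) - 1‖ ≤ B * |y| * (1 + |y|) / t ∧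
    ‖chiRatio t (y + (1 : ℝ) * I) - 1‖ ≤ B * (1 + |y|) ^ 2 / t := by
  refine ⟨100 * Real.exp 100, ?_, fun t ht y => ?_⟩
  · have := Real.one_le_exp (show (0 : ℝ) ≤ 100 by norm_num)
    linarith
  have hM : 1 ≤ Real.exp 100 := Real.one_le_exp (by norm_num)
  have ht0 : 0 < t := by linarith
  have hpi := Real.pi_pos
  have hy := abs_nonneg y
  have hreal : ∀ u : ℝ, ‖chiRatio t u‖ = 1 := fun u => by
    rw [norm_chiRatio ht0, norm_chi_of_re_eq_half (by simp)]
    simp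
  rcases le_or_gt |y| (t / 4) with h | h
  · set k := 100 * (1 + |y|) / t with hk
    have hk0 : 0 ≤ k := by positivity
    have b0 : ‖chiRatio t y - 1‖ ≤ |y| * k := by
      have hd : ∀ u ∈ Set.Icc (0 : ℝ) 1, HasDerivWithinAt
          (fun u : ℝ => chiRatio t ((u : ℂ) * y))
          (chiRatio t ((u : ℂ) * y) * (I * (chiLogDeriv (1 / 2 + I * (t + (u : ℂ) * y)) +
            Real.log (t / (2 * Real.pi)))) * (1 * y)) (Set.Icc (0 : ℝ) 1) u := by
        intro u hu
        have h2 : |((u : ℂ) * y).re| ≤ |y| := by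
          rw [← ofReal_mul, ofReal_re, abs_mul, abs_of_nonneg hu.1]
          exact mul_le_of_le_one_left hy hu.2
        have h3 := hasDerivAt_chiRatio ht (x := (u : ℂ) * y) (h2.trans h) (by simp) (by simp)
        have h4 : HasDerivAt (fun u : ℂ => u * y) (1 * y) (u : ℂ) :=
          (hasDerivAt_id (u : ℂ)).mul_const (y : ℂ)
        exact (HasDerivAt.comp (u : ℂ) h3 h4).comp_ofReal.hasDerivWithinAt
      have hb : ∀ u ∈ Set.Ico (0 : ℝ) 1, ‖chiRatio t ((u : ℂ) * y) *
          (I * (chiLogDeriv (1 / 2 + I * (t + (u : ℂ) * y)) +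
            Real.log (t / (2 * Real.pi)))) * (1 * y)‖ ≤ |y| * k := by
        intro u hu
        have h2 : |((u : ℂ) * y).re| ≤ |y| := by
          rw [← ofReal_mul, ofReal_re, abs_mul, abs_of_nonneg hu.1]
          exact mul_le_of_le_one_left hy hu.2.le
        have h3 := norm_chiLogDeriv_add_log_le ht (x := (u : ℂ) * y) (h2.trans h) (by simp)
          (by simp)
        have h4 : ‖chiRatio t ((u : ℂ) * y)‖ = 1 := by rw [← ofReal_mul]; exact hreal _
        rw [norm_mul, norm_mul, norm_mul, h4, norm_I, one_mul, one_mul, one_mul, norm_real,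
          Real.norm_eq_abs, mul_comm]
        gcongr
        refine h3.trans ?_
        rw [hk]
        gcongr
      have := norm_image_sub_le_of_norm_deriv_le_segment' hd hb 1 (by simp)
      simpa [chiRatio_zero] using this
    have hd : ∀ u ∈ Set.Icc (0 : ℝ) 1, HasDerivAt
          (fun u : ℝ => chiRatio t (y + (u : ℂ) * I))
          (chiRatio t (y + (u : ℂ) * I) *
            (I * (chiLogDeriv (1 / 2 + I * (t + (y + (u : ℂ) * I))) +
            Real.log (t / (2 * Real.pi)))) * (1 * I)) u := by
      intro u hu
      have h3 := hasDerivAt_chiRatio ht (x := y + (u : ℂ) * I) (by simpa using h)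
        (by simpa using hu.1) (by simpa using hu.2)
      have h4 : HasDerivAt (fun u : ℂ => y + u * I) (1 * I) (u : ℂ) :=
        ((hasDerivAt_id (u : ℂ)).mul_const I).const_add (y : ℂ)
      exact (HasDerivAt.comp (u : ℂ) h3 h4).comp_ofReal
    have hb : ∀ u ∈ Set.Ico (0 : ℝ) 1, ‖chiRatio t (y + (u : ℂ) * I) *
          (I * (chiLogDeriv (1 / 2 + I * (t + (y + (u : ℂ) * I))) +
            Real.log (t / (2 * Real.pi)))) * (1 * I)‖ ≤
          k * ‖chiRatio t (y + (u : ℂ) * I)‖ + 0 := by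
      intro u hu
      have h3 := norm_chiLogDeriv_add_log_le ht (x := y + (u : ℂ) * I) (by simpa using h)
        (by simpa using hu.1) (by simpa using hu.2.le)
      have h4 : (y + (u : ℂ) * I).re = y := by simp
      rw [h4] at h3
      rw [norm_mul, norm_mul, norm_mul, norm_mul, norm_I, norm_one, one_mul, one_mul, mul_one,
        add_zero, mul_comm]
      gcongr
    have hcont : ContinuousOn (fun u : ℝ => chiRatio t (y + (u : ℂ) * I)) (Set.Icc 0 1) :=
      fun u hu => (hd u hu).continuousAt.continuousWithinAt
    -- The modulus is not known in advance on the vertical segment; Grönwall from the value `1` at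
    -- its foot bounds it by `e^k`, and `k ≤ 100`.
    have hgron := norm_le_gronwallBound_of_norm_deriv_right_le (δ := 1) (K := k) (ε := 0) hcont
      (fun u hu => (hd u ⟨hu.1, hu.2.le⟩).hasDerivWithinAt) (by simpa using (hreal y).le) hb
    have hk100 : k ≤ 100 := by
      rw [hk, div_le_iff₀ ht0]
      linarith
    have hbd : ∀ u ∈ Set.Icc (0 : ℝ) 1, ‖chiRatio t (y + (u : ℂ) * I)‖ ≤ Real.exp 100 := by
      intro u hu
      refine (hgron u hu).trans ?_
      rw [gronwallBound_ε0, one_mul]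
      apply Real.exp_le_exp.2
      rw [sub_zero]
      nlinarith [hu.1, hu.2]
    have b1 : ‖chiRatio t (y + (1 : ℝ) * I) - chiRatio t (y + (0 : ℝ) * I)‖ ≤
        k * Real.exp 100 * (1 - 0) :=
      norm_image_sub_le_of_norm_deriv_le_segment' (fun u hu => (hd u hu).hasDerivWithinAt)
        (fun u hu => (hb u hu).trans (by
          rw [add_zero]
          exact mul_le_mul_of_nonneg_left (hbd u ⟨hu.1, hu.2.le⟩) hk0)) 1 (by simp)
    have e0 : (y + (0 : ℝ) * I : ℂ) = y := by simp
    rw [e0] at b1 ⊢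
    constructor
    · refine b0.trans ?_
      rw [hk, mul_div_assoc', div_le_div_iff_of_pos_right ht0]
      nlinarith [mul_nonneg hy (by linarith : 0 ≤ 1 + |y|)]
    · have e1 : ‖chiRatio t (y + (1 : ℝ) * I) - 1‖ ≤ k * Real.exp 100 + |y| * k := by
        have := norm_add_le (chiRatio t (y + (1 : ℝ) * I) - chiRatio t y) (chiRatio t y - 1)
        rw [sub_add_sub_cancel] at this
        linarith
      refine e1.trans ?_
      have e2 : k * Real.exp 100 + |y| * k ≤ k * Real.exp 100 * (1 + |y|) := by
        nlinarith [mul_nonneg hk0 hy]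
      refine e2.trans (le_of_eq ?_)
      rw [hk]
      ring
  · have hyt : 1 ≤ 4 * |y| / t := by
      rw [le_div_iff₀ ht0]
      linarith
    have e0 : (y + (0 : ℝ) * I : ℂ) = y := by simp
    constructor
    · rw [e0]
      calc ‖chiRatio t y - 1‖ ≤ 2 := by
            refine (norm_sub_le _ _).trans ?_
            rw [hreal, norm_one]
            norm_num
        _ ≤ 2 * (4 * |y| / t) := by linarith
        _ = 8 * |y| / t := by ring
        _ ≤ 100 * Real.exp 100 * |y| * (1 + |y|) / t := by
            rw [div_le_div_iff_of_pos_right ht0]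
            have e1 : 1 ≤ Real.exp 100 := Real.one_le_exp (by norm_num)
            have e2 : |y| * 1 ≤ |y| * (1 + |y|) := mul_le_mul_of_nonneg_left (by linarith) hy
            nlinarith [mul_le_mul e1 e2 (by positivity) (by positivity)]
    · have h3 : ‖chiRatio t (y + (1 : ℝ) * I)‖ ≤ 2 + |y| := by
        have hs : (1 / 2 + I * (t + (y + (1 : ℝ) * I)) : ℂ) = -(1 / 2) + I * (t + y) := by
          push_cast
          linear_combination I_sq
        have him : (y + (1 : ℝ) * I : ℂ).im = 1 := by simp
        rw [norm_chiRatio ht0, him, hs, norm_chi_of_re_eq_neg_half (by simp), Real.rpow_neg_one]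
        have h4 : ‖(-(1 / 2) + I * (t + y) : ℂ)‖ ≤ 1 / 2 + (t + |y|) := by
          refine (norm_add_le _ _).trans ?_
          rw [norm_mul, norm_I, one_mul]
          have h5 := norm_add_le (t : ℂ) y
          rw [norm_real, norm_real, Real.norm_of_nonneg ht0.le, Real.norm_eq_abs] at h5
          have h6 : ‖(-(1 / 2) : ℂ)‖ = 1 / 2 := by simp
          rw [h6]
          linarith
        have h5 : ‖(-(1 / 2) + I * (t + y) : ℂ)‖ / (2 * Real.pi) * (t / (2 * Real.pi))⁻¹ =
            ‖(-(1 / 2) + I * (t + y) : ℂ)‖ / t := by field_simp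
        rw [h5, div_le_iff₀ ht0]
        nlinarith
      calc ‖chiRatio t (y + (1 : ℝ) * I) - 1‖ ≤ 3 * (1 + |y|) := by
            refine (norm_sub_le _ _).trans ?_
            rw [norm_one]
            linarith
        _ ≤ 3 * (1 + |y|) * (4 * |y| / t) := le_mul_of_one_le_right (by positivity) hyt
        _ = 12 * ((1 + |y|) * |y|) / t := by ring
        _ ≤ 100 * Real.exp 100 * (1 + |y|) ^ 2 / t := by
            have e1 : 1 ≤ Real.exp 100 := Real.one_le_exp (by norm_num)
            gcongr
            · linarith
            · nlinarith

/-! ### The two error integrals. -/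

theorem one_add_pow_three_mul_exp_le {u : ℝ} (hu : 0 ≤ u) :
    (1 + u) ^ 3 * Real.exp (-(Real.pi / 2) * u) ≤ 216 * Real.exp (-u) := by
  have h1 : 1 + u ≤ 6 * Real.exp (u / 6) := by
    have := Real.add_one_le_exp (u / 6)
    linarith
  calc (1 + u) ^ 3 * Real.exp (-(Real.pi / 2) * u)
      ≤ (6 * Real.exp (u / 6)) ^ 3 * Real.exp (-(3 / 2) * u) := by
        gcongr
        nlinarith [Real.pi_gt_three]
    _ = 216 * (Real.exp (u / 6) * Real.exp (u / 6) * Real.exp (u / 6) *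
          Real.exp (-(3 / 2) * u)) := by ring
    _ = _ := by
      rw [← Real.exp_add, ← Real.exp_add, ← Real.exp_add]
      congr 2
      ring

/-- The estimate of `norm_integral_zeta_mul_le` for weights `(g(x) - g(0)) π / (2 sinh (π x / 2))`. -/
theorem norm_integral_zeta_mul_cschMul_le {ε : ℝ} (hε0 : 0 < ε) (hε : ε ≤ 1 / 4) :
    ∃ K, 0 < K ∧ ∀ (t : ℝ) (g : ℂ → ℂ) (D C a : ℝ), 2 * Real.pi < t → 0 ≤ D → 0 ≤ a →
      a < Real.pi / 2 → DifferentiableOn ℂ g {z | -(1 / 2) < z.im ∧ z.im < 2} →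
      (∀ z : ℂ, 0 ≤ z.im → z.im ≤ 1 → ‖g z‖ ≤ C * Real.exp (a * |z.re|)) →
      (∀ y : ℝ, ‖g (y + (0 : ℝ) * I) - g 0‖ ≤ D * |y| * (1 + |y|) ^ 2) →
      (∀ y : ℝ, ‖g (y + (1 : ℝ) * I) - g 0‖ ≤ D * (1 + |y|) ^ 3) →
      ‖∫ y : ℝ, ((t / (2 * Real.pi) : ℝ) : ℂ) ^ (-(I * (y + (1 : ℝ) * I) / 2)) *
        riemannZeta (1 / 2 - I * (t + (y + (1 : ℝ) * I))) * cschMul g (y + (1 : ℝ) * I)‖ ≤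
        K * D * t ^ (1 / 6 + ε) := by
  obtain ⟨K, hK, hmain⟩ := norm_integral_zeta_mul_le hε0 hε
  refine ⟨K * 1728, by positivity, fun t g D C a ht hD ha0 ha hg hb h0 h1 => ?_⟩
  have hU : IsOpen {z : ℂ | -(1 / 2) < z.im ∧ z.im < 2} :=
    (isOpen_lt continuous_const continuous_im).inter (isOpen_lt continuous_im continuous_const)
  have hd := differentiableOn_cschMul hU (by simp) (fun x hx => abs_lt.2 ⟨by linarith [hx.1], hx.2⟩) hg
  have hb0 : ‖g 0‖ ≤ C := by simpa using hb 0 (by simp) (by simp)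
  have hC : 0 ≤ C := (norm_nonneg _).trans hb0
  have := hmain t (cschMul g) (1728 * D) (2 * C * (2 * Real.pi)) (Real.pi / 2 - a) ht
    (by positivity) (by linarith)
    (hd.mono fun z hz => ⟨by linarith [hz.1], by linarith [hz.2]⟩)
    (fun z hz0 hz1 hz => norm_cschMul_le ha0 hC (hb z hz0 hz1) hb0 hz)
    (fun y => ?_) (fun y hy => ?_)
  · refine this.trans (le_of_eq ?_)
    ring
  · have hne : (y + (1 : ℝ) * I : ℂ) ≠ 0 := fun h => by simpa using congrArg im h
    have hk := norm_cschKernel_le_of_abs_im_eq_one (x := y + (1 : ℝ) * I) (by simp)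
    have hre : (y + (1 : ℝ) * I : ℂ).re = y := by simp
    rw [hre] at hk
    rw [cschMul_of_ne hne, norm_mul]
    calc _ ≤ D * (1 + |y|) ^ 3 * (Real.pi * Real.exp (-(Real.pi / 2) * |y|)) :=
          mul_le_mul (h1 y) hk (norm_nonneg _) (by positivity)
      _ = D * Real.pi * ((1 + |y|) ^ 3 * Real.exp (-(Real.pi / 2) * |y|)) := by ring
      _ ≤ D * 8 * (216 * Real.exp (-|y|)) := by
          refine mul_le_mul ?_ (one_add_pow_three_mul_exp_le (abs_nonneg y)) (by positivity)
            (by positivity)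
          gcongr
          linarith [Real.pi_lt_four]
      _ = _ := by ring
  · have e0 : (y + (0 : ℝ) * I : ℂ) = y := by simp
    have h0' := h0 y
    rw [e0] at h0' ⊢
    have hk := norm_mul_cschKernel_ofReal_le y
    rw [norm_mul, norm_real, Real.norm_eq_abs] at hk
    rw [cschMul_of_ne (by exact_mod_cast hy), norm_mul]
    calc _ ≤ D * |y| * (1 + |y|) ^ 2 * ‖cschKernel y‖ := by gcongr
      _ = D * (1 + |y|) ^ 2 * (|y| * ‖cschKernel y‖) := by ring
      _ ≤ D * (1 + |y|) ^ 2 * (8 * (1 + |y|) * Real.exp (-(Real.pi / 2) * |y|)) := by gcongr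
      _ = D * 8 * ((1 + |y|) ^ 3 * Real.exp (-(Real.pi / 2) * |y|)) := by ring
      _ ≤ D * 8 * (216 * Real.exp (-|y|)) :=
          mul_le_mul_of_nonneg_left (one_add_pow_three_mul_exp_le (abs_nonneg y)) (by positivity)
      _ = _ := by ring

theorem norm_div_add_I_div_two_le {t : ℝ} (ht : 0 < t) (x : ℂ) : ‖x / (t + I / 2)‖ ≤ ‖x‖ / t := by
  rw [norm_div]
  have h : t ≤ ‖(t + I / 2 : ℂ)‖ := by
    have := re_le_norm (t + I / 2 : ℂ)
    simpa using this
  gcongr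

theorem norm_add_I_le (y : ℝ) : ‖(y + (1 : ℝ) * I : ℂ)‖ ≤ 1 + |y| := by
  refine (norm_add_le _ _).trans ?_
  simp [add_comm]

theorem norm_div_sub_I_div_two_le {t : ℝ} (ht : 0 < t) (x : ℂ) : ‖x / (t - I / 2)‖ ≤ ‖x‖ / t := by
  rw [norm_div]
  have h : t ≤ ‖(t - I / 2 : ℂ)‖ := by
    have := re_le_norm (t - I / 2 : ℂ)
    simpa using this
  gcongr

/-- This is the error caused on the lower line by the factor `1 + x/(t + i/2)`, moved to the upper
line by conjugation; hence `t - i/2`. -/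
theorem norm_integral_zeta_mul_cschMul_div_le {ε : ℝ} (hε0 : 0 < ε) (hε : ε ≤ 1 / 4) :
    ∃ K, 0 < K ∧ ∀ t : ℝ, 20 ≤ t →
      ‖∫ y : ℝ, ((t / (2 * Real.pi) : ℝ) : ℂ) ^ (-(I * (y + (1 : ℝ) * I) / 2)) *
        riemannZeta (1 / 2 - I * (t + (y + (1 : ℝ) * I))) *
          cschMul (fun x => x / (t - I / 2)) (y + (1 : ℝ) * I)‖ ≤
        K * t ^ (-(5 / 6 : ℝ) + ε) := by
  obtain ⟨K, hK, hmain⟩ := norm_integral_zeta_mul_cschMul_le hε0 hε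
  refine ⟨K, hK, fun t ht => ?_⟩
  have ht0 : 0 < t := by linarith
  have hx (x : ℂ) := norm_div_sub_I_div_two_le ht0 x
  refine (hmain t (fun x => x / (t - I / 2)) (1 / t) 1 1
    (by linarith [Real.pi_lt_four]) (by positivity) zero_le_one (by linarith [Real.pi_gt_three])
    (by fun_prop) (fun z h0 h1 => ?_) (fun y => ?_) (fun y => ?_)).trans (le_of_eq ?_)
  · refine (hx z).trans ?_
    have h2 := norm_le_abs_re_add_abs_im z
    rw [abs_of_nonneg h0] at h2
    have h3 := Real.add_one_le_exp |z.re|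
    have h4 : ‖z‖ / t ≤ ‖z‖ := div_le_self (norm_nonneg _) (by linarith)
    rw [one_mul, one_mul]
    linarith
  · have e0 : (y + (0 : ℝ) * I : ℂ) = y := by simp
    simp only [e0, zero_div, sub_zero]
    refine (hx _).trans ?_
    rw [norm_real, Real.norm_eq_abs, div_eq_mul_one_div, mul_comm]
    apply le_mul_of_one_le_right (by positivity)
    exact one_le_pow₀ (by simp)
  · simp only [zero_div, sub_zero]
    refine (hx _).trans ?_
    rw [div_eq_mul_one_div, mul_comm]
    gcongr
    exact (norm_add_I_le y).trans (le_self_pow₀ (by simp) (by norm_num))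
  · have : t ^ (-(5 / 6 : ℝ) + ε) = t⁻¹ * t ^ (1 / 6 + ε) := by
      rw [← Real.rpow_neg_one, ← Real.rpow_add ht0]
      congr 1
      ring
    rw [this]
    ring

/-- The exponential loss in `t` is harmless: this bound only licenses contour shifts and does not
reach the final estimate. -/
theorem norm_chiRatio_le : ∃ C, 0 < C ∧ ∀ t : ℝ, 2 * Real.pi < t → ∀ z : ℂ, 0 ≤ z.im → z.im ≤ 1 →
    ‖chiRatio t z‖ ≤ C * Real.exp (3 * Real.pi / 8 * t) *
      Real.exp (3 * Real.pi / 8 * |z.re|) := by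
  obtain ⟨C, hC, hchi⟩ := norm_chi_le
  refine ⟨C, hC, fun t ht z h0 h1 => ?_⟩
  have hpi := Real.pi_pos
  have ht0 : 0 < t := by linarith
  have hsre : (1 / 2 + I * (t + z) : ℂ).re = 1 / 2 - z.im := by
    simp
    ring
  have hsim : (1 / 2 + I * (t + z) : ℂ).im = t + z.re := by simp
  have h2 := hchi (1 / 2 + I * (t + z)) (by rw [hsre]; linarith) (by rw [hsre]; linarith)
  have h3 : |t + z.re| ≤ t + |z.re| := by
    simpa [abs_of_pos ht0] using abs_add_le t z.re
  rw [norm_chiRatio ht0]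
  have h4 : (t / (2 * Real.pi)) ^ (-z.im) ≤ 1 :=
    Real.rpow_le_one_of_one_le_of_nonpos ((one_le_div (by positivity)).2 ht.le) (by linarith)
  rw [hsim] at h2
  calc _ ≤ (C * Real.exp (3 * Real.pi / 8 * |t + z.re|)) * 1 :=
        mul_le_mul h2 h4 (by positivity) (by positivity)
    _ ≤ C * Real.exp (3 * Real.pi / 8 * t + 3 * Real.pi / 8 * |z.re|) := by
        rw [mul_one, ← mul_add]
        gcongr
    _ = _ := by rw [Real.exp_add, mul_assoc]

/-- This is the error on the upper line, where Stirling's formula and the factor `1 + x/(t + i/2)`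
each contribute `O(1/t)`. The extra `1/8` in the growth rate absorbs `1 + |x|`. -/
theorem norm_integral_zeta_mul_cschMul_chiRatio_le {ε : ℝ} (hε0 : 0 < ε) (hε : ε ≤ 1 / 4) :
    ∃ K, 0 < K ∧ ∀ t : ℝ, 20 ≤ t →
      ‖∫ y : ℝ, ((t / (2 * Real.pi) : ℝ) : ℂ) ^ (-(I * (y + (1 : ℝ) * I) / 2)) *
        riemannZeta (1 / 2 - I * (t + (y + (1 : ℝ) * I))) *
          cschMul (fun x => chiRatio t x * (1 + x / (t + I / 2))) (y + (1 : ℝ) * I)‖ ≤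
        K * t ^ (-(5 / 6 : ℝ) + ε) := by
  obtain ⟨K, hK, hmain⟩ := norm_integral_zeta_mul_cschMul_le hε0 hε
  obtain ⟨B, hB1, hB⟩ := norm_chiRatio_sub_one_le
  obtain ⟨C, hC, hchi⟩ := norm_chiRatio_le
  refine ⟨K * (2 * B + 1), by positivity, fun t ht => ?_⟩
  have ht0 : 0 < t := by linarith
  have htpi : 2 * Real.pi < t := by linarith [Real.pi_lt_four]
  have hpi := Real.pi_gt_three
  have hx (x : ℂ) := norm_div_add_I_div_two_le ht0 x
  have hx' (x : ℂ) : ‖x / (t + I / 2)‖ ≤ ‖x‖ :=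
    (hx x).trans (div_le_self (norm_nonneg _) (by linarith))
  have hr (x : ℂ) : ‖1 + x / (t + I / 2)‖ ≤ 1 + ‖x‖ := by
    refine (norm_add_le _ _).trans ?_
    rw [norm_one]
    linarith [hx' x]
  have hsub (x : ℂ) : ‖chiRatio t x * (1 + x / (t + I / 2)) - chiRatio t 0 * (1 + 0 / (t + I / 2))‖ ≤
      ‖chiRatio t x - 1‖ * (1 + ‖x‖) + ‖x‖ / t := by
    rw [chiRatio_zero]
    have : chiRatio t x * (1 + x / (t + I / 2)) - 1 * (1 + 0 / (t + I / 2)) =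
      (chiRatio t x - 1) * (1 + x / (t + I / 2)) + x / (t + I / 2) := by ring
    rw [this]
    refine (norm_add_le _ _).trans (add_le_add ?_ (hx x))
    rw [norm_mul]
    gcongr
    exact hr x
  refine (hmain t (fun x => chiRatio t x * (1 + x / (t + I / 2))) ((2 * B + 1) / t)
    (C * Real.exp (3 * Real.pi / 8 * t) * 8) (3 * Real.pi / 8 + 1 / 8)
    htpi (by positivity) (by positivity) (by linarith)
    (fun z hz => ?_) (fun z h0 h1 => ?_) (fun y => ?_) (fun y => ?_)).trans (le_of_eq ?_)
  · exact ((differentiableAt_chiRatio ht0 hz.1).mul (by fun_prop)).differentiableWithinAt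
  · rw [norm_mul]
    have h2 := norm_le_abs_re_add_abs_im z
    rw [abs_of_nonneg h0] at h2
    have h3 : 1 + ‖z‖ ≤ 8 * Real.exp (1 / 8 * |z.re|) := by
      have := Real.add_one_le_exp (1 / 8 * |z.re|)
      linarith
    calc _ ≤ (C * Real.exp (3 * Real.pi / 8 * t) * Real.exp (3 * Real.pi / 8 * |z.re|)) *
          (8 * Real.exp (1 / 8 * |z.re|)) :=
          mul_le_mul (hchi t htpi z h0 h1) ((hr z).trans h3) (norm_nonneg _) (by positivity)
      _ = C * Real.exp (3 * Real.pi / 8 * t) * 8 *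
          (Real.exp (3 * Real.pi / 8 * |z.re|) * Real.exp (1 / 8 * |z.re|)) := by ring
      _ = _ := by rw [← Real.exp_add, add_mul]
  · refine (hsub _).trans ?_
    have h1 := (hB t ht y).1
    have e0 : (y + (0 : ℝ) * I : ℂ) = y := by simp
    rw [e0] at h1 ⊢
    rw [norm_real, Real.norm_eq_abs]
    have hy := abs_nonneg y
    calc _ ≤ B * |y| * (1 + |y|) / t * (1 + |y|) + |y| / t := by gcongr
      _ = |y| * (B * (1 + |y|) ^ 2 + 1) / t := by ring
      _ ≤ |y| * ((2 * B + 1) * (1 + |y|) ^ 2) / t := by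
          gcongr
          nlinarith [mul_nonneg hy hy]
      _ = _ := by ring
  · refine (hsub _).trans ?_
    have h1 := (hB t ht y).2
    have hn := norm_add_I_le y
    have hy := abs_nonneg y
    calc _ ≤ B * (1 + |y|) ^ 2 / t * (2 * (1 + |y|)) + (1 + |y|) / t := by
          gcongr
          linarith
      _ = (2 * B * (1 + |y|) ^ 3 + (1 + |y|)) / t := by ring
      _ ≤ ((2 * B + 1) * (1 + |y|) ^ 3) / t := by
          have : 1 + |y| ≤ (1 + |y|) ^ 3 := le_self_pow₀ (by simp) (by norm_num)
          gcongr
          linarith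
      _ = _ := by ring
  · have : t ^ (-(5 / 6 : ℝ) + ε) = t⁻¹ * t ^ (1 / 6 + ε) := by
      rw [← Real.rpow_neg_one, ← Real.rpow_add ht0]
      congr 1
      ring
    rw [this]
    ring

/-! ### Convergence of `G` and independence of `σ`. -/

theorem norm_riemannZeta_le_of_le_re {a : ℝ} (ha : 1 < a) :
    ∃ C, 0 ≤ C ∧ ∀ s : ℂ, a ≤ s.re → ‖riemannZeta s‖ ≤ C := by
  have hs0 : Summable fun n : ℕ => 1 / ((n : ℝ) + 1) ^ a := by
    have := (summable_nat_add_iff 1).2 (Real.summable_one_div_nat_rpow.2 ha)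
    exact_mod_cast this
  refine ⟨∑' n : ℕ, 1 / ((n : ℝ) + 1) ^ a, tsum_nonneg fun n => by positivity, fun s hs => ?_⟩
  rw [zeta_eq_tsum_one_div_nat_add_one_cpow (by linarith)]
  refine tsum_of_norm_bounded hs0.hasSum fun n => ?_
  have hn : ‖((n : ℂ) + 1) ^ s‖ = ((n : ℝ) + 1) ^ s.re := by
    have := norm_cpow_eq_rpow_re_of_pos (by positivity : (0 : ℝ) < (n : ℝ) + 1) s
    exact_mod_cast this
  rw [norm_div, norm_one, hn]
  gcongr
  simp

theorem half_add_I_mul_re (t : ℝ) (x : ℂ) : (1 / 2 + I * (t + x) : ℂ).re = 1 / 2 - x.im := by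
  simp
  ring

theorem integrandG_eq (t : ℝ) (x : ℂ) :
    integrandG t x = ((t / (2 * Real.pi) : ℝ) : ℂ) ^ (I * x / 2) *
      riemannZeta (1 / 2 + I * (t + x)) * cschKernel x := rfl

theorem norm_cpow_I_mul_div_two {p : ℝ} (hp : 0 < p) (x : ℂ) :
    ‖(p : ℂ) ^ (I * x / 2)‖ = p ^ (-x.im / 2) := by
  rw [norm_cpow_eq_rpow_re_of_pos hp]
  congr 1
  simp

/-- The strip avoids the pole of `ζ`, which has `Im x = -1/2`, and the poles of the kernel at `0`
and `-2i`. -/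
theorem differentiableOn_integrandG {t : ℝ} (ht : 0 < t) {a b : ℝ} (ha : -2 < a)
    (hb : b < -(1 / 2)) : DifferentiableOn ℂ (integrandG t) {z | a ≤ z.im ∧ z.im ≤ b} := by
  intro z hz
  obtain ⟨h1, h2⟩ := hz
  have hpi := Real.pi_pos
  have hp : ((t / (2 * Real.pi) : ℝ) : ℂ) ≠ 0 := by
    have : t / (2 * Real.pi) ≠ 0 := by positivity
    exact_mod_cast this
  have hne : (1 / 2 + I * (t + z) : ℂ) ≠ 1 := fun h => by
    have := congrArg re h
    rw [half_add_I_mul_re, one_re] at this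
    linarith
  have hz0 : z ≠ 0 := fun h => by
    rw [h] at h2
    simp at h2
    linarith
  have d1 : DifferentiableAt ℂ (fun x : ℂ => ((t / (2 * Real.pi) : ℝ) : ℂ) ^ (I * x / 2)) z :=
    DifferentiableAt.const_cpow (by fun_prop) (Or.inl hp)
  have d2 : DifferentiableAt ℂ (fun x : ℂ => riemannZeta (1 / 2 + I * (t + x))) z :=
    DifferentiableAt.comp (f := fun x : ℂ => 1 / 2 + I * (t + x)) z
      (differentiableAt_riemannZeta hne) (by fun_prop)
  exact ((d1.mul d2).mul
    (differentiableAt_cschKernel hz0 (abs_lt.2 ⟨by linarith, by linarith⟩))).differentiableWithinAt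

theorem norm_integrandG_le {t : ℝ} (ht : 2 * Real.pi < t) {a b : ℝ} (ha : -2 < a)
    (hb : b < -(1 / 2)) : ∃ C, ∀ z : ℂ, a ≤ z.im → z.im ≤ b → 1 ≤ |z.re| →
      ‖integrandG t z‖ ≤ C * Real.exp (-(Real.pi / 2) * |z.re|) := by
  have hpi := Real.pi_pos
  have hp1 : 1 ≤ t / (2 * Real.pi) := (one_le_div (by positivity)).2 ht.le
  obtain ⟨C, hC0, hC⟩ := norm_riemannZeta_le_of_le_re (a := 1 / 2 - b) (by linarith)
  refine ⟨t / (2 * Real.pi) * C * (2 * Real.pi), fun z h1 h2 h3 => ?_⟩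
  rw [integrandG_eq, norm_mul, norm_mul, norm_cpow_I_mul_div_two (by linarith), mul_assoc (_ * _)]
  have h4 : (t / (2 * Real.pi)) ^ (-z.im / 2) ≤ t / (2 * Real.pi) :=
    Real.rpow_le_self_of_one_le hp1 (by linarith)
  have h5 := hC (1 / 2 + I * (t + z)) (by rw [half_add_I_mul_re]; linarith)
  have h6 := norm_cschKernel_le_of_one_le_abs_re h3
  gcongr

theorem integrable_integrandG {t : ℝ} (ht : 2 * Real.pi < t) {c : ℝ} (hc : -2 < c)
    (hc' : c < -(1 / 2)) : Integrable fun y : ℝ => integrandG t (y + c * I) := by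
  obtain ⟨C, hC⟩ := norm_integrandG_le ht hc hc'
  exact integrable_line (differentiableOn_integrandG (by linarith [Real.pi_pos]) hc hc')
    (by positivity) hC le_rfl le_rfl

theorem ofReal_sub_I_mul (y σ : ℝ) : (y - I * σ : ℂ) = y + ((-σ : ℝ) : ℂ) * I := by
  push_cast
  ring

theorem G_eq (σ t : ℝ) :
    G σ t = 1 / (2 * Real.pi * I) * ∫ y : ℝ, integrandG t (y + ((-σ : ℝ) : ℂ) * I) := by
  simp only [G, ofReal_sub_I_mul]

theorem G_eq_of_le {t : ℝ} (ht : 2 * Real.pi < t) {σ₁ σ₂ : ℝ} (h1 : 1 / 2 < σ₁) (h2 : σ₂ < 2)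
    (h : σ₁ ≤ σ₂) : G σ₁ t = G σ₂ t := by
  obtain ⟨C, hC⟩ := norm_integrandG_le ht (by linarith : -2 < -σ₂) (by linarith : -σ₁ < -(1 / 2))
  rw [G_eq, G_eq, integral_line_eq (neg_le_neg h)
    (differentiableOn_integrandG (by linarith [Real.pi_pos]) (by linarith) (by linarith))
    (by positivity) hC]

theorem G_eq_G {t : ℝ} (ht : 2 * Real.pi < t) {σ₁ σ₂ : ℝ} (h1 : 1 / 2 < σ₁) (h1' : σ₁ < 2)
    (h2 : 1 / 2 < σ₂) (h2' : σ₂ < 2) : G σ₁ t = G σ₂ t := by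
  rcases le_total σ₁ σ₂ with h | h
  · exact G_eq_of_le ht h1 h2' h
  · exact (G_eq_of_le ht h2 h1' h).symm

/-! ### Conjugation, the functional equation and the exact remainder. -/

theorem integrable_mul_cschKernel_line {g : ℂ → ℂ} (hg : Differentiable ℂ g) {C a c : ℝ}
    (ha : a < Real.pi / 2) (hc : |c| = 1)
    (hb : ∀ x : ℂ, |x.im| ≤ 1 → ‖g x‖ ≤ C * Real.exp (a * |x.re|)) :
    Integrable fun y : ℝ => g (y + c * I) * cschKernel (y + c * I) := by
  refine integrable_of_exp_decay (C := C * Real.pi) ?_ (by linarith : 0 < Real.pi / 2 - a)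
    fun y _ => ?_
  · refine (hg.continuous.comp (by fun_prop)).mul (continuous_iff_continuousAt.2 fun y => ?_)
    have hne : (y + c * I : ℂ) ≠ 0 := fun h => by
      have := congrArg im h
      simp at this
      rw [this] at hc
      simp at hc
    exact ContinuousAt.comp (f := fun y : ℝ => (y + c * I : ℂ))
      (differentiableAt_cschKernel hne (by simp [hc])).continuousAt (by fun_prop)
  · have h1 := hb (y + c * I) (by simp [hc])
    have h2 := norm_cschKernel_le_of_abs_im_eq_one (x := y + c * I) (by simpa using hc)
    have hre : (y + c * I : ℂ).re = y := by simp
    rw [hre] at h1 h2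
    rw [norm_mul]
    calc _ ≤ (C * Real.exp (a * |y|)) * (Real.pi * Real.exp (-(Real.pi / 2) * |y|)) :=
          mul_le_mul h1 h2 (norm_nonneg _) ((norm_nonneg _).trans h1)
      _ = C * Real.pi * (Real.exp (a * |y|) * Real.exp (-(Real.pi / 2) * |y|)) := by ring
      _ = _ := by
          rw [← Real.exp_add]
          congr 2
          ring

/-- The complex conjugate of `integrandG t` at the conjugate point. -/
noncomputable def conjIntegrandG (t : ℝ) (x : ℂ) : ℂ :=
  ((t / (2 * Real.pi) : ℝ) : ℂ) ^ (-(I * x / 2)) * riemannZeta (1 / 2 - I * (t + x)) * cschKernel x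

theorem conj_cschKernel (x : ℂ) : (starRingEnd ℂ) (cschKernel x) = cschKernel ((starRingEnd ℂ) x) := by
  have h2 : (starRingEnd ℂ) (2 : ℂ) = 2 := map_ofNat _ 2
  rw [cschKernel, cschKernel, map_div₀, map_mul, ← sinh_conj, map_div₀, map_mul, h2, conj_ofReal]

theorem conj_integrandG {t : ℝ} (ht : 0 < t) (y : ℝ) :
    (starRingEnd ℂ) (integrandG t (y + ((-1 : ℝ) : ℂ) * I)) =
      conjIntegrandG t (y + ((1 : ℝ) : ℂ) * I) := by
  have hpi := Real.pi_pos
  have hx : (starRingEnd ℂ) (y + ((-1 : ℝ) : ℂ) * I) = y + ((1 : ℝ) : ℂ) * I := by simp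
  have hp : (((t / (2 * Real.pi) : ℝ) : ℂ)).arg ≠ Real.pi := by
    rw [arg_ofReal_of_nonneg (by positivity)]
    exact hpi.ne
  have h2 : (starRingEnd ℂ) (2 : ℂ) = 2 := map_ofNat _ 2
  have hc := cpow_conj _ (I * (y + ((-1 : ℝ) : ℂ) * I) / 2) hp
  rw [conj_ofReal] at hc
  rw [integrandG_eq, map_mul, map_mul, conj_cschKernel, ← riemannZeta_conj, ← hc, hx, map_div₀,
    map_mul, hx, map_add (starRingEnd ℂ) (1 / 2), map_div₀, map_mul, map_add (starRingEnd ℂ) (t : ℂ),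
    hx, conjIntegrandG, h2, conj_I, map_one, conj_ofReal]
  congr 3 <;> ring

/-- At `1/2 + it` the two Gamma factors of `χ` are complex conjugates with phases `e^(∓iϑ)`, so `χ =
e^(-2iϑ)` there. -/
theorem chi_half_eq (t : ℝ) : exp (I * theta t) * chi (1 / 2 + I * t) = exp (-(I * theta t)) := by
  have hpi : (Real.pi : ℂ) ≠ 0 := by exact_mod_cast Real.pi_ne_zero
  have h2 : (starRingEnd ℂ) (2 : ℂ) = 2 := map_ofNat _ 2
  have h4 : (starRingEnd ℂ) (4 : ℂ) = 4 := map_ofNat _ 4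
  have hconj : exp (-(I * theta t)) = (starRingEnd ℂ) (exp (I * theta t)) := by
    rw [← exp_conj, map_mul, conj_I, conj_ofReal, neg_mul]
  have hG := Gamma_ne_zero (fun m => gamma_line_ne m t)
  have hp : (Real.pi : ℂ).arg ≠ Real.pi := by
    rw [arg_ofReal_of_nonneg Real.pi_pos.le]
    exact Real.pi_ne_zero.symm
  have hc : (starRingEnd ℂ) ((Real.pi : ℂ) ^ (-(I * t / 2))) = (Real.pi : ℂ) ^ (I * t / 2) := by
    have := cpow_conj _ (-(I * t / 2)) hp
    rw [conj_ofReal] at this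
    rw [← this, map_neg, map_div₀, map_mul, h2, conj_I, conj_ofReal]
    congr 1
    ring
  have e1 : (1 / 2 + I * t : ℂ) / 2 = 1 / 4 + I * (t / 2) := by ring
  have e2 : (1 - (1 / 2 + I * t) : ℂ) / 2 = (starRingEnd ℂ) (1 / 4 + I * (t / 2)) := by
    rw [map_add, map_div₀, map_mul, map_div₀, h2, h4, conj_I, map_one, conj_ofReal]
    ring
  have e3 : (-(1 - (1 / 2 + I * t)) / 2 : ℂ) = -(1 / 4) + I * t / 2 := by ring
  have e4 : (-(1 / 2 + I * t) / 2 : ℂ) = -(1 / 4) + -(I * t / 2) := by ring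
  rw [hconj, exp_theta, map_div₀, map_mul, hc, conj_ofReal, chi, Gammaℝ_def, Gammaℝ_def, e1, e2,
    e3, e4, cpow_add _ _ hpi, cpow_add _ _ hpi, cpow_neg _ (I * t / 2), Gamma_conj]
  have h5 : (Real.pi : ℂ) ^ (I * t / 2) ≠ 0 := by simp [cpow_eq_zero_iff, hpi]
  have h6 : (Real.pi : ℂ) ^ (-(1 / 4) : ℂ) ≠ 0 := by simp [cpow_eq_zero_iff, hpi]
  have h7 : (‖Gamma (1 / 4 + I * (t / 2))‖ : ℂ) ≠ 0 := by exact_mod_cast norm_ne_zero_iff.2 hG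
  generalize Gamma (1 / 4 + I * (t / 2)) = γ at *
  field_simp

/-- `(t / 2π) ^ (i x / 2) (s - 1) ζ(s) / (s₀ - 1)` with `s = 1/2 + i (t + x)`, `s₀ = 1/2 + i t`. -/
noncomputable def entireIntegrand (t : ℝ) (x : ℂ) : ℂ :=
  ((t / (2 * Real.pi) : ℝ) : ℂ) ^ (I * x / 2) * zetaMulSubOne (1 / 2 + I * (t + x)) /
    (-(1 / 2) + I * t)

theorem neg_half_add_ne_zero (t : ℝ) : (-(1 / 2) + I * t : ℂ) ≠ 0 := fun h => by
  have := congrArg re h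
  simp at this

theorem differentiable_entireIntegrand {t : ℝ} (ht : 0 < t) :
    Differentiable ℂ (entireIntegrand t) := by
  have hpi := Real.pi_pos
  have hp : ((t / (2 * Real.pi) : ℝ) : ℂ) ≠ 0 := by
    have : t / (2 * Real.pi) ≠ 0 := by positivity
    exact_mod_cast this
  have d1 : Differentiable ℂ (fun x : ℂ => ((t / (2 * Real.pi) : ℝ) : ℂ) ^ (I * x / 2)) :=
    Differentiable.const_cpow (by fun_prop) (Or.inl hp)
  exact (d1.mul (differentiable_zetaMulSubOne.comp (by fun_prop))).div_const _

theorem norm_entireIntegrand_le {t : ℝ} (ht : 2 * Real.pi < t) : ∃ C, ∀ x : ℂ, |x.im| ≤ 1 →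
    ‖entireIntegrand t x‖ ≤ C * Real.exp (7 * Real.pi / 16 * |x.re|) := by
  have hpi := Real.pi_pos
  have ht0 : 0 < t := by linarith
  have hp1 : 1 ≤ t / (2 * Real.pi) := (one_le_div (by positivity)).2 ht.le
  obtain ⟨C, hC, hz⟩ := norm_zetaMulSubOne_le
  refine ⟨t / (2 * Real.pi) * (C * Real.exp (7 * Real.pi / 16 * t)) / ‖(-(1 / 2) + I * t : ℂ)‖,
    fun x hx => ?_⟩
  have hx' := abs_le.1 hx
  have h1 : (t / (2 * Real.pi)) ^ (-x.im / 2) ≤ t / (2 * Real.pi) :=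
    Real.rpow_le_self_of_one_le hp1 (by linarith)
  have h2 := hz (1 / 2 + I * (t + x)) (by rw [half_add_I_mul_re]; linarith)
    (by rw [half_add_I_mul_re]; linarith)
  have hsim : (1 / 2 + I * (t + x) : ℂ).im = t + x.re := by simp
  have h3 : |t + x.re| ≤ t + |x.re| := by
    simpa [abs_of_pos ht0] using abs_add_le t x.re
  rw [hsim] at h2
  have h4 : Real.exp (7 * Real.pi / 16 * |t + x.re|) ≤
      Real.exp (7 * Real.pi / 16 * t) * Real.exp (7 * Real.pi / 16 * |x.re|) := by
    rw [← Real.exp_add, ← mul_add]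
    gcongr
  rw [entireIntegrand, norm_div, norm_mul, norm_cpow_I_mul_div_two (by linarith)]
  calc _ ≤ t / (2 * Real.pi) * (C * (Real.exp (7 * Real.pi / 16 * t) *
        Real.exp (7 * Real.pi / 16 * |x.re|))) / ‖(-(1 / 2) + I * t : ℂ)‖ := by
        gcongr
        exact h2.trans (by gcongr)
    _ = _ := by ring

theorem entireIntegrand_zero (t : ℝ) : entireIntegrand t 0 = riemannZeta (1 / 2 + I * t) := by
  have h0 : (1 / 2 + I * t : ℂ) ≠ 0 := fun h => by
    have := congrArg re h
    simp at this
  have h1 : (1 / 2 + I * t : ℂ) ≠ 1 := fun h => by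
    have := congrArg re h
    norm_num at this
  have h2 : (1 / 2 + I * t - 1 : ℂ) = -(1 / 2) + I * t := by ring
  rw [entireIntegrand, add_zero, zetaMulSubOne_eq h0 h1, h2, mul_zero, zero_div, cpow_zero, one_mul,
    mul_div_cancel_left₀ _ (neg_half_add_ne_zero t)]

theorem add_I_div_two_ne_zero (t : ℝ) : (t + I / 2 : ℂ) ≠ 0 := fun h => by
  have := congrArg im h
  simp at this

/-- The last factor is `(s-1)/(s₀-1)`, the price of removing the pole of `ζ` at `x = -t - i/2` from
the strip `|Im x| ≤ 1`. -/
theorem entireIntegrand_eq {t : ℝ} {x : ℂ} (h0 : (1 / 2 + I * (t + x) : ℂ) ≠ 0)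
    (h1 : (1 / 2 + I * (t + x) : ℂ) ≠ 1) :
    entireIntegrand t x = ((t / (2 * Real.pi) : ℝ) : ℂ) ^ (I * x / 2) *
      riemannZeta (1 / 2 + I * (t + x)) * (1 + x / (t + I / 2)) := by
  have h2 : (-(1 / 2) + I * t : ℂ) = I * (t + I / 2) := by linear_combination -(1 / 2 : ℂ) * I_sq
  have h3 : (1 / 2 + I * (t + x) - 1 : ℂ) = I * (t + I / 2) * (1 + x / (t + I / 2)) := by
    have : (t + I / 2 : ℂ) * (1 + x / (t + I / 2)) = t + I / 2 + x := by
      rw [mul_add, mul_one, mul_div_cancel₀ _ (add_I_div_two_ne_zero t)]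
    rw [mul_assoc, this]
    linear_combination -(1 / 2 : ℂ) * I_sq
  rw [entireIntegrand, zetaMulSubOne_eq h0 h1, h3, h2, mul_assoc (I * _), mul_div_assoc,
    mul_div_cancel_left₀ _ (mul_ne_zero I_ne_zero (add_I_div_two_ne_zero t))]
  ring

/-- Splitting `p^(ix/2) = p^(-ix/2) p^(ix)` lets `p^(ix)` compensate the variation of `χ`, so what
remains is the conjugate integrand times a ratio close to `1`. -/
theorem cpow_mul_riemannZeta_eq {t : ℝ} (ht : 0 < t) {x : ℂ} (h0 : (1 / 2 + I * (t + x) : ℂ) ≠ 0)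
    (h1 : (1 / 2 + I * (t + x) : ℂ).re < 1) :
    ((t / (2 * Real.pi) : ℝ) : ℂ) ^ (I * x / 2) * riemannZeta (1 / 2 + I * (t + x)) =
      chi (1 / 2 + I * t) * (((t / (2 * Real.pi) : ℝ) : ℂ) ^ (-(I * x / 2)) *
        riemannZeta (1 / 2 - I * (t + x)) * chiRatio t x) := by
  have hpi := Real.pi_pos
  have hp : ((t / (2 * Real.pi) : ℝ) : ℂ) ≠ 0 := by
    have : t / (2 * Real.pi) ≠ 0 := by positivity
    exact_mod_cast this
  have h2 : (1 - (1 / 2 + I * (t + x)) : ℂ) = 1 / 2 - I * (t + x) := by ring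
  have h3 : I * x / 2 = -(I * x / 2) + I * x := by ring
  rw [riemannZeta_eq_chi_mul h0 h1, h2, chiRatio]
  nth_rewrite 1 [h3]
  rw [cpow_add _ _ hp]
  have := chi_half_ne_zero t
  generalize chi (1 / 2 + I * t) = χ₀ at *
  generalize chi (1 / 2 + I * (t + x)) = χ
  field_simp

theorem ofReal_add_mul_I_ne_zero (y : ℝ) {c : ℝ} (hc : c ≠ 0) : (y + c * I : ℂ) ≠ 0 := fun h => by
  have := congrArg im h
  simp at this
  exact hc this

/-- The exact remainder of the approximation `Z(t) ≈ 2 Re (e ^ (i ϑ(t)) G(t))`. -/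
theorem hardyZ_sub_eq {t : ℝ} (ht : 2 * Real.pi < t) :
    hardyZ t - ((2 * (exp (I * theta t) * G 1 t).re : ℝ) : ℂ) =
      (exp (I * theta t) * (starRingEnd ℂ) (∫ y : ℝ,
          ((t / (2 * Real.pi) : ℝ) : ℂ) ^ (-(I * (y + (1 : ℝ) * I) / 2)) *
            riemannZeta (1 / 2 - I * (t + (y + (1 : ℝ) * I))) *
              cschMul (fun x => x / (t - I / 2)) (y + (1 : ℝ) * I)) -
        exp (-(I * theta t)) * ∫ y : ℝ,
          ((t / (2 * Real.pi) : ℝ) : ℂ) ^ (-(I * (y + (1 : ℝ) * I) / 2)) *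
            riemannZeta (1 / 2 - I * (t + (y + (1 : ℝ) * I))) *
              cschMul (fun x => chiRatio t x * (1 + x / (t + I / 2))) (y + (1 : ℝ) * I)) /
        (2 * Real.pi * I) := by
  set A := ∫ y : ℝ,
    ((t / (2 * Real.pi) : ℝ) : ℂ) ^ (-(I * (y + (1 : ℝ) * I) / 2)) *
            riemannZeta (1 / 2 - I * (t + (y + (1 : ℝ) * I))) *
              cschMul (fun x => x / (t - I / 2)) (y + (1 : ℝ) * I) with hA
  set B := ∫ y : ℝ,
          ((t / (2 * Real.pi) : ℝ) : ℂ) ^ (-(I * (y + (1 : ℝ) * I) / 2)) *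
            riemannZeta (1 / 2 - I * (t + (y + (1 : ℝ) * I))) *
              cschMul (fun x => chiRatio t x * (1 + x / (t + I / 2))) (y + (1 : ℝ) * I) with hB
  have hpi := Real.pi_gt_three
  have ht0 : 0 < t := by linarith
  obtain ⟨C, hC⟩ := norm_entireIntegrand_le ht
  have hd := differentiable_entireIntegrand ht0
  have ha : 7 * Real.pi / 16 < Real.pi / 2 := by linarith
  have hpole := integral_mul_cschKernel_sub hd ha (by positivity) hC
  rw [entireIntegrand_zero] at hpole
  have im1 := integrable_mul_cschKernel_line hd (c := -1) ha (by simp) hC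
  have ip1 := integrable_mul_cschKernel_line hd (c := 1) ha (by simp) hC
  have iG : Integrable fun y : ℝ => integrandG t (y + ((-1 : ℝ) : ℂ) * I) :=
    integrable_integrandG ht (by norm_num) (by norm_num)
  have iH : Integrable fun y : ℝ => conjIntegrandG t (y + ((1 : ℝ) : ℂ) * I) := by
    have := iG.norm.mono'
      (continuous_conj.comp_aestronglyMeasurable iG.aestronglyMeasurable)
      (Eventually.of_forall fun y => (norm_conj _).le)
    simpa only [conj_integrandG ht0] using this
  have hconj : (starRingEnd ℂ) (∫ y : ℝ, integrandG t (y + ((-1 : ℝ) : ℂ) * I)) =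
      ∫ y : ℝ, conjIntegrandG t (y + ((1 : ℝ) : ℂ) * I) := by
    rw [← integral_conj]
    simp only [conj_integrandG ht0]
  -- Lower line: the `1` in `1 + x/(t + i/2)` gives the integral of `G`, the rest is the conjugate
  -- of `A`.
  have hm1 : ∫ y : ℝ, entireIntegrand t (y + (-1 : ℝ) * I) * cschKernel (y + (-1 : ℝ) * I) =
      (∫ y : ℝ, integrandG t (y + ((-1 : ℝ) : ℂ) * I)) + (starRingEnd ℂ) A := by
    rw [← sub_eq_iff_eq_add', ← integral_sub im1 iG, hA, ← integral_conj]
    refine integral_congr_ae (Eventually.of_forall fun y => ?_)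
    have hre : (1 / 2 + I * (t + (y + (-1 : ℝ) * I)) : ℂ).re = 3 / 2 := by
      rw [half_add_I_mul_re]
      norm_num
    have h0 : (1 / 2 + I * (t + (y + (-1 : ℝ) * I)) : ℂ) ≠ 0 := fun h => by
      rw [h] at hre
      norm_num at hre
    have h1 : (1 / 2 + I * (t + (y + (-1 : ℝ) * I)) : ℂ) ≠ 1 := fun h => by
      rw [h] at hre
      norm_num at hre
    have hx : (starRingEnd ℂ) (y + ((1 : ℝ) : ℂ) * I) = y + ((-1 : ℝ) : ℂ) * I := by simp
    have hw : (starRingEnd ℂ) (t - I / 2 : ℂ) = t + I / 2 := by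
      have h2 : (starRingEnd ℂ) (2 : ℂ) = 2 := map_ofNat _ 2
      rw [map_sub, map_div₀, conj_I, conj_ofReal, h2]
      ring
    have hH : (starRingEnd ℂ) (conjIntegrandG t (y + ((1 : ℝ) : ℂ) * I)) =
        integrandG t (y + ((-1 : ℝ) : ℂ) * I) := by
      rw [← conj_integrandG ht0, conj_conj]
    have hQ : ((t / (2 * Real.pi) : ℝ) : ℂ) ^ (-(I * (y + (1 : ℝ) * I) / 2)) *
            riemannZeta (1 / 2 - I * (t + (y + (1 : ℝ) * I))) *
              cschMul (fun x => x / (t - I / 2)) (y + (1 : ℝ) * I) =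
        conjIntegrandG t (y + ((1 : ℝ) : ℂ) * I) * ((y + ((1 : ℝ) : ℂ) * I) / (t - I / 2)) := by
      rw [cschMul_of_ne (ofReal_add_mul_I_ne_zero y one_ne_zero), conjIntegrandG, zero_div, sub_zero]
      ring
    simp only
    rw [hQ, map_mul, hH, map_div₀, hx, hw, entireIntegrand_eq h0 h1, integrandG_eq]
    ring
  -- Upper line: `cschMul` subtracts the value `1` of its weight at `0`, which separates the
  -- conjugate of the integral of `G` from the error `B`.
  have hp1 : ∫ y : ℝ, entireIntegrand t (y + (1 : ℝ) * I) * cschKernel (y + (1 : ℝ) * I) =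
      chi (1 / 2 + I * t) * ((∫ y : ℝ, conjIntegrandG t (y + ((1 : ℝ) : ℂ) * I)) + B) := by
    rw [mul_add, ← sub_eq_iff_eq_add', hB, ← integral_const_mul, ← integral_const_mul,
      ← integral_sub ip1 (iH.const_mul _)]
    refine integral_congr_ae (Eventually.of_forall fun y => ?_)
    have hre : (1 / 2 + I * (t + (y + (1 : ℝ) * I)) : ℂ).re = -(1 / 2) := by
      rw [half_add_I_mul_re]
      norm_num
    have h0 : (1 / 2 + I * (t + (y + (1 : ℝ) * I)) : ℂ) ≠ 0 := fun h => by
      rw [h] at hre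
      norm_num at hre
    have h1 : (1 / 2 + I * (t + (y + (1 : ℝ) * I)) : ℂ) ≠ 1 := fun h => by
      rw [h] at hre
      norm_num at hre
    simp only
    rw [entireIntegrand_eq h0 h1, cpow_mul_riemannZeta_eq ht0 h0 (by rw [hre]; norm_num),
      cschMul_of_ne (ofReal_add_mul_I_ne_zero y one_ne_zero), conjIntegrandG, chiRatio_zero]
    ring
  rw [hm1, hp1] at hpole
  have hG1 : G 1 t = 1 / (2 * Real.pi * I) * ∫ y : ℝ, integrandG t (y + ((-1 : ℝ) : ℂ) * I) :=
    G_eq 1 t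
  have h2 : (starRingEnd ℂ) (2 : ℂ) = 2 := map_ofNat _ 2
  have hθ : (starRingEnd ℂ) (exp (I * theta t)) = exp (-(I * theta t)) := by
    rw [← exp_conj, map_mul, conj_I, conj_ofReal, neg_mul]
  have hpiC : (Real.pi : ℂ) ≠ 0 := by exact_mod_cast Real.pi_ne_zero
  have hI := I_ne_zero
  rw [← add_conj, map_mul, hθ, hG1, map_mul, hconj, hardyZ, map_div₀, map_mul, map_mul, map_one, h2,
    conj_I, conj_ofReal]
  have hχ := chi_half_eq t
  set M := ∫ y : ℝ, integrandG t (y + ((-1 : ℝ) : ℂ) * I)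
  set N := ∫ y : ℝ, conjIntegrandG t (y + ((1 : ℝ) : ℂ) * I)
  generalize riemannZeta (1 / 2 + I * t) = ζ₀ at *
  generalize chi (1 / 2 + I * t) = χ₀ at *
  generalize exp (I * theta t) = e at *
  rw [← hχ, eq_div_iff (by simp [hpiC])]
  have hMN (w : ℂ) : 1 / (2 * Real.pi * I) * w * (2 * Real.pi * I) = w := by field_simp
  have hMN' (w : ℂ) : 1 / (2 * Real.pi * -I) * w * (2 * Real.pi * I) = -w := by field_simp
  linear_combination (-e) * hpole - e * hMN M - e * χ₀ * hMN' N

theorem exists_norm_hardyZ_sub_le {ε : ℝ} (hε0 : 0 < ε) (hε : ε ≤ 1 / 4) :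
    ∃ K, ∀ t : ℝ, 20 ≤ t →
      ‖hardyZ t - ((2 * (exp (I * theta t) * G 1 t).re : ℝ) : ℂ)‖ ≤
        K * t ^ (-(5 / 6 : ℝ) + ε) := by
  obtain ⟨K₁, hK₁, h1⟩ := norm_integral_zeta_mul_cschMul_div_le hε0 hε
  obtain ⟨K₂, hK₂, h2⟩ := norm_integral_zeta_mul_cschMul_chiRatio_le hε0 hε
  refine ⟨K₁ + K₂, fun t ht => ?_⟩
  have hpi := Real.pi_gt_three
  rw [hardyZ_sub_eq (by linarith [Real.pi_lt_four]), norm_div]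
  have hn : ‖(2 * Real.pi * I : ℂ)‖ = 2 * Real.pi := by
    simp [abs_of_pos Real.pi_pos]
  have he : ‖exp (I * theta t)‖ = 1 := by simp [norm_exp]
  have he' : ‖exp (-(I * theta t))‖ = 1 := by simp [norm_exp]
  rw [hn]
  refine (div_le_self (norm_nonneg _) (by linarith)).trans ((norm_sub_le _ _).trans ?_)
  rw [norm_mul, norm_mul, he, he', one_mul, one_mul, norm_conj, add_mul]
  exact add_le_add (h1 t ht) (h2 t ht)

end RiemannSiegelApprox

theorem mainTheorem1 :
    (∀ t : ℝ, 2 * Real.pi < t → ∀ σ : ℝ, 1 / 2 < σ → σ < 2 →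
      Integrable (fun y : ℝ => RiemannSiegelApprox.integrandG t (y - I * σ))) ∧
    (∀ t : ℝ, 2 * Real.pi < t → ∀ σ₁ σ₂ : ℝ, 1 / 2 < σ₁ → σ₁ < 2 → 1 / 2 < σ₂ → σ₂ < 2 →
      RiemannSiegelApprox.G σ₁ t = RiemannSiegelApprox.G σ₂ t) ∧
    (∀ σ : ℝ, 1 / 2 < σ → σ < 2 → ∀ ε : ℝ, 0 < ε →
      (fun t : ℝ => RiemannSiegelApprox.hardyZ t -
          ((2 * (exp (I * RiemannSiegelApprox.theta t) * RiemannSiegelApprox.G σ t).re : ℝ) : ℂ))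
        =O[atTop] (fun t : ℝ => t ^ (-(5 / 6 : ℝ) + ε))) := by
  refine ⟨fun t ht σ h1 h2 => ?_, fun t ht σ₁ σ₂ h1 h1' h2 h2' =>
    RiemannSiegelApprox.G_eq_G ht h1 h1' h2 h2', fun σ h1 h2 ε hε => ?_⟩
  · simp only [RiemannSiegelApprox.ofReal_sub_I_mul]
    exact RiemannSiegelApprox.integrable_integrandG ht (by linarith) (by linarith)
  -- The estimate is available for `ε ≤ 1/4` and `σ = 1`; a smaller exponent is stronger for `t ≥
  -- 1`, and `G` does not depend on `σ`.
  · obtain ⟨K, hK⟩ := RiemannSiegelApprox.exists_norm_hardyZ_sub_le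
      (ε := min ε (1 / 4)) (by positivity) (min_le_right _ _)
    have hO : (fun t : ℝ => t ^ (-(5 / 6 : ℝ) + min ε (1 / 4))) =O[atTop]
        (fun t : ℝ => t ^ (-(5 / 6 : ℝ) + ε)) := by
      refine IsBigO.of_bound 1 ((eventually_ge_atTop 1).mono fun t ht => ?_)
      rw [one_mul, Real.norm_of_nonneg (by positivity), Real.norm_of_nonneg (by positivity)]
      gcongr
      exact min_le_left _ _
    refine IsBigO.trans (IsBigO.of_bound K ((eventually_ge_atTop 20).mono fun t ht => ?_)) hO
    rw [RiemannSiegelApprox.G_eq_G (by linarith [Real.pi_lt_four]) h1 h2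
      (by norm_num : (1 / 2 : ℝ) < 1) (by norm_num), Real.norm_of_nonneg (r := t ^ _) (by positivity)]
    exact hK t ht
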